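/- Fix homogeneous coordinates $(\mathcal X:\mathcal Y:\mathcal Z)$ on $\mathbb P^2=\mathbb P^2_{\mathbb C}$, let $L$ be the line $\mathcal Z=0$ and $p=(1:0:0)$. Let $C$ be an integral plane curve of degree $d$, with equation $F=0$, having one place at infinity at $p$, that is, $C\cap L=\{p\}$ and $C$ is reduced and unibranch at $p$. Let $\mathcal P_C$ be the pencil of curves $\lambda F+\mu \mathcal Z^d=0$ and let $p_{0\,1}=p,\,p_{0\,2},\ldots,p_{0\,s_0}$ be its (proper and infinitely near) base points, where $p_{0\,i+1}$ lies on the exceptional curve created by blowing up $p_{0\,i}$. Let $k\ge 0$. For $1\le j\le k$ let $C_j$ be a curve $F+c_j\mathcal Z^d=0$ of $\mathcal P_C$ ($c_j\in\mathbb C$), let $s_j\ge 1$, and let $p_{j\,1},\ldots,p_{j\,s_j}$ be free infinitely near points lying on the strict transforms of $C_j$, where $p_{j\,1}$ lies on the exceptional curve of $p_{0\,s_0}$, $p_{j\,\ell+1}$ lies on the exceptional curve of $p_{j\,\ell}$, and $p_{1\,1},\ldots,p_{k\,1}$ are distinct. Here a point $q$ is proximate to $r$ if it is obtained after blowing up $r$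 and lies on the strict transform of the exceptional curve $E_r$, and $q$ is free if it is not proximate to two different points. Let $\widetilde X$ be the surface obtained by blowing up $\mathbb P^2$ at all the points $p_{j\,\ell}$, $0\le j\le k$, $1\le \ell\le s_j$. Write $E_{0\,0}^*$ for the total transform of a line and $E_{j\,\ell}^*$, $\widetilde E_{j\,\ell}$ for the total and strict transforms on $\widetilde X$ of the exceptional curve of $p_{j\,\ell}$. The classes of $E_{0\,0}^*$ and the $E_{j\,\ell}^*$ form an orthogonal basis of $\operatorname{NS}_{\mathbb R}(\widetilde X)$ with self-intersections $1$ and $-1$ respectively. Let $P\subset \operatorname{NS}_{\mathbb R}(\widetilde X)$ be the convex cone generated by the classes of the strict transforms $\widetilde L,\widetilde C_1,\ldots,\widetilde C_k$ and of all the $\widetilde E_{j\,\ell}$, and let $$P^\vee=\{x\in\operatorname{NS}_{\mathbb R}(\widetilde X)\mid x\cdot y\ge 0\text{ for all }y\in P\}.$$ For each point $q=p_{j\,m}$ let $\varphi_{j\,m}$ be an analytically irreducible germ of curve at $p$ whose strict transform on the blow-up at $q$ is transversal to the exceptional curve $E_q$ at a general point of $E_q$ (a point lying on no other exceptional curve and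 not on the strict transform of $L$). Let $\varphi_L$ be the germ of $L$ at $p$, let $(\cdot,\cdot)_p$ denote the intersection multiplicity at $p$, and let $\operatorname{mult}_r(\varphi)$ denote the multiplicity at $r$ of the strict transform of $\varphi$. Put $D_{0\,0}=E_{0\,0}^*$ and, for $m\ge 1$, $$D_{0\,m}=(\varphi_L,\varphi_{0\,m})_p\,E_{0\,0}^*-\sum_{\ell=1}^{m}\operatorname{mult}_{p_{0\,\ell}}(\varphi_{0\,m})\,E_{0\,\ell}^*\qquad(1\le m\le s_0),$$ $$D_{j\,m}=(\varphi_L,\varphi_{j\,m})_p\,E_{0\,0}^*-\sum_{\ell=1}^{s_0}\operatorname{mult}_{p_{0\,\ell}}(\varphi_{j\,m})\,E_{0\,\ell}^*-\sum_{\ell=1}^{m}\operatorname{mult}_{p_{j\,\ell}}(\varphi_{j\,m})\,E_{j\,\ell}^*\qquad(1\le j\le k,\ 1\le m\le s_j).$$ For a nonempty $J\subseteq\{1,\ldots,k\}$, a tuple $\bar\ell_J=(\ell_j)_{j\in J}\in \mathcal S_J=\prod_{j\in J}\{1,\ldots,s_j\}$ and $0\le m\le s_0-1$, put $\Pi_{\bar\ell_J}=\prod_{j\in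 J}\ell_j$, $a_m=D_{0\,m}\cdot D_{0\,s_0}$ and $$D_{0\,m}^{J,\bar\ell_J}=a_m\sum_{j\in J}\frac{\Pi_{\bar\ell_J}}{\ell_j}\,D_{j\,\ell_j}+\Pi_{\bar\ell_J}\,D_{0\,m}.$$ Then $P^\vee$ is the convex cone generated by the classes of the divisors $D_{0\,m}$, $0\le m\le s_0$, and $D_{0\,m}^{J,\bar\ell_J}$, where $\emptyset\ne J\subseteq\{1,\ldots,k\}$, $\bar\ell_J\in\mathcal S_J$ and $0\le m\le s_0-1$. -/

import Mathlib

open scoped MvPowerSeries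

namespace PencilCone

noncomputable section

/-! ### Germs of curves and infinitely near points

Homogeneous coordinates on the complex projective plane are `(X : Y : Z)` (the variables `0, 1, 2`),
the line at infinity `L` is `Z = 0`, and `p = (1 : 0 : 0)`.  Local coordinates at `p` are
`u = Z / X` and `v = Y / X` (the variables `0` and `1` of the power series ring). -/

/-- Germs at a smooth point of a surface, in local coordinates `u = X 0`, `v = X 1`
(the completed local ring). -/
abbrev Germ : Type := MvPowerSeries (Fin 2) ℂ

/-- Points of the exceptional curve (the projective line of tangent directions) of the blow-up of
a point with local coordinates `u, v`: `fin c` is the direction of `v = c u`, and `inf` is the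
direction of `u = 0`. -/
inductive Dir : Type
  | fin (c : ℂ) : Dir
  | inf : Dir

/-- A point equal or infinitely near to `p`, given by the successive points chosen on the created
exceptional curves: `[]` is `p` itself, and `q ++ [t]` is the point `t` of the exceptional curve
`E_q` of the blow-up at `q`.  So `q` is infinitely near to `r` iff `r` is a prefix of `q`. -/
abbrev Pt : Type := List Dir

/-- The blow-up map in the local coordinates centred at the point `t` of the exceptional curve:
`(u, v) ↦ (u, u (v + c))` for `t = fin c`, and `(u, v) ↦ (u v, v)` for `t = inf`. -/
def chart : Dir → Fin 2 → Germ
  | .fin c => ![MvPowerSeries.X 0,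
      MvPowerSeries.X 0 * (MvPowerSeries.X 1 + MvPowerSeries.C c)]
  | .inf => ![MvPowerSeries.X 0 * MvPowerSeries.X 1, MvPowerSeries.X 1]

/-- The coordinate that is a local equation of the exceptional curve at its point `t`. -/
def excIdx : Dir → Fin 2
  | .fin _ => 0
  | .inf => 1

/-- Local equation at the point `t` of the exceptional curve just created. -/
def excEq (t : Dir) : Germ := MvPowerSeries.X (excIdx t)

/-- Total transform of a germ at the point `t` of the exceptional curve. -/
def totalTransform (t : Dir) (g : Germ) : Germ := MvPowerSeries.subst (chart t) g

/-- Division by the `m`-th power of the equation of the exceptional curve at `t` (used only on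
multiples of that power). -/
def divExc (t : Dir) (m : ℕ) (g : Germ) : Germ :=
  fun e => MvPowerSeries.coeff (e + Finsupp.single (excIdx t) m) g

/-- Multiplicity of a (nonzero) germ: the order of the power series. -/
def mult (g : Germ) : ℕ := g.order.toNat

/-- Strict transform of a germ at the point `t` of the exceptional curve. -/
def strictStep (g : Germ) (t : Dir) : Germ := divExc t (mult g) (totalTransform t g)

/-- Strict transform of a germ at an infinitely near point. -/
def strictAt (q : Pt) (g : Germ) : Germ := q.foldl strictStep g

/-- The strict transform of the germ `g` goes through `q`. -/
def PassesThrough (g : Germ) (q : Pt) : Prop :=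
  MvPowerSeries.constantCoeff (strictAt q g) = 0

/-- Multiplicity at `q` of the strict transform of `g`. -/
def multAt (q : Pt) (g : Germ) : ℕ := mult (strictAt q g)

/-- `q` is proximate to `r`: `q` is a point of some later blow-up lying on the strict transform of
the exceptional curve `E_r`, whose equation at the point `r ++ [t]` is `excEq t`. -/
def Proximate (q r : Pt) : Prop :=
  ∃ (t : Dir) (q' : Pt), q = r ++ t :: q' ∧ PassesThrough (excEq t) q'

/-- A point is free if it is not a satellite, that is, not proximate to two different points. -/
def IsFree (q : Pt) : Prop :=
  ∀ r r' : Pt, Proximate q r → Proximate q r' → r = r'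

/-- Intersection multiplicity of two germs, `dim ℂ[[u, v]] / (g, h)`. -/
def intMult (g h : Germ) : ℕ := Module.finrank ℂ (Germ ⧸ Ideal.span {g, h})

/-- The germ of the line at infinity at `p`. -/
def lineGerm : Germ := MvPowerSeries.X 0

/-- `φ` is an analytically irreducible germ at `p` whose strict transform on the blow-up at `q` is
transversal to the exceptional curve `E_q` at a general point of `E_q`; a point of `E_q` is general
if it lies neither on another exceptional curve nor on the strict transform of `L`. -/
def IsCurvette (φ : Germ) (q : Pt) : Prop :=
  Irreducible φ ∧ ∃ t : Dir,
    intMult (strictAt (q ++ [t]) φ) (excEq t) = 1 ∧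
    (∀ r : Pt, Proximate (q ++ [t]) r → r = q) ∧
    ¬ PassesThrough lineGerm (q ++ [t])

/-! ### Plane curves with one place at infinity and pencils at infinity -/

/-- The germ at `p` of the plane curve with homogeneous equation `G`, i.e. `G(1, v, u)`. -/
def germAt (G : MvPolynomial (Fin 3) ℂ) : Germ :=
  ((MvPolynomial.aeval ![1, MvPolynomial.X 1, MvPolynomial.X 0] G :
    MvPolynomial (Fin 2) ℂ) : MvPowerSeries (Fin 2) ℂ)

/-- `F` is the equation of an integral plane curve of degree `d` with one place at infinity, the
point at infinity being `p`: it meets `L` exactly in `p` and is reduced and unibranch there. -/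
structure OnePlaceAtInfinity (F : MvPolynomial (Fin 3) ℂ) (d : ℕ) : Prop where
  homogeneous : F.IsHomogeneous d
  integral : Irreducible F
  meets : ∀ x : Fin 3 → ℂ, x ≠ 0 → x 2 = 0 → (MvPolynomial.eval x F = 0 ↔ x 1 = 0)
  unibranch : Irreducible (germAt F)

/-- The member `F + c Z ^ d` of the pencil at infinity (all members except `d L`). -/
def member (F : MvPolynomial (Fin 3) ℂ) (d : ℕ) (c : ℂ) : MvPolynomial (Fin 3) ℂ :=
  F + MvPolynomial.C c * MvPolynomial.X 2 ^ d

/-- Transform, at the point `t` of the exceptional curve, of the pencil of germs spanned by the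
pair: total transform with the exceptional fixed part removed. -/
def pencilStep (P : Germ × Germ) (t : Dir) : Germ × Germ :=
  (divExc t (min (mult P.1) (mult P.2)) (totalTransform t P.1),
   divExc t (min (mult P.1) (mult P.2)) (totalTransform t P.2))

/-- Transform at `q` of the pencil spanned by `F` and `Z ^ d`. -/
def pencilAt (F : MvPolynomial (Fin 3) ℂ) (d : ℕ) (q : Pt) : Germ × Germ :=
  q.foldl pencilStep (germAt F, germAt (MvPolynomial.X 2 ^ d))

/-- `q` is a (proper or infinitely near) base point of the pencil spanned by `F` and `Z ^ d`. -/
def IsBasePoint (F : MvPolynomial (Fin 3) ℂ) (d : ℕ) (q : Pt) : Prop :=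
  MvPowerSeries.constantCoeff (pencilAt F d q).1 = 0 ∧
  MvPowerSeries.constantCoeff (pencilAt F d q).2 = 0

/-! ### Configurations extending a pencil at infinity -/

/-- A curve with one place at infinity, together with a configuration `B ∪ D` where `B` consists
of the base points `p_{0 1}, …, p_{0 s₀}` of the pencil, and `D` of points `p_{j 1}, …, p_{j s_j}`
(`j = 1, …, k`).  The point `p_{0 i}` is the prefix of length `i - 1` of `last = p_{0 s₀}`, and
`p_{j ℓ}` is `last` followed by the first `ℓ` entries of `tail j`. -/
structure Config where
  /-- degree of the curve -/
  d : ℕ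
  /-- equation of the curve -/
  F : MvPolynomial (Fin 3) ℂ
  onePlace : OnePlaceAtInfinity F d
  /-- the last base point of the pencil -/
  last : Pt
  base : ∀ q : Pt, IsBasePoint F d q ↔ q <+: last
  /-- number of chains of additional points -/
  k : ℕ
  /-- successive directions of the additional points of the `j`-th chain -/
  tail : Fin k → Pt
  tail_ne_nil : ∀ j, tail j ≠ []
  /-- the points `p_{j 1}` of `E_{0 s₀}` are distinct -/
  first_ne : ∀ i j, i ≠ j → (tail i).take 1 ≠ (tail j).take 1
  /-- the points `p_{j ℓ}`, `1 ≤ ℓ`, are free -/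
  free : ∀ j (ℓ : Fin (tail j).length), IsFree (last ++ (tail j).take (ℓ + 1))
  /-- `C_j` is the curve `F + c_j Z ^ d` of the pencil -/
  c : Fin k → ℂ
  /-- the points `p_{j ℓ}`, `1 ≤ ℓ`, lie on the strict transforms of `C_j` -/
  passes : ∀ j (ℓ : Fin (tail j).length),
    PassesThrough (germAt (member F d (c j))) (last ++ (tail j).take (ℓ + 1))

namespace Config

variable (S : Config)

/-- The number `s₀ = n` of base points. -/
def s₀ : ℕ := S.last.length + 1

/-- The number `s_j ≥ 1` of points of the `j`-th additional chain. -/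
def s (j : Fin S.k) : ℕ := (S.tail j).length

/-- Indices of the points: `inl i` stands for `0 (i + 1)`, and `inr ⟨j, ℓ⟩` for `j (ℓ + 1)`. -/
abbrev Idx : Type := Fin S.s₀ ⊕ (Σ j : Fin S.k, Fin (S.s j))

/-- The points of the configuration. -/
def pt : S.Idx → Pt
  | .inl i => S.last.take i
  | .inr ⟨j, ℓ⟩ => S.last ++ (S.tail j).take (ℓ + 1)

/-- The real Néron-Severi space of the surface obtained by blowing up the plane at the points of
the configuration: it has the basis consisting of the classes of the total transforms of a line
(first component) and of the exceptional divisors (second component). -/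
abbrev NS : Type := ℝ × (S.Idx → ℝ)

/-- The intersection product: the basis of total transforms is orthogonal, the total transform of
a line has self-intersection `1`, those of the exceptional divisors have self-intersection `-1`. -/
def inter : S.NS →ₗ[ℝ] S.NS →ₗ[ℝ] ℝ :=
  LinearMap.mk₂ ℝ (fun x y => x.1 * y.1 - ∑ q, x.2 q * y.2 q)
    (by intro x x' y; simp [add_mul, Finset.sum_add_distrib]; ring)
    (by intro a x y; simp [mul_assoc, ← Finset.mul_sum]; ring)
    (by intro x y y'; simp [mul_add, Finset.sum_add_distrib]; ring)
    (by intro a x y; simp [mul_left_comm, ← Finset.mul_sum]; ring)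

/-- Class of the total transform of a line, `E_{0 0}^*`. -/
def lineClass : S.NS := (1, 0)

/-- Class of the total transform `E_q^*` of an exceptional divisor. -/
def excTotal (q : S.Idx) : S.NS := (0, Pi.single q 1)

open Classical in
/-- Class of the strict transform of the exceptional divisor `E_q`. -/
def excStrict (q : S.Idx) : S.NS :=
  S.excTotal q - ∑ r, if Proximate (S.pt r) (S.pt q) then S.excTotal r else 0

/-- Class of the strict transform of the plane curve of degree `e` with equation `G`. -/
def curveClass (G : MvPolynomial (Fin 3) ℂ) (e : ℕ) : S.NS :=
  (e : ℝ) • S.lineClass - ∑ q, (multAt (S.pt q) (germAt G) : ℝ) • S.excTotal q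

/-- The set of classes of the strict transforms of `L`, of the curves `C_j` and of the exceptional
divisors. -/
def deltaP : Set S.NS :=
  {S.curveClass (MvPolynomial.X 2) 1} ∪
  Set.range (fun j => S.curveClass (member S.F S.d (S.c j)) S.d) ∪
  Set.range S.excStrict

/-- The cone `P`. -/
def P : PointedCone ℝ S.NS := PointedCone.hull ℝ S.deltaP

/-- The dual cone of `P` with respect to the intersection product. -/
def dualP : PointedCone ℝ S.NS := PointedCone.dual S.inter (S.P : Set S.NS)

open Classical in
/-- The class of `D_{j m}`, `m ≥ 1`, for the index `q` of `p_{j m}`: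
`(φ_L, φ_q)_p E_{0 0}^* - ∑ mult_{r}(φ_q) E_r^*`, where `r` runs over the points of the
configuration to which `q` is infinitely near. Here `φ_q` is the chosen germ attached to `q`. -/
def D (φ : S.Idx → Germ) (q : S.Idx) : S.NS :=
  (intMult lineGerm (φ q) : ℝ) • S.lineClass -
    ∑ r, if S.pt r <+: S.pt q then (multAt (S.pt r) (φ q) : ℝ) • S.excTotal r else 0

/-- The class of `D_{0 m}` for `0 ≤ m ≤ s₀`. -/
def D0 (φ : S.Idx → Germ) (m : Fin (S.s₀ + 1)) : S.NS :=
  Fin.cases S.lineClass (fun i => S.D φ (.inl i)) m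

/-- The number `a_m = D_{0 m} · D_{0 s₀}`. -/
def a (φ : S.Idx → Germ) (m : Fin (S.s₀ + 1)) : ℝ :=
  S.inter (S.D0 φ m) (S.D0 φ (Fin.last S.s₀))

/-- The product of the entries of `ℓ ∈ S_J`; the entry with index `j` is the integer
`ℓ j + 1 ∈ {1, …, s_j}`. -/
def prodL (J : Finset (Fin S.k)) (ℓ : (j : J) → Fin (S.s j)) : ℝ :=
  ∏ j : J, ((ℓ j : ℕ) + 1 : ℝ)

/-- The class of `D_{0 m}^{J, ℓ}`. -/
def DJ (φ : S.Idx → Germ) (J : Finset (Fin S.k)) (ℓ : (j : J) → Fin (S.s j))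
    (m : Fin (S.s₀ + 1)) : S.NS :=
  S.a φ m • (∑ j : J, (S.prodL J ℓ / ((ℓ j : ℕ) + 1 : ℝ)) • S.D φ (.inr ⟨j, ℓ j⟩)) +
    S.prodL J ℓ • S.D0 φ m

end Config

end

end PencilCone

/-!
The classes `D` are the basis dual to the strict transforms of `L` and of the exceptional curves:
this is Noether's formula for the intersection with `L`, together with the proximity equalities for
a germ transversal to an exceptional curve (`Config.eq_sum_D`). Hence `P^∨` is cut out, in the
orthant spanned by the `D`, by the inequalities `x · C_j ≥ 0`, and these are the only place where
the geometry of the pencil matters.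

Let `V = D_{0 s₀}`. The curve `C` is smooth at the last base point, where it is transversal to the
only axis contained in the monomial member `Z ^ d` of the transformed pencil
(`Config.exists_shape_last`). It follows that `V` is the class of the members of the pencil on the
blow-up of its base points, that `V² = 0`, and that all members leave the last base point through
general points of its exceptional curve. The additional points being free, each class `D_{j ℓ}` is
`V - E_{j 1}^* - ⋯ - E_{j ℓ}^*`, so that `D_{j ℓ} · C_j = -ℓ` and `D_{j ℓ} · C_i = 0` for `i ≠ j`,
whereas `D_{0 m} · C_j = D_{0 m} · V = a_m ≥ 0`. Let `x = ∑ y_m D_{0 m} + ∑ z_{j ℓ} D_{j ℓ}` and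
`c = ∑ y_m a_m`. The conditions read `y, z ≥ 0` and `∑_ℓ ℓ z_{j ℓ} ≤ c` for all `j`. If `c > 0`, then
`(z_{j ℓ} / c)_ℓ` lies in the simplex with vertices `0` and `1 / ℓ` times the `ℓ`-th unit vector. A
product of convex hulls is the convex hull of the product (`mem_convexHull_pi`), so `x` is a
combination of classes `D_{0 m} + a_m ∑_{j ∈ J} D_{j ℓ_j} / ℓ_j`, which are positive multiples of the
given generators; and `a_{s₀} = V² = 0` (`Config.mem_hull_of_mem_dualP`).

The assertion on the last base point comes from an inequality of Moh. Along the base points, the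
pencil is spanned by the strict transform of `C` and a monomial `u ^ e₀ v ^ e₁` (`PencilShape`). As
long as `e₀ + e₁` exceeds the multiplicity of `C`, the next point of `C` is a base point again. When
this fails, the function `F / Z ^ d` has no pole along the arc `u = v`, and Moh's inequality
`OnePlaceAtInfinity.degree_le_order` says that such an arc meets `L` with multiplicity at least `d`.
As `C` itself meets `L` with multiplicity `d`, it has to be smooth and transversal
(`PencilShape.transversal`).

Moh's inequality is proved over the complete field of Laurent series at the place at infinity of the
first coordinate, over which the affine equation `f`, monic of degree `d` in the second coordinate,
is irreducible. The arc provides an algebraic element `β` with `‖f(β)‖ ≤ 1`, whose degree is at most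
the multiplicity of the arc with `L`. Let `e` be the number of roots of `f` as near to the root `α`
nearest to `β` as `β` is. If `e = 1`, Krasner's lemma gives `α ∈ K(β)`, whence the inequality. If
`e ≥ 2`, the approximate `e`-th root `g` of `f`, which has polynomial coefficients, satisfies
`‖g(α)‖ ≤ 1` (`natDegree_le_or_exists_bounded_approximateRoot`). So `g` is bounded at the only place
at infinity of `C`; it is constant on `C`, which is absurd as its degree in the second coordinate is
positive and smaller than `d` (`not_norm_aeval_le_one`).
-/

section

open Polynomial

/-! ### Approximate roots -/

/-- The cofactor of `x - y` in `x ^ e - y ^ e` has degree `m * (e - 1)` and leading coefficient `e`: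
this is what makes `e`-th roots unique as soon as `e` is invertible. -/
theorem natDegree_geom_sum_le {R : Type*} [CommRing R] [Nontrivial R] {x y : R[X]} {m : ℕ} (e : ℕ)
    (hx : x.Monic) (hy : y.Monic) (hxm : x.natDegree = m) (hym : y.natDegree = m) :
    (∑ i ∈ Finset.range e, x ^ i * y ^ (e - 1 - i)).natDegree ≤ m * (e - 1) ∧
    (∑ i ∈ Finset.range e, x ^ i * y ^ (e - 1 - i)).coeff (m * (e - 1)) = e := by
  have key : ∀ i ∈ Finset.range e, (x ^ i * y ^ (e - 1 - i)).natDegree = m * (e - 1) ∧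
      (x ^ i * y ^ (e - 1 - i)).coeff (m * (e - 1)) = 1 := by
    intro i hi
    have hi' : i < e := Finset.mem_range.mp hi
    have hmon : (x ^ i * y ^ (e - 1 - i)).Monic := (hx.pow i).mul (hy.pow _)
    have hd : (x ^ i * y ^ (e - 1 - i)).natDegree = m * (e - 1) := by
      rw [(hx.pow i).natDegree_mul (hy.pow _), hx.natDegree_pow, hy.natDegree_pow, hxm, hym,
        ← add_mul, mul_comm]
      congr 1
      omega
    refine ⟨hd, ?_⟩
    rw [← hd]
    exact hmon
  constructor
  · exact natDegree_sum_le_of_forall_le _ _ fun i hi => (key i hi).1.le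
  · rw [finsetSum_coeff, Finset.sum_congr rfl fun i hi => (key i hi).2]
    simp

/-- Existence of the approximate `e`-th root of a monic polynomial of degree `m * e`: a monic
polynomial `g` of degree `m` for which `g ^ e` agrees with `f` in the top `m + 1` degrees. -/
theorem exists_approximateRoot {R : Type*} [CommRing R] [Nontrivial R] {e m : ℕ}
    (he : IsUnit (e : R)) {f : R[X]} (hf : f.Monic) (hd : f.natDegree = m * e) :
    ∃ g : R[X], g.Monic ∧ g.natDegree = m ∧ (f - g ^ e).degree < ((m * (e - 1) : ℕ) : WithBot ℕ) := by
  have he0 : 1 ≤ e := by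
    rcases Nat.eq_zero_or_pos e with h | h
    · subst h; simp at he
    · exact h
  -- the coefficients of `g` are corrected one at a time from the top; `j` of them are settled
  have main : ∀ j ≤ m, ∃ g : R[X], g.Monic ∧ g.natDegree = m ∧
      (f - g ^ e).degree < ((m * e - j : ℕ) : WithBot ℕ) := by
    intro j
    induction j with
    | zero =>
      intro _
      refine ⟨X ^ m, monic_X_pow m, natDegree_X_pow m, ?_⟩
      have h1 : f.degree = ((m * e : ℕ) : WithBot ℕ) := by
        rw [degree_eq_natDegree hf.ne_zero, hd]
      have h2 : f.degree = ((X ^ m : R[X]) ^ e).degree := by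
        rw [h1, ← pow_mul, degree_X_pow]
      have := degree_sub_lt_left h2 hf.ne_zero
        (by rw [hf.leadingCoeff, ((monic_X_pow m).pow e).leadingCoeff])
      rw [h1] at this
      simpa using this
    | succ j ih =>
      intro hj
      obtain ⟨g, hg, hgm, hlt⟩ := ih (by omega)
      obtain ⟨w, hw⟩ := he.exists_right_inv
      set k := m * e - 1 - j with hk
      set a := (f - g ^ e).coeff k * w with ha
      have hme : m ≤ m * e := Nat.le_mul_of_pos_right m he0
      have hmul : m * e = m * (e - 1) + m := by
        obtain ⟨e', rfl⟩ : ∃ e', e = e' + 1 := ⟨e - 1, by omega⟩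
        simp [mul_add]
      have hlow : (C a * X ^ (m - 1 - j)).degree < g.degree := by
        rw [degree_eq_natDegree hg.ne_zero, hgm]
        refine lt_of_le_of_lt (degree_C_mul_X_pow_le _ _) ?_
        exact_mod_cast (by omega : m - 1 - j < m)
      have hg' : (g + C a * X ^ (m - 1 - j)).Monic := hg.add_of_left hlow
      have hg'm : (g + C a * X ^ (m - 1 - j)).natDegree = m := by
        rw [natDegree_add_eq_left_of_degree_lt hlow, hgm]
      refine ⟨_, hg', hg'm, ?_⟩
      obtain ⟨hS1, hS2⟩ := natDegree_geom_sum_le e hg' hg hg'm hgm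
      have hgs := geom_sum₂_mul (g + C a * X ^ (m - 1 - j)) g e
      set S := ∑ i ∈ Finset.range e, (g + C a * X ^ (m - 1 - j)) ^ i * g ^ (e - 1 - i)
      have hexp : f - (g + C a * X ^ (m - 1 - j)) ^ e = (f - g ^ e) - C a * S * X ^ (m - 1 - j) := by
        have : C a * S * X ^ (m - 1 - j) = (g + C a * X ^ (m - 1 - j)) ^ e - g ^ e := by
          rw [← hgs]; ring
        rw [this]; ring
      rw [hexp, degree_lt_iff_coeff_zero]
      intro i hi
      rw [coeff_sub]
      rcases Nat.lt_or_ge k i with hki | hki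
      · rw [coeff_eq_zero_of_degree_lt (lt_of_lt_of_le hlt (by exact_mod_cast (by omega))),
          coeff_eq_zero_of_natDegree_lt, sub_zero]
        refine lt_of_le_of_lt (natDegree_mul_le_of_le (natDegree_C_mul_le _ _ |>.trans hS1)
          (natDegree_X_pow_le _)) ?_
        omega
      · have hik : i = m * (e - 1) + (m - 1 - j) := by omega
        have hik' : i = k := by omega
        rw [hik, coeff_mul_X_pow, coeff_C_mul, hS2, ← hik, hik', ha, mul_assoc,
          mul_comm w, hw, mul_one, sub_self]
  obtain ⟨g, h1, h2, h3⟩ := main m le_rfl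
  refine ⟨g, h1, h2, ?_⟩
  rwa [show m * (e - 1) = m * e - m by rw [Nat.mul_sub, mul_one]]

/-- Uniqueness of `e`-th roots modulo polynomials of small degree. -/
theorem eq_of_pow_sub_smul_pow_degree_lt {k : Type*} [Field k] {e n : ℕ} (he : (e : k) ≠ 0)
    {Q g : k[X]} (hQ : Q.Monic) (hg : g.Monic) (hQn : Q.natDegree = n) (hgn : g.natDegree = n)
    {c : k} (h : (Q ^ e - C c * g ^ e).degree < ((n * (e - 1) : ℕ) : WithBot ℕ)) : Q = g := by
  have he0 : 1 ≤ e := by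
    rcases Nat.eq_zero_or_pos e with h | h
    · subst h; simp at he
    · exact h
  have hc : c = 1 := by
    have h1 : (Q ^ e - C c * g ^ e).coeff (n * e) = 0 := by
      apply coeff_eq_zero_of_degree_lt (lt_of_lt_of_le h _)
      exact_mod_cast Nat.mul_le_mul_left n (by omega)
    have hQe : (Q ^ e).coeff (n * e) = 1 := by
      have := (hQ.pow e).coeff_natDegree
      rwa [hQ.natDegree_pow, hQn, mul_comm] at this
    have hge : (g ^ e).coeff (n * e) = 1 := by
      have := (hg.pow e).coeff_natDegree
      rwa [hg.natDegree_pow, hgn, mul_comm] at this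
    rw [coeff_sub, coeff_C_mul, hQe, hge, mul_one] at h1
    exact (sub_eq_zero.mp h1).symm
  subst hc
  rw [C_1, one_mul] at h
  by_contra hne
  have hgs := geom_sum₂_mul Q g e
  obtain ⟨hS1, hS2⟩ := natDegree_geom_sum_le e hQ hg hQn hgn
  set S := ∑ i ∈ Finset.range e, Q ^ i * g ^ (e - 1 - i)
  rw [← hgs, degree_mul] at h
  have hS : ((n * (e - 1) : ℕ) : WithBot ℕ) ≤ S.degree := le_degree_of_ne_zero (by rw [hS2]; exact he)
  have h0 : (0 : WithBot ℕ) ≤ (Q - g).degree := zero_le_degree_iff.mpr (sub_ne_zero.mpr hne)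
  exact absurd h (not_lt.mpr (le_trans hS (le_add_of_nonneg_right h0)))

/-! ### Reduction of split polynomials at a radius -/

section Reduction

variable {L : Type*} [NormedField L] [IsUltrametricDist L]

/-- The closed unit ball. -/
noncomputable abbrev unitBall (L : Type*) [NormedField L] [IsUltrametricDist L] : ValuationSubring L :=
  (NormedField.valuation (K := L)).valuationSubring

theorem mem_unitBall {x : L} : x ∈ unitBall L ↔ ‖x‖ ≤ 1 := by
  rw [Valuation.mem_valuationSubring_iff]
  exact NNReal.coe_le_coe.symm

/-- The residue field of the closed unit ball. -/
noncomputable abbrev resField (L : Type*) [NormedField L] [IsUltrametricDist L] : Type _ :=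
  IsLocalRing.ResidueField (unitBall L)

theorem residue_eq_zero_iff_norm_lt {x : unitBall L} :
    IsLocalRing.residue (unitBall L) x = 0 ↔ ‖(x : L)‖ < 1 := by
  rw [IsLocalRing.residue_eq_zero_iff, IsLocalRing.mem_maximalIdeal, mem_nonunits_iff,
    ← not_le, not_iff_not]
  constructor
  · intro h
    obtain ⟨w, hw⟩ := h.exists_right_inv
    have h1 : ‖(x : L)‖ * ‖(w : L)‖ = 1 := by
      rw [← norm_mul, ← norm_one (α := L)]
      congr 1
      exact_mod_cast congrArg Subtype.val hw
    have h2 : ‖(w : L)‖ ≤ 1 := mem_unitBall.mp w.2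
    nlinarith [norm_nonneg (x : L), norm_nonneg (w : L)]
  · intro h
    have hx : (x : L) ≠ 0 := by
      intro h0; rw [h0, norm_zero] at h; linarith
    have hinv : (x : L)⁻¹ ∈ unitBall L := by
      rw [mem_unitBall, norm_inv]
      exact inv_le_one_of_one_le₀ h
    refine IsUnit.of_mul_eq_one ⟨_, hinv⟩ (Subtype.ext ?_)
    exact mul_inv_cancel₀ hx

theorem div_mem_unitBall {a y : L} (h : ‖a‖ ≤ ‖y‖) : a / y ∈ unitBall L := by
  rw [mem_unitBall, norm_div]
  exact div_le_one_of_le₀ h (norm_nonneg _)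

open Classical in
/-- The linear factor `X - a`, after scaling the variable by `y` and dividing by a constant so that
the coefficients lie in the unit ball and one of them is `1`. The reduction is `X - a / y` if
`‖a‖ ≤ ‖y‖`, and `1` otherwise. -/
noncomputable def scaledFactor (y a : L) : (unitBall L)[X] :=
  if h : ‖a‖ ≤ ‖y‖ then X - C ⟨a / y, div_mem_unitBall h⟩
  else 1 - C ⟨y / a, div_mem_unitBall (not_le.mp h).le⟩ * X

open Classical in
/-- The constant by which `X - a`, scaled by `y`, is divided in `scaledFactor`. -/
noncomputable def scaledConst (y a : L) : L := if ‖a‖ ≤ ‖y‖ then y else -a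

open Classical in
/-- The residue class of `a / y`, with the junk value `0` if `‖y‖ < ‖a‖`. -/
noncomputable def scaledRes (y a : L) : resField L :=
  if h : ‖a‖ ≤ ‖y‖ then IsLocalRing.residue _ ⟨a / y, div_mem_unitBall h⟩ else 0

theorem norm_scaledConst {L : Type*} [NormedField L] (y a : L) : ‖scaledConst y a‖ = max ‖y‖ ‖a‖ := by
  unfold scaledConst
  split_ifs with h
  · rw [max_eq_left h]
  · rw [norm_neg, max_eq_right (not_le.mp h).le]

theorem scaledConst_mul_map {y : L} (hy : y ≠ 0) (a : L) :
    (X - C a).comp (C y * X) =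
      C (scaledConst y a) * (scaledFactor y a).map (unitBall L).subtype := by
  unfold scaledConst scaledFactor
  split_ifs with h
  · simp only [sub_comp, X_comp, C_comp, Polynomial.map_sub, Polynomial.map_X, Polynomial.map_C,
      mul_sub, ← C_mul]
    congr 2
    change a = y * (a / y)
    field_simp
  · have ha : a ≠ 0 := by
      rintro rfl
      simp at h
    simp only [sub_comp, X_comp, C_comp, Polynomial.map_sub, Polynomial.map_X, Polynomial.map_C,
      mul_sub, Polynomial.map_one, Polynomial.map_mul, ← mul_assoc, ← C_mul]
    have : (-a * (unitBall L).subtype ⟨y / a, div_mem_unitBall (not_le.mp h).le⟩) = -y := by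
      change -a * (y / a) = -y
      field_simp
    rw [this, C_neg, C_neg]
    ring

/-- Product of the scaled linear factors with given roots. -/
noncomputable def scaledProd (y : L) (T : Multiset L) : (unitBall L)[X] :=
  (T.map (scaledFactor y)).prod

theorem scaledProd_map {y : L} (hy : y ≠ 0) (T : Multiset L) :
    (T.map fun a => X - C a).prod.comp (C y * X) =
      C (T.map (scaledConst y)).prod * (scaledProd y T).map (unitBall L).subtype := by
  unfold scaledProd
  induction T using Multiset.induction_on with
  | empty => simp
  | cons a T ih =>
    simp only [Multiset.map_cons, Multiset.prod_cons, mul_comp, ih, scaledConst_mul_map hy,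
      Polynomial.map_mul, C_mul]
    ring

open Classical in
/-- The roots outside of the disc of radius `‖y‖` disappear in the reduction. -/
theorem scaledProd_residue {y : L} (T : Multiset L) :
    (scaledProd y T).map (IsLocalRing.residue (unitBall L)) =
      ((T.filter (‖·‖ ≤ ‖y‖)).map fun a => X - C (scaledRes y a)).prod := by
  unfold scaledProd
  induction T using Multiset.induction_on with
  | empty => simp
  | cons a T ih =>
    rw [Multiset.map_cons, Multiset.prod_cons, Polynomial.map_mul, ih]
    by_cases h : ‖a‖ ≤ ‖y‖
    · rw [Multiset.filter_cons_of_pos (p := (‖·‖ ≤ ‖y‖)) _ h, Multiset.map_cons, Multiset.prod_cons]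
      congr 1
      simp [scaledFactor, scaledRes, h]
    · rw [Multiset.filter_cons_of_neg (p := (‖·‖ ≤ ‖y‖)) _ h]
      have : IsLocalRing.residue (unitBall L)
          ⟨y / a, div_mem_unitBall (not_le.mp h).le⟩ = 0 := by
        rw [residue_eq_zero_iff_norm_lt]
        change ‖y / a‖ < 1
        rw [norm_div, div_lt_one ((norm_nonneg y).trans_lt (not_le.mp h))]
        exact not_le.mp h
      simp [scaledFactor, h, this]

theorem scaledRes_eq_zero_iff {y a : L} (hy : y ≠ 0) (h : ‖a‖ ≤ ‖y‖) :
    scaledRes y a = 0 ↔ ‖a‖ < ‖y‖ := by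
  simp only [scaledRes, h, dite_true]
  rw [residue_eq_zero_iff_norm_lt]
  change ‖a / y‖ < 1 ↔ _
  rw [norm_div, div_lt_one (norm_pos_iff.mpr hy)]

theorem scaledRes_congr {y a b : L} (hy : y ≠ 0) (ha : ‖a‖ ≤ ‖y‖) (hab : ‖a - b‖ < ‖y‖) :
    scaledRes y a = scaledRes y b := by
  have hb : ‖b‖ ≤ ‖y‖ := by
    have := IsUltrametricDist.norm_add_le_max a (b - a)
    rw [add_sub_cancel, norm_sub_rev b a] at this
    exact this.trans (max_le ha hab.le)
  simp only [scaledRes, ha, hb, dite_true]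
  rw [← sub_eq_zero, ← map_sub, residue_eq_zero_iff_norm_lt]
  change ‖a / y - b / y‖ < 1
  rw [← sub_div, norm_div, div_lt_one (norm_pos_iff.mpr hy)]
  exact hab

theorem exists_coeff_unit_of_monic_residue {p : (unitBall L)[X]}
    (hp : (p.map (IsLocalRing.residue (unitBall L))).Monic) :
    ∃ i, ‖((p.coeff i : unitBall L) : L)‖ = 1 := by
  refine ⟨(p.map (IsLocalRing.residue (unitBall L))).natDegree,
    le_antisymm (mem_unitBall.mp (p.coeff _).2) (not_lt.mp fun h => ?_)⟩
  rw [← residue_eq_zero_iff_norm_lt, ← coeff_map] at h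
  exact one_ne_zero (hp.coeff_natDegree.symm.trans h)

open Classical in
/-- Let `S` be partitioned into clusters of `e` elements with radius `r < ‖y‖`, and let `∏ (X - a)`
over `S` be the `e`-th power of the product over `T`, up to an error `ρ` with few roots of absolute
value at most `‖y‖`. After scaling by `y`, both products reduce to `e`-th powers: of the product `Q`
over the clusters, and of the reduction of the product over `T`. As the reduction of `ρ` has small
degree, the two `e`-th roots agree, and one compares the multiplicities of their root `0`. -/
theorem card_filter_norm_lt_eq [IsAlgClosed L] (hchar : ∀ n : ℕ, n ≠ 0 → ‖(n : L)‖ = 1)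
    {y : L} (hy : y ≠ 0) {r : ℝ} (hry : r < ‖y‖) (S : Finset L) (rep : L → L)
    (hrep : ∀ a ∈ S, ‖a - rep a‖ ≤ r) {e : ℕ} (he : 1 ≤ e)
    (hfib : ∀ a ∈ S, {b ∈ S | rep b = rep a}.card = e)
    (T : Multiset L) (ρ : L[X])
    (hρ : (S.val.map fun a => X - C a).prod = (T.map fun a => X - C a).prod ^ e + ρ)
    (hcount : ρ ≠ 0 → (ρ.roots.filter (‖·‖ ≤ ‖y‖)).card * e <
      (S.val.filter (‖·‖ ≤ ‖y‖)).card * (e - 1))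
    (hcard : (S.val.filter (‖·‖ ≤ ‖y‖)).card = e * (T.filter (‖·‖ ≤ ‖y‖)).card)
    (hconst : ‖(S.val.map (scaledConst y)).prod‖ = ‖(T.map (scaledConst y)).prod‖ ^ e) :
    (S.val.filter (‖·‖ < ‖y‖)).card = e * (T.filter (‖·‖ < ‖y‖)).card := by
  set res := IsLocalRing.residue (unitBall L)
  set n := (T.filter (‖·‖ ≤ ‖y‖)).card with hn
  set cS := (S.val.map (scaledConst y)).prod with hcS
  set cT := (T.map (scaledConst y)).prod with hcT
  have hconst_ne : ∀ M : Multiset L, (M.map (scaledConst y)).prod ≠ 0 := by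
    intro M
    refine Multiset.prod_ne_zero fun hx => ?_
    obtain ⟨a, -, ha⟩ := Multiset.mem_map.mp hx
    have h1 := norm_scaledConst y a
    rw [ha, norm_zero] at h1
    exact (lt_of_lt_of_le (norm_pos_iff.mpr hy) (le_max_left _ _)).ne h1
  have hcS0 : cS ≠ 0 := hconst_ne _
  -- the comparison constant is a unit of the valuation ring
  have hlam : cT ^ e / cS ∈ unitBall L := by
    rw [mem_unitBall, norm_div, norm_pow, ← hconst, div_self]
    exact norm_ne_zero_iff.mpr hcS0
  set lam : unitBall L := ⟨cT ^ e / cS, hlam⟩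
  set Fs := scaledProd y S.val
  set Gs := scaledProd y T
  have hρy : ρ.comp (C y * X) = C cS * ((Fs - C lam * Gs ^ e).map (unitBall L).subtype) := by
    have h1 := congrArg (fun p => p.comp (C y * X)) hρ
    simp only [add_comp, pow_comp, scaledProd_map hy] at h1
    rw [← sub_eq_iff_eq_add'] at h1
    rw [← h1, Polynomial.map_sub, Polynomial.map_mul, Polynomial.map_pow, Polynomial.map_C,
      mul_sub, mul_pow, ← C_pow, ← mul_assoc, ← C_mul]
    congr 3
    change cT ^ e = cS * (cT ^ e / cS)
    field_simp
  have hFbar : Fs.map res = ((S.val.filter (‖·‖ ≤ ‖y‖)).map fun a => X - C (scaledRes y a)).prod :=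
    scaledProd_residue _
  have hGbar : Gs.map res = ((T.filter (‖·‖ ≤ ‖y‖)).map fun a => X - C (scaledRes y a)).prod :=
    scaledProd_residue _
  have hGmon : (Gs.map res).Monic := by
    rw [hGbar]; exact monic_multiset_prod_of_monic _ _ fun a _ => monic_X_sub_C _
  have hGdeg : (Gs.map res).natDegree = n := by
    rw [hGbar, natDegree_multiset_prod_of_monic _ (by
      intro p hp
      obtain ⟨a, -, rfl⟩ := Multiset.mem_map.mp hp
      exact monic_X_sub_C _)]
    simp [hn]
  -- the reduction of the product over `S` is an `e`-th power
  set S' := S.filter (‖·‖ ≤ ‖y‖) with hS'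
  set Q : (resField L)[X] := ∏ b ∈ S'.image rep, (X - C (scaledRes y b)) with hQ
  have hFQ : Fs.map res = Q ^ e := by
    have h1 : Fs.map res = ∏ a ∈ S', (X - C (scaledRes y a)) := by
      rw [hFbar]; rfl
    rw [h1, hQ, ← Finset.prod_pow]
    have h2 : ∏ a ∈ S', (X - C (scaledRes y a)) = ∏ a ∈ S', (X - C (scaledRes y (rep a))) := by
      refine Finset.prod_congr rfl fun a ha => ?_
      rw [hS', Finset.mem_filter] at ha
      rw [scaledRes_congr hy ha.2 ((hrep a ha.1).trans_lt hry)]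
    rw [h2, Finset.prod_comp (fun b => X - C (scaledRes y b)) rep]
    refine Finset.prod_congr rfl fun b hb => ?_
    obtain ⟨a, ha, rfl⟩ := Finset.mem_image.mp hb
    rw [hS', Finset.mem_filter] at ha
    congr 1
    rw [← hfib a ha.1]
    congr 1
    ext b
    simp only [hS', Finset.mem_filter]
    refine ⟨fun h => ⟨h.1.1, h.2⟩, fun h => ⟨⟨h.1, ?_⟩, h.2⟩⟩
    have e1 : b = (b - rep b) + ((rep a - a) + a) := by rw [h.2]; ring
    rw [e1]
    refine (IsUltrametricDist.norm_add_le_max _ _).trans (max_le ((hrep b h.1).trans hry.le) ?_)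
    refine (IsUltrametricDist.norm_add_le_max _ _).trans (max_le ?_ ha.2)
    rw [norm_sub_rev]
    exact (hrep a ha.1).trans hry.le
  have hQmon : Q.Monic := monic_prod_of_monic _ _ fun a _ => monic_X_sub_C _
  have hQdeg : Q.natDegree = n := by
    have h1 : (Q ^ e).natDegree = e * n := by
      rw [← hFQ, hFbar, natDegree_multiset_prod_of_monic _ (by
        intro p hp
        obtain ⟨a, -, rfl⟩ := Multiset.mem_map.mp hp
        exact monic_X_sub_C _), ← hcard]
      simp
    rw [hQmon.natDegree_pow] at h1
    exact Nat.eq_of_mul_eq_mul_left he h1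
  have he_ne : (e : resField L) ≠ 0 := by
    intro h0
    have : res ((e : ℕ) : unitBall L) = 0 := by rw [map_natCast]; exact h0
    rw [residue_eq_zero_iff_norm_lt] at this
    have h2 := hchar e (by omega)
    have h3 : (((e : ℕ) : unitBall L) : L) = (e : L) := by norm_cast
    rw [h3, h2] at this
    exact lt_irrefl _ this
  have hQG : Q = Gs.map res := by
    refine eq_of_pow_sub_smul_pow_degree_lt he_ne hQmon hGmon hQdeg hGdeg (c := res lam) ?_
    have hred : Q ^ e - C (res lam) * Gs.map res ^ e = (Fs - C lam * Gs ^ e).map res := by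
      rw [← hFQ, Polynomial.map_sub, Polynomial.map_mul, Polynomial.map_pow, Polynomial.map_C]
    rw [hred]
    by_cases hρ0 : ρ = 0
    · rw [hρ0, zero_comp] at hρy
      have : (Fs - C lam * Gs ^ e).map (unitBall L).subtype = 0 := by
        rcases mul_eq_zero.mp hρy.symm with h | h
        · exact absurd (C_eq_zero.mp h) hcS0
        · exact h
      have h0 : Fs - C lam * Gs ^ e = 0 :=
        (Polynomial.map_eq_zero_iff (Subtype.val_injective)).mp this
      rw [h0, Polynomial.map_zero, degree_zero]
      exact WithBot.bot_lt_coe _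
    · -- the reduction of `ρ` is a constant times the product over its small roots
      set Rs := scaledProd y ρ.roots
      set cR := (ρ.roots.map (scaledConst y)).prod
      have hsplit : ρ = C ρ.leadingCoeff * (ρ.roots.map fun a => X - C a).prod :=
        (IsAlgClosed.splits ρ).eq_prod_roots
      have h1 : ρ.comp (C y * X) =
          C (ρ.leadingCoeff * cR) * Rs.map (unitBall L).subtype := by
        conv_lhs => rw [hsplit]
        rw [mul_comp, C_comp, scaledProd_map hy, ← mul_assoc, ← C_mul]
      have h2 : (Fs - C lam * Gs ^ e).map (unitBall L).subtype =
          C (ρ.leadingCoeff * cR / cS) * Rs.map (unitBall L).subtype := by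
        have := hρy.symm.trans h1
        have h3 : C (cS⁻¹) * (C cS * (Fs - C lam * Gs ^ e).map (unitBall L).subtype) =
          C (cS⁻¹) * (C (ρ.leadingCoeff * cR) * Rs.map (unitBall L).subtype) := by rw [this]
        rw [← mul_assoc, ← mul_assoc, ← C_mul, ← C_mul, inv_mul_cancel₀ hcS0, C_1, one_mul] at h3
        rw [h3, div_eq_inv_mul]
      have hRbar := scaledProd_residue (y := y) ρ.roots
      have hRmon : (Rs.map res).Monic := by
        rw [hRbar]; exact monic_multiset_prod_of_monic _ _ fun a _ => monic_X_sub_C _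
      have hκ : ρ.leadingCoeff * cR / cS ∈ unitBall L := by
        obtain ⟨i, hi⟩ := exists_coeff_unit_of_monic_residue hRmon
        have := congrArg (fun p => ‖p.coeff i‖) h2
        simp only [coeff_map, coeff_C_mul, norm_mul] at this
        rw [mem_unitBall]
        have e1 : ‖(unitBall L).subtype (Rs.coeff i)‖ = 1 := hi
        rw [e1, mul_one] at this
        rw [← this]
        exact mem_unitBall.mp ((Fs - C lam * Gs ^ e).coeff i).2
      have h4 : Fs - C lam * Gs ^ e = C ⟨_, hκ⟩ * Rs := by
        apply Polynomial.map_injective (unitBall L).subtype Subtype.val_injective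
        rw [h2, Polynomial.map_mul, Polynomial.map_C]
        rfl
      rw [h4, Polynomial.map_mul, Polynomial.map_C]
      refine lt_of_le_of_lt ((degree_mul_le _ _).trans (add_le_add_left degree_C_le _)) ?_
      rw [zero_add]
      rw [degree_eq_natDegree hRmon.ne_zero, hRbar, natDegree_multiset_prod_of_monic _ (by
        intro p hp
        obtain ⟨a, -, rfl⟩ := Multiset.mem_map.mp hp
        exact monic_X_sub_C _)]
      have := hcount hρ0
      rw [hcard] at this
      simp only [Multiset.map_map, Function.comp_def, natDegree_X_sub_C, Multiset.map_const',
        Multiset.sum_replicate, smul_eq_mul, mul_one]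
      have h5 : (ρ.roots.filter (‖·‖ ≤ ‖y‖)).card < n * (e - 1) := by
        have h6 : (ρ.roots.filter (‖·‖ ≤ ‖y‖)).card * e < n * (e - 1) * e := by
          calc _ < e * n * (e - 1) := this
            _ = _ := by ring
        exact lt_of_mul_lt_mul_right h6 (Nat.zero_le e)
      exact_mod_cast h5
  -- compare the multiplicities of the root zero
  have hroots : ∀ M : Multiset L, Multiset.count 0
      (((M.filter (‖·‖ ≤ ‖y‖)).map fun a => X - C (scaledRes y a)).prod).roots =
      (M.filter (‖·‖ < ‖y‖)).card := by
    intro M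
    have e1 : ((M.filter (‖·‖ ≤ ‖y‖)).map fun a => X - C (scaledRes y a)) =
        (((M.filter (‖·‖ ≤ ‖y‖)).map (scaledRes y)).map fun a => X - C a) := by
      rw [Multiset.map_map]; rfl
    rw [e1, roots_multiset_prod_X_sub_C, Multiset.count_map, Multiset.filter_filter]
    congr 1
    refine Multiset.filter_congr fun a _ => ?_
    constructor
    · rintro ⟨h1, h2⟩
      exact (scaledRes_eq_zero_iff hy h2).mp h1.symm
    · intro h
      exact ⟨((scaledRes_eq_zero_iff hy h.le).mpr h).symm, h.le⟩
  have h1 := hroots S.val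
  rw [← hFbar, hFQ, hQG, roots_pow, Multiset.count_nsmul, hGbar, hroots T] at h1
  exact h1.symm

end Reduction

/-! ### Absolute values of the roots of an approximate root -/

theorem Multiset.prod_map_max (A : Multiset ℝ) (x : ℝ) :
    (A.map (max x)).prod = (A.filter (x < ·)).prod * x ^ (A.filter (· ≤ x)).card := by
  induction A using Multiset.induction_on with
  | empty => simp
  | cons a A ih =>
    rw [Multiset.map_cons, Multiset.prod_cons, ih]
    rcases lt_or_ge x a with h | h
    · rw [Multiset.filter_cons_of_pos (p := (x < ·)) _ h,
        Multiset.filter_cons_of_neg (p := (· ≤ x)) _ (not_le.mpr h), Multiset.prod_cons,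
        max_eq_right h.le, mul_assoc]
    · rw [Multiset.filter_cons_of_neg (p := (x < ·)) _ (not_lt.mpr h),
        Multiset.filter_cons_of_pos (p := (· ≤ x)) _ h, Multiset.card_cons, max_eq_left h, pow_succ]
      ring

theorem Multiset.card_filter_le_eq_add_count (A : Multiset ℝ) (x : ℝ) :
    (A.filter (· ≤ x)).card = (A.filter (· < x)).card + A.count x := by
  induction A using Multiset.induction_on with
  | empty => simp
  | cons a A ih =>
    rcases lt_trichotomy a x with h | h | h
    · rw [Multiset.filter_cons_of_pos (p := (· ≤ x)) _ h.le,
        Multiset.filter_cons_of_pos (p := (· < x)) _ h, Multiset.count_cons_of_ne h.ne',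
        Multiset.card_cons, Multiset.card_cons, ih]
      ring
    · subst h
      rw [Multiset.filter_cons_of_pos (p := (· ≤ a)) _ le_rfl,
        Multiset.filter_cons_of_neg (p := (· < a)) _ (lt_irrefl _), Multiset.count_cons_self,
        Multiset.card_cons, ih]
      ring
    · rw [Multiset.filter_cons_of_neg (p := (· ≤ x)) _ (not_le.mpr h),
        Multiset.filter_cons_of_neg (p := (· < x)) _ h.not_gt, Multiset.count_cons_of_ne h.ne, ih]

theorem Multiset.filter_lt_eq_of_count_eq {A B : Multiset ℝ} {x : ℝ}
    (h : ∀ z, x < z → A.count z = B.count z) : A.filter (x < ·) = B.filter (x < ·) := by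
  ext z
  rw [Multiset.count_filter, Multiset.count_filter]
  split_ifs with hz
  · exact h z hz
  · rfl

theorem Multiset.card_filter_le_eq {A B : Multiset ℝ} {x : ℝ} (hcard : A.card = B.card)
    (h : A.filter (x < ·) = B.filter (x < ·)) :
    (A.filter (· ≤ x)).card = (B.filter (· ≤ x)).card := by
  have key : ∀ M : Multiset ℝ, (M.filter (x < ·)).card + (M.filter (· ≤ x)).card = M.card := by
    intro M
    have := congrArg Multiset.card (Multiset.filter_add_not (x < ·) M)
    rw [Multiset.card_add] at this
    simpa only [not_lt] using this
  have h1 := key A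
  have h2 := key B
  rw [h] at h1
  omega

open Classical in
/-- If the roots of a polynomial come in clusters of `e` elements with radius `r`, then the absolute
values greater than `r` of these roots are those of the roots of its approximate `e`-th root `g`,
each taken `e` times. This is proved by descending on the absolute value. -/
theorem prod_max_norm_roots_pow_eq {L : Type*} [NormedField L] [IsUltrametricDist L] [IsAlgClosed L]
    (hchar : ∀ n : ℕ, n ≠ 0 → ‖(n : L)‖ = 1) {r : ℝ} (hr : 0 ≤ r) (S : Finset L) (rep : L → L)
    (hrep : ∀ a ∈ S, ‖a - rep a‖ ≤ r) {e : ℕ} (he : 1 ≤ e)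
    (hfib : ∀ a ∈ S, {b ∈ S | rep b = rep a}.card = e)
    {g : L[X]} (hg : g.Monic) (hdeg : S.card = e * g.natDegree) (ρ : L[X])
    (hρ : (∏ a ∈ S, (X - C a)) = g ^ e + ρ)
    (hcount : ρ ≠ 0 → ∀ R, r < R → (ρ.roots.filter (‖·‖ ≤ R)).card * e <
      (S.filter (‖·‖ ≤ R)).card * (e - 1)) :
    (g.roots.map fun b => max r ‖b‖).prod ^ e = ∏ a ∈ S, max r ‖a‖ := by
  set T := g.roots
  have hgT : g = (T.map fun a => X - C a).prod :=
    (IsAlgClosed.splits g).eq_prod_roots_of_monic hg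
  have hTcard : T.card = g.natDegree := (IsAlgClosed.splits g).natDegree_eq_card_roots.symm
  set A : Multiset ℝ := S.val.map norm with hA
  set B : Multiset ℝ := e • T.map norm with hB
  have hcardAB : A.card = B.card := by
    rw [hA, hB, Multiset.card_map, Multiset.card_nsmul, Multiset.card_map, hTcard,
      ← hdeg]
    rfl
  have hAle : ∀ x, (A.filter (· ≤ x)).card = (S.val.filter (‖·‖ ≤ x)).card := fun x => by
    rw [hA, Multiset.filter_map, Multiset.card_map]; rfl
  have hAlt : ∀ x, (A.filter (· < x)).card = (S.val.filter (‖·‖ < x)).card := fun x => by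
    rw [hA, Multiset.filter_map, Multiset.card_map]; rfl
  have hBle : ∀ x, (B.filter (· ≤ x)).card = e * (T.filter (‖·‖ ≤ x)).card := fun x => by
    rw [hB, Multiset.filter_nsmul, Multiset.card_nsmul, Multiset.filter_map, Multiset.card_map]; rfl
  have hBlt : ∀ x, (B.filter (· < x)).card = e * (T.filter (‖·‖ < x)).card := fun x => by
    rw [hB, Multiset.filter_nsmul, Multiset.card_nsmul, Multiset.filter_map, Multiset.card_map]; rfl
  have hprod : ∀ x, A.filter (x < ·) = B.filter (x < ·) →
      (T.map fun b => max x ‖b‖).prod ^ e = (S.val.map fun a => max x ‖a‖).prod := by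
    intro x hx
    have h1 : (A.map (max x)).prod = (B.map (max x)).prod := by
      rw [Multiset.prod_map_max, Multiset.prod_map_max, hx,
        Multiset.card_filter_le_eq hcardAB hx]
    rw [hA, hB, Multiset.map_nsmul, Multiset.prod_nsmul, Multiset.map_map, Multiset.map_map] at h1
    exact h1.symm
  suffices hcnt : ∀ x, r < x → A.count x = B.count x from
    hprod r (Multiset.filter_lt_eq_of_count_eq hcnt)
  by_contra! hbad
  -- the largest radius at which the two multisets of absolute values differ
  set bad : Finset ℝ := (A + B).toFinset.filter fun x => r < x ∧ A.count x ≠ B.count x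
  have hbadmem : ∀ x, r < x → A.count x ≠ B.count x → x ∈ bad := by
    intro x hx hne
    refine Finset.mem_filter.mpr ⟨?_, hx, hne⟩
    rw [Multiset.mem_toFinset, Multiset.mem_add]
    by_contra! hno
    exact hne (by rw [Multiset.count_eq_zero_of_notMem hno.1, Multiset.count_eq_zero_of_notMem hno.2])
  have hbne : bad.Nonempty := by
    obtain ⟨x, hx, hne⟩ := hbad
    exact ⟨x, hbadmem x hx hne⟩
  set x := bad.max' hbne
  obtain ⟨hxm, hrx, hxne⟩ := Finset.mem_filter.mp (bad.max'_mem hbne)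
  have hgt : A.filter (x < ·) = B.filter (x < ·) := by
    refine Multiset.filter_lt_eq_of_count_eq fun z hz => ?_
    by_contra hne
    exact absurd (bad.le_max' z (hbadmem z (hrx.trans hz) hne)) (not_le.mpr hz)
  obtain ⟨y, hyx⟩ : ∃ y : L, ‖y‖ = x := by
    rw [Multiset.mem_toFinset, Multiset.mem_add] at hxm
    rcases hxm with h | h
    · obtain ⟨y, -, hy⟩ := Multiset.mem_map.mp h
      exact ⟨y, hy⟩
    · obtain ⟨y, -, hy⟩ := Multiset.mem_map.mp (Multiset.mem_of_mem_nsmul h)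
      exact ⟨y, hy⟩
  have hy0 : y ≠ 0 := by
    rintro rfl
    rw [norm_zero] at hyx
    exact absurd (hr.trans_lt hrx) (by rw [hyx]; exact lt_irrefl _)
  have hlecard : (S.val.filter (‖·‖ ≤ ‖y‖)).card = e * (T.filter (‖·‖ ≤ ‖y‖)).card := by
    rw [← hAle, ← hBle, hyx]
    exact Multiset.card_filter_le_eq hcardAB hgt
  have hltcard := card_filter_norm_lt_eq hchar hy0 (hyx ▸ hrx) S rep hrep he hfib T ρ
    (by rw [← hgT]; exact hρ) (fun h => hcount h _ (hyx ▸ hrx)) hlecard (by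
      have hn : ∀ M : Multiset L, ‖(M.map (scaledConst y)).prod‖ =
          (M.map fun a => max x ‖a‖).prod := by
        intro M
        rw [← hyx]
        induction M using Multiset.induction_on with
        | empty => simp
        | cons a M ih =>
          rw [Multiset.map_cons, Multiset.prod_cons, norm_mul, ih, norm_scaledConst,
            Multiset.map_cons, Multiset.prod_cons]
      rw [hn, hn, hprod x hgt])
  have h1 := Multiset.card_filter_le_eq_add_count A x
  have h2 := Multiset.card_filter_le_eq_add_count B x
  rw [hAle, hAlt, ← hyx, hlecard, hltcard] at h1
  rw [hBle, hBlt, ← hyx] at h2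
  refine hxne ?_
  change A.count x = B.count x
  rw [← hyx]
  omega

/-! ### Clusters of roots over a complete field -/

section Galois

variable {K L : Type*} [NontriviallyNormedField K] [CompleteSpace K] [IsUltrametricDist K]
  [NormedField L] [NormedAlgebra K L] [Algebra.IsAlgebraic K L]

theorem norm_algEquiv_apply (σ : L ≃ₐ[K] L) (x : L) : ‖σ x‖ = ‖x‖ := by
  rw [NormedAlgebra.norm_eq_spectralNorm K, NormedAlgebra.norm_eq_spectralNorm K,
    ← spectralNorm_eq_of_equiv]

open Classical in
theorem card_filter_roots_norm_sub_le (σ : L ≃ₐ[K] L) (p : K[X])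
    (hp : (p.map (algebraMap K L)).Splits) (a : L) (R : ℝ) :
    ((p.map (algebraMap K L)).roots.filter (‖· - σ a‖ ≤ R)).card =
      ((p.map (algebraMap K L)).roots.filter (‖· - a‖ ≤ R)).card := by
  have h1 : (p.map (algebraMap K L)).roots.map σ = (p.map (algebraMap K L)).roots := by
    have h := hp.roots_map (σ : L →+* L)
    rw [Polynomial.map_map] at h
    have h2 : (σ : L →+* L).comp (algebraMap K L) = algebraMap K L := by
      ext x; simp
    rw [h2] at h
    exact h.symm
  conv_lhs => rw [← h1]
  rw [Multiset.filter_map, Multiset.card_map]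
  congr 1
  refine Multiset.filter_congr fun x _ => ?_
  simp only [Function.comp]
  rw [← map_sub, norm_algEquiv_apply]

variable [IsAlgClosed L] [CharZero K]

open Classical in
/-- Let `f` be bounded at `β`, let `α` be the root of `f` nearest to `β`, and let `e` be the number
of roots at distance at most `‖β - α‖` from `α`. If `e = 1`, then `α ∈ K(β)` by Krasner's lemma, so
the degree of `f` is at most that of `β`. If `e ≥ 2`, the roots fall into clusters of `e` elements,
and the value at `α` of the approximate `e`-th root `g` of `f` is bounded, as
`‖g(α)‖ ^ e ≤ ∏ max ‖β - α‖ ‖a - α‖ = ‖f(β)‖`, the product being taken over the roots `a` of `f`. -/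
theorem natDegree_le_or_exists_bounded_approximateRoot
    (hchar : ∀ n : ℕ, n ≠ 0 → ‖(n : L)‖ = 1) {f : K[X]} (hf : f.Monic) (hirr : Irreducible f)
    {β : L} (hβ : ‖aeval β f‖ ≤ 1) :
    f.natDegree ≤ (minpoly K β).natDegree ∨
    ∃ e m : ℕ, ∃ α : L, 2 ≤ e ∧ f.natDegree = m * e ∧ aeval α f = 0 ∧
      ∀ g : K[X], g.Monic → g.natDegree = m →
        (f - g ^ e).degree < ((m * (e - 1) : ℕ) : WithBot ℕ) → ‖aeval α g‖ ≤ 1 := by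
  have hul : IsUltrametricDist L := IsUltrametricDist.of_normedAlgebra K
  have hclos : IsAlgClosure K L := ⟨inferInstance, inferInstance⟩
  have hnormal : Normal K L := IsAlgClosure.normal K L
  have hsplits : ∀ p : K[X], (p.map (algebraMap K L)).Splits := fun p => IsAlgClosed.splits _
  set S : Finset L := (f.map (algebraMap K L)).roots.toFinset with hS
  have hnodup : (f.map (algebraMap K L)).roots.Nodup :=
    nodup_roots ((separable_map _).mpr hirr.separable)
  have hSval : S.val = (f.map (algebraMap K L)).roots := by
    rw [hS, Multiset.toFinset_val, hnodup.dedup]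
  have hfS : f.map (algebraMap K L) = ∏ a ∈ S, (X - C a) := by
    have h := (hsplits f).eq_prod_roots_of_monic (hf.map _)
    rw [← hSval] at h
    exact h
  have hmemS : ∀ a, a ∈ S ↔ aeval a f = 0 := by
    intro a
    rw [hS, Multiset.mem_toFinset, mem_roots (hf.map _).ne_zero, IsRoot.def, eval_map_algebraMap]
  have hScard : S.card = f.natDegree := by
    have h : S.card = S.val.card := rfl
    rw [h, hSval, ← (hsplits f).natDegree_eq_card_roots, natDegree_map]
  have hminpoly : ∀ a ∈ S, f = minpoly K a := fun a ha =>
    minpoly.eq_of_irreducible_of_monic hirr ((hmemS a).mp ha) hf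
  have htrans : ∀ a ∈ S, ∀ b ∈ S, ∃ σ : L ≃ₐ[K] L, σ a = b := by
    intro a ha b hb
    refine minpoly.exists_algEquiv_of_root (Algebra.IsAlgebraic.isAlgebraic b) ?_
    rw [← hminpoly b hb]
    exact (hmemS a).mp ha
  have hSne : S.Nonempty := by
    rw [← Finset.card_pos, hScard]
    exact hirr.natDegree_pos
  -- the root nearest to `β`
  obtain ⟨α, hαS, hαmin⟩ := S.exists_min_image (fun a => ‖β - a‖) hSne
  set r := ‖β - α‖ with hr
  have hr0 : 0 ≤ r := norm_nonneg _
  have hprod : ∏ a ∈ S, max r ‖a - α‖ ≤ 1 := by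
    have h1 : aeval β f = ∏ a ∈ S, (β - a) := by
      rw [← eval_map_algebraMap, hfS, eval_prod]
      simp
    rw [h1, norm_prod] at hβ
    refine le_of_eq_of_le (Finset.prod_congr rfl fun a ha => ?_) hβ
    have h2 : r ≤ ‖β - a‖ := hαmin a ha
    have e1 : β - a = (β - α) + (α - a) := by ring
    have e2 : a - α = (β - α) - (β - a) := by ring
    refine le_antisymm (max_le h2 ?_) ?_
    · rw [e2, sub_eq_add_neg]
      refine (IsUltrametricDist.norm_add_le_max _ _).trans (max_le h2 ?_)
      rw [norm_neg]
    · rw [norm_sub_rev a α, e1]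
      exact IsUltrametricDist.norm_add_le_max _ _
  -- numbers of roots in discs
  have hcountS : ∀ (R : ℝ) (a b : L), a ∈ S → b ∈ S →
      {c ∈ S | ‖c - a‖ ≤ R}.card = {c ∈ S | ‖c - b‖ ≤ R}.card := by
    intro R a b ha hb
    obtain ⟨σ, rfl⟩ := htrans a ha b hb
    have h := card_filter_roots_norm_sub_le σ f (hsplits f) a R
    rw [← hSval] at h
    exact h.symm
  set e := {c ∈ S | ‖c - α‖ ≤ r}.card with he
  have he1 : 1 ≤ e := by
    rw [he, Nat.one_le_iff_ne_zero, ← Nat.pos_iff_ne_zero, Finset.card_pos]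
    exact ⟨α, Finset.mem_filter.mpr ⟨hαS, by simpa using hr0⟩⟩
  rcases Nat.lt_or_ge 1 e with he2 | he2
  · right
    -- representatives of the clusters
    let st : Setoid L :=
      { r := fun a b => ‖a - b‖ ≤ r
        iseqv :=
          { refl := fun a => by simpa using hr0
            symm := fun {a b} h => by rwa [norm_sub_rev]
            trans := fun {a b c} h1 h2 => by
              have : a - c = (a - b) + (b - c) := by ring
              rw [this]
              exact (IsUltrametricDist.norm_add_le_max _ _).trans (max_le h1 h2) } }
    let rep : L → L := fun a => (Quotient.mk st a).out
    have hrep : ∀ a, ‖a - rep a‖ ≤ r := fun a => by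
      rw [norm_sub_rev]
      exact Quotient.mk_out (s := st) a
    have hrep_eq : ∀ a b, rep b = rep a ↔ ‖b - a‖ ≤ r := by
      intro a b
      constructor
      · intro h
        have h2 := Quotient.out_injective h
        exact Quotient.exact (s := st) h2
      · intro h
        have : (Quotient.mk st b) = Quotient.mk st a := Quotient.sound (s := st) h
        simp only [rep, this]
    have hfib : ∀ a ∈ S, {b ∈ S | rep b = rep a}.card = e := by
      intro a ha
      rw [he, ← hcountS r a α ha hαS]
      simp only [hrep_eq]
    obtain ⟨m, hm⟩ : ∃ m, S.card = m * e := by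
      refine ⟨(S.image rep).card, ?_⟩
      rw [Finset.card_eq_sum_card_image rep S, Finset.sum_const_nat]
      intro b hb
      obtain ⟨a, ha, rfl⟩ := Finset.mem_image.mp hb
      exact hfib a ha
    refine ⟨e, m, α, he2, by rw [← hScard, hm], (hmemS α).mp hαS, ?_⟩
    intro g hg hgm hlt
    set ρ := f - g ^ e with hρ
    -- the number of roots of the error term in a disc around `α`, bounded by averaging over the
    -- conjugates of `α`
    have hcountρ : ∀ R : ℝ, ((ρ.map (algebraMap K L)).roots.filter (‖· - α‖ ≤ R)).card * S.card ≤
        ρ.natDegree * {c ∈ S | ‖c - α‖ ≤ R}.card := by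
      intro R
      have h1 : ∑ a ∈ S, ((ρ.map (algebraMap K L)).roots.filter (‖· - a‖ ≤ R)).card =
          ((ρ.map (algebraMap K L)).roots.filter (‖· - α‖ ≤ R)).card * S.card := by
        rw [Finset.sum_const_nat (m := ((ρ.map (algebraMap K L)).roots.filter
          (‖· - α‖ ≤ R)).card), mul_comm]
        intro a ha
        obtain ⟨σ, rfl⟩ := htrans α hαS a ha
        exact card_filter_roots_norm_sub_le σ ρ (hsplits ρ) α R
      have h2 : ∀ M : Multiset L, ∑ a ∈ S, (M.filter (‖· - a‖ ≤ R)).card ≤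
          M.card * {c ∈ S | ‖c - α‖ ≤ R}.card := by
        intro M
        induction M using Multiset.induction_on with
        | empty => simp
        | cons b M ih =>
          have h3 : ∀ a, ((b ::ₘ M).filter (‖· - a‖ ≤ R)).card =
              (if ‖b - a‖ ≤ R then 1 else 0) + (M.filter (‖· - a‖ ≤ R)).card := by
            intro a
            rw [Multiset.filter_cons]
            split_ifs <;> simp [add_comm]
          simp only [h3]
          rw [Finset.sum_add_distrib, Multiset.card_cons, add_mul, one_mul, add_comm]
          refine add_le_add ih ?_
          rw [← Finset.card_filter]
          rcases Finset.eq_empty_or_nonempty {a ∈ S | ‖b - a‖ ≤ R} with h0 | ⟨a₀, ha₀⟩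
          · rw [h0]; simp
          · rw [Finset.mem_filter] at ha₀
            rw [← hcountS R a₀ α ha₀.1 hαS]
            refine Finset.card_le_card fun a ha => ?_
            rw [Finset.mem_filter] at ha ⊢
            refine ⟨ha.1, ?_⟩
            have : a - a₀ = (b - a₀) + -(b - a) := by ring
            rw [this]
            refine (IsUltrametricDist.norm_add_le_max _ _).trans (max_le ha₀.2 ?_)
            rw [norm_neg]
            exact ha.2
      rw [← h1]
      refine (h2 _).trans (Nat.mul_le_mul_right _ ?_)
      exact (card_roots' _).trans (natDegree_map_le)
    -- recentre at `α`
    have hroots : ∀ p : L[X], ((p.comp (C 1 * X + C α)).roots.map fun x => x + α) = p.roots := by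
      intro p
      have := p.map_roots_comp_C_mul_X_add_C 1 α isUnit_one
      simpa only [one_mul] using this
    set S' := S.image (· - α) with hS'
    have hinj : Function.Injective (· - α : L → L) := sub_left_injective
    have hS'prod : ∏ a ∈ S', max r ‖a‖ = ∏ a ∈ S, max r ‖a - α‖ :=
      Finset.prod_image hinj.injOn
    set g' := (g.map (algebraMap K L)).comp (C 1 * X + C α) with hg'
    have hlin : (C 1 * X + C α : L[X]) = X + C α := by simp
    have hg'mon : g'.Monic := by
      rw [hg', hlin]
      exact (hg.map _).comp (monic_X_add_C α) (by rw [natDegree_X_add_C]; exact one_ne_zero)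
    have hg'deg : g'.natDegree = m := by
      rw [hg', hlin, natDegree_comp, natDegree_X_add_C, mul_one, natDegree_map, hgm]
    have key := prod_max_norm_roots_pow_eq hchar hr0 S' (fun a => rep (a + α) - α) (e := e)
      (g := g') (by
        intro a _
        have := hrep (a + α)
        rwa [show a - (rep (a + α) - α) = a + α - rep (a + α) by ring]) he1 (by
        intro a ha
        obtain ⟨a, ha', rfl⟩ := Finset.mem_image.mp ha
        rw [← hfib a ha', hS', Finset.filter_image, Finset.card_image_of_injective _ hinj]
        simp) hg'mon (by
        rw [Finset.card_image_of_injective _ hinj, hm, hg'deg, mul_comm])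
      ((ρ.map (algebraMap K L)).comp (C 1 * X + C α)) (by
        rw [hg', ← pow_comp, ← Polynomial.map_pow, ← add_comp, ← Polynomial.map_add, hρ,
          add_sub_cancel, hfS, prod_comp, hS', Finset.prod_image hinj.injOn]
        refine Finset.prod_congr rfl fun a _ => ?_
        simp only [sub_comp, X_comp, C_comp, C_sub, C_1, one_mul]
        ring) (by
        intro hne R hR
        have hρ0 : ρ ≠ 0 := by
          rintro h0
          rw [h0] at hne
          simp at hne
        have e1 : (((ρ.map (algebraMap K L)).comp (C 1 * X + C α)).roots.filter (‖·‖ ≤ R)).card =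
            ((ρ.map (algebraMap K L)).roots.filter (‖· - α‖ ≤ R)).card := by
          rw [← hroots (ρ.map (algebraMap K L)), Multiset.filter_map, Multiset.card_map]
          simp
        have e2 : (S'.filter (‖·‖ ≤ R)).card = {c ∈ S | ‖c - α‖ ≤ R}.card := by
          rw [hS', Finset.filter_image, Finset.card_image_of_injective _ hinj]
        rw [e1, e2]
        have h3 := hcountρ R
        have h4 : ρ.natDegree < m * (e - 1) := by
          rw [degree_eq_natDegree hρ0] at hlt
          exact_mod_cast hlt
        have h5 : 0 < {c ∈ S | ‖c - α‖ ≤ R}.card :=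
          Finset.card_pos.mpr ⟨α, Finset.mem_filter.mpr ⟨hαS, by simpa using hr0.trans hR.le⟩⟩
        have hm0 : 0 < m := Nat.pos_of_ne_zero fun h => by rw [h] at h4; simp at h4
        rw [hm] at h3
        have h6 := (Nat.mul_lt_mul_of_pos_right h4 h5)
        have h7 := h3.trans_lt h6
        refine lt_of_mul_lt_mul_left (a := m) ?_ (Nat.zero_le m)
        calc _ = ((ρ.map (algebraMap K L)).roots.filter (‖· - α‖ ≤ R)).card * (m * e) := by ring
          _ < _ := h7
          _ = _ := by ring)
    rw [hS'prod] at key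
    have hP1 : (g'.roots.map fun b => max r ‖b‖).prod ≤ 1 := by
      by_contra hgt
      exact absurd (key ▸ hprod) (not_le.mpr (one_lt_pow₀ (not_le.mp hgt) (by omega)))
    have hval : aeval α g = g'.eval 0 := by
      rw [hg', eval_comp, ← eval_map_algebraMap]
      simp
    have hg'prod : g' = (g'.roots.map fun a => X - C a).prod :=
      (IsAlgClosed.splits g').eq_prod_roots_of_monic hg'mon
    rw [hval, hg'prod]
    refine le_trans ?_ hP1
    generalize g'.roots = M
    induction M using Multiset.induction_on with
    | empty => simp
    | cons b M ih =>
      simp only [Multiset.map_cons, Multiset.prod_cons, eval_mul, norm_mul]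
      refine mul_le_mul ?_ ih (norm_nonneg _) (le_max_of_le_left hr0)
      simp
  · left
    -- the nearest root is nearer to `β` than to its conjugates, and Krasner's lemma applies
    have hkr : α ∈ IntermediateField.adjoin K {β} := by
      refine IsKrasner.krasner (K := K) (L := L) (x := α) (y := β) ?_ (hsplits _)
        (Algebra.IsIntegral.isIntegral β) ?_
      · rw [← hminpoly α hαS]; exact hirr.separable
      · intro x' hx' hne
        have hx'S : x' ∈ S := by
          rw [hmemS, hminpoly α hαS, hx']
          exact minpoly.aeval K x'
        rw [norm_sub_rev α β, norm_sub_rev α x']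
        by_contra hle
        have : 1 < e := by
          rw [he, Finset.one_lt_card]
          exact ⟨α, Finset.mem_filter.mpr ⟨hαS, by simpa using hr0⟩, x',
            Finset.mem_filter.mpr ⟨hx'S, not_lt.mp hle⟩, hne⟩
        omega
    have hβint : IsIntegral K β := Algebra.IsIntegral.isIntegral β
    have hle : IntermediateField.adjoin K {α} ≤ IntermediateField.adjoin K {β} := by
      rw [IntermediateField.adjoin_simple_le_iff]
      exact hkr
    rw [hminpoly α hαS, ← IntermediateField.adjoin.finrank (Algebra.IsIntegral.isIntegral α),
      ← IntermediateField.adjoin.finrank hβint]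
    have := IntermediateField.adjoin.finiteDimensional hβint
    exact IntermediateField.finrank_le_of_le_right hle

end Galois

/-! ### Functions bounded at infinity -/

section Bounded

variable {K L : Type*} [NontriviallyNormedField K] [CompleteSpace K] [IsUltrametricDist K]
  [NormedField L] [NormedAlgebra K L]

/-- A polynomial with bounded coefficients is bounded at bounded elements. -/
theorem norm_sum_algebraMap_mul_pow_le_one {F : Type*} [Field F] [IsUltrametricDist L]
    (ι : F →+* L) (hι : ∀ c, ‖ι c‖ ≤ 1) {z : L} (hz : ‖z‖ ≤ 1) (χ : F[X]) :
    ‖χ.eval₂ ι z‖ ≤ 1 := by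
  rw [eval₂_eq_sum_range]
  refine IsUltrametricDist.norm_sum_le_of_forall_le_of_nonneg zero_le_one fun i _ => ?_
  rw [norm_mul, norm_pow]
  exact mul_le_one₀ (hι _) (by positivity) (pow_le_one₀ (norm_nonneg _) hz)

/-- A polynomial in two variables which is bounded at the only place at infinity of an integral
curve is constant on that curve; so a monic one, whose degree in the second variable lies strictly
between `0` and that of the equation of the curve, is not bounded. -/
theorem not_norm_aeval_le_one {F : Type*} [Field F] [IsAlgClosed F] (ι : F[X] →+* K) {B : ℝ}
    (hB : 1 < B) (hι : ∀ p : F[X], p ≠ 0 → ‖ι p‖ = B ^ p.natDegree) {f g : F[X][X]} (hf : f.Monic)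
    (hirr : Irreducible (f.map ι)) (hg : g.Monic) (hg0 : 0 < g.natDegree)
    (hgf : g.natDegree < f.natDegree) {α : L} (hα : aeval α (f.map ι) = 0) :
    ¬ ‖aeval α (g.map ι)‖ ≤ 1 := by
  intro hbd
  have hul : IsUltrametricDist L := IsUltrametricDist.of_normedAlgebra K
  set d := f.natDegree with hd
  have hfK : (f.map ι).natDegree = d := hf.natDegree_map ι
  have hfKmon : (f.map ι).Monic := hf.map ι
  have hmin : f.map ι = minpoly K α := minpoly.eq_of_irreducible_of_monic hirr hα hfKmon
  -- coordinates in the basis of powers of `α` are bounded by the norm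
  let T : (Fin d → K) →ₗ[K] L :=
    { toFun := fun c => ∑ i : Fin d, c i • α ^ (i : ℕ)
      map_add' := fun a b => by simp [add_smul, Finset.sum_add_distrib]
      map_smul' := fun a b => by simp [Finset.smul_sum, mul_smul] }
  have hTval : ∀ p : K[X], p.natDegree < d → T (fun i => p.coeff i) = aeval α p := by
    intro p hp
    rw [aeval_eq_sum_range' hp]
    exact Fin.sum_univ_eq_sum_range (fun i => p.coeff i • α ^ i) d
  have hTker : LinearMap.ker T = ⊥ := by
    rw [LinearMap.ker_eq_bot']
    intro c hc
    set p : K[X] := ∑ i : Fin d, C (c i) * X ^ (i : ℕ) with hp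
    have hcoeff : ∀ i : Fin d, p.coeff i = c i := by
      intro i
      simp only [hp, finsetSum_coeff, coeff_C_mul, coeff_X_pow]
      rw [Finset.sum_eq_single i]
      · simp
      · intro b _ hb
        rw [if_neg (fun h => hb (Fin.ext h.symm)), mul_zero]
      · simp
    have hpα : aeval α p = 0 := by
      rw [← hc]
      simp [hp, T, Algebra.smul_def]
    have hdvd := minpoly.dvd K α hpα
    rw [← hmin] at hdvd
    have hp0 : p = 0 := by
      by_contra hne
      have h1 := degree_le_of_dvd hdvd hne
      rw [degree_eq_natDegree hfKmon.ne_zero, hfK] at h1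
      have h2 : p.degree < d := by
        refine lt_of_le_of_lt (degree_sum_le _ _) ?_
        rw [Finset.sup_lt_iff (WithBot.bot_lt_coe _)]
        intro i _
        exact lt_of_le_of_lt (degree_C_mul_X_pow_le _ _) (by exact_mod_cast i.2)
      exact absurd h2 (not_lt.mpr h1)
    funext i
    rw [← hcoeff i, hp0]; simp
  obtain ⟨A, hA0, hA⟩ := T.exists_antilipschitzWith hTker
  have hcoord : ∀ c : Fin d → K, ‖c‖ ≤ A * ‖T c‖ := by
    intro c
    have := hA.le_mul_dist c 0
    simpa [dist_eq_norm] using this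
  obtain ⟨N, hN⟩ := pow_unbounded_of_one_lt (A : ℝ) hB
  have hC : ∀ c : F, ‖ι (C c)‖ ≤ 1 := by
    intro c
    by_cases hc : c = 0
    · simp [hc]
    · rw [hι _ (by simpa using hc)]; simp
  -- the remainders modulo `f` of the polynomials in `g` have coordinates of bounded degree, hence
  -- lie in a finite-dimensional space; so `f` divides a nonzero polynomial in `g`
  let h : F[X] → F[X][X] := fun χ => (aeval g χ) %ₘ f
  have hdegh : ∀ χ, (h χ).natDegree < d := by
    intro χ
    by_cases h0 : h χ = 0
    · rw [h0]; simpa using hg0.trans hgf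
    · exact (natDegree_modByMonic_lt _ hf (by
        rintro rfl
        simp [hd] at hgf))
  have hbound : ∀ χ i j, N ≤ j → ((h χ).coeff i).coeff j = 0 := by
    intro χ i j hj
    rcases Nat.lt_or_ge i d with hi | hi
    swap
    · rw [coeff_eq_zero_of_natDegree_lt ((hdegh χ).trans_le hi)]; simp
    by_contra hne
    have hne0 : (h χ).coeff i ≠ 0 := by
      intro h0; rw [h0] at hne; simp at hne
    have hval : ‖aeval α ((h χ).map ι)‖ ≤ 1 := by
      have h1 : aeval α ((h χ).map ι) = aeval α ((aeval g χ).map ι) := by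
        have h2 := congrArg (fun p => aeval α (p.map ι)) (modByMonic_add_div (aeval g χ) f)
        simp only [Polynomial.map_add, Polynomial.map_mul, map_add, map_mul, hα, zero_mul,
          add_zero] at h2
        exact h2
      have h3 : aeval α ((aeval g χ).map ι) =
          χ.eval₂ (((algebraMap K L).comp ι).comp C) (aeval α (g.map ι)) := by
        have h4 : aeval α ((aeval g χ).map ι) =
            ((aeval α : K[X] →ₐ[K] L) : K[X] →+* L).comp (mapRingHom ι) (aeval g χ) := rfl
        rw [h4, aeval_def, hom_eval₂]
        congr 1
        ext c
        simp
      rw [h1, h3]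
      refine norm_sum_algebraMap_mul_pow_le_one _ (fun c => ?_) hbd χ
      simp only [RingHom.comp_apply]
      rw [norm_algebraMap']
      exact hC c
    have h5 := hcoord (fun i => ((h χ).map ι).coeff i)
    rw [hTval _ (by exact (natDegree_map_le).trans_lt (hdegh χ))] at h5
    have h6 := (norm_le_pi_norm (fun i : Fin d => ((h χ).map ι).coeff i) ⟨i, hi⟩).trans h5
    have h7 : A * ‖aeval α ((h χ).map ι)‖ ≤ A := mul_le_of_le_one_right A.2 hval
    have h8 := h6.trans h7
    simp only [coeff_map] at h8
    rw [hι _ hne0] at h8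
    have h9 : B ^ N ≤ B ^ ((h χ).coeff i).natDegree :=
      pow_le_pow_right₀ hB.le (hj.trans (le_natDegree_of_ne_zero hne))
    linarith
  let Ψ : F[X] →ₗ[F] (Fin d × Fin N → F) :=
    { toFun := fun χ q => ((h χ).coeff q.1).coeff q.2
      map_add' := fun a b => by
        funext q
        simp [h, add_modByMonic]
      map_smul' := fun a b => by
        funext q
        have : (aeval g) (a • b) = (C a : F[X]) • aeval g b := by
          rw [map_smul, ← algebraMap_eq, algebraMap_smul]
        simp only [h, this, smul_modByMonic]
        simp }
  obtain ⟨χ, hχ0, hχ⟩ : ∃ χ : F[X], χ ≠ 0 ∧ f ∣ aeval g χ := by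
    by_contra! hno
    refine Polynomial.not_finite (R := F) (Module.Finite.of_injective Ψ ?_)
    rw [injective_iff_map_eq_zero]
    intro χ hχ
    by_contra hne
    refine hno χ hne ((modByMonic_eq_zero_iff_dvd hf).mp ?_)
    change h χ = 0
    ext i j
    rcases Nat.lt_or_ge j N with hj | hj
    swap
    · rw [hbound χ i j hj]; simp
    rcases Nat.lt_or_ge i d with hi | hi
    swap
    · rw [coeff_eq_zero_of_natDegree_lt ((hdegh χ).trans_le hi)]; simp
    have := congrFun hχ (⟨i, hi⟩, ⟨j, hj⟩)
    simpa [Ψ] using this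
  -- `f` divides a product of factors `g - t`
  have hprod : aeval g χ = C (C χ.leadingCoeff) * (χ.roots.map fun t => g - C (C t)).prod := by
    conv_lhs => rw [(IsAlgClosed.splits χ).eq_prod_roots]
    rw [map_mul, aeval_C, map_multiset_prod, Multiset.map_map]
    simp only [Function.comp_def, map_sub, aeval_X, aeval_C]
    rfl
  rw [hprod] at hχ
  have hχK := Polynomial.map_dvd ι hχ
  rw [Polynomial.map_mul] at hχK
  rcases hirr.prime.dvd_or_dvd hχK with h1 | h1
  · rw [Polynomial.map_C] at h1
    have h2 : ι (C χ.leadingCoeff) ≠ 0 := by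
      rw [← norm_ne_zero_iff, hι _ (by simpa using hχ0)]
      simp
    exact hirr.not_isUnit (isUnit_of_dvd_unit h1 (isUnit_C.mpr h2.isUnit))
  · rw [← coe_mapRingHom, map_multiset_prod, Multiset.map_map] at h1
    obtain ⟨t, -, ht⟩ := hirr.prime.exists_mem_multiset_map_dvd h1
    have hmon : (g - C (C t)).Monic := hg.sub_of_left (by
      rw [degree_eq_natDegree hg.ne_zero]
      exact lt_of_le_of_lt degree_C_le (by exact_mod_cast hg0))
    have hdeg : (g - C (C t)).natDegree = g.natDegree := natDegree_sub_C
    have h3 := natDegree_le_of_dvd ht (by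
      simp only [Function.comp, coe_mapRingHom]
      exact (hmon.map ι).ne_zero)
    simp only [Function.comp, coe_mapRingHom] at h3
    rw [hfK, hmon.natDegree_map, hdeg] at h3
    omega

end Bounded

/-- **Moh's inequality**, over a complete field: if `f` is monic in the second variable and stays
irreducible at the place at infinity of the first variable, and `f` is bounded at `β`, then the
degree of `β` is at least that of `f`. -/
theorem natDegree_le_natDegree_minpoly {K L : Type*} [NontriviallyNormedField K] [CompleteSpace K]
    [IsUltrametricDist K] [NormedField L] [NormedAlgebra K L] [Algebra.IsAlgebraic K L]
    [IsAlgClosed L] [CharZero K] (hchar : ∀ n : ℕ, n ≠ 0 → ‖(n : L)‖ = 1)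
    {F : Type*} [Field F] [IsAlgClosed F] [CharZero F] (ι : F[X] →+* K) {B : ℝ}
    (hB : 1 < B) (hι : ∀ p : F[X], p ≠ 0 → ‖ι p‖ = B ^ p.natDegree) {f : F[X][X]} (hf : f.Monic)
    (hirr : Irreducible (f.map ι)) {β : L} (hβ : ‖aeval β (f.map ι)‖ ≤ 1) :
    f.natDegree ≤ (minpoly K β).natDegree := by
  rcases natDegree_le_or_exists_bounded_approximateRoot hchar (hf.map ι) hirr hβ with h | h
  · rwa [hf.natDegree_map] at h
  · exfalso
    obtain ⟨e, m, α, he, hdeg, hα, hg⟩ := h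
    rw [hf.natDegree_map] at hdeg
    have heunit : IsUnit (e : F[X]) := by
      rw [← C_eq_natCast, isUnit_C, isUnit_iff_ne_zero]
      exact_mod_cast (by omega : e ≠ 0)
    obtain ⟨g, hgmon, hgm, hlt⟩ := exists_approximateRoot heunit hf hdeg
    have hfpos : 0 < f.natDegree := by
      have := hirr.natDegree_pos
      rwa [hf.natDegree_map] at this
    have hm0 : 0 < m := Nat.pos_of_ne_zero fun h => by rw [hdeg, h] at hfpos; simp at hfpos
    refine not_norm_aeval_le_one ι hB hι hf hirr hgmon (hgm ▸ hm0) ?_ hα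
      (hg _ (hgmon.map ι) (by rw [hgmon.natDegree_map, hgm]) ?_)
    · rw [hgm, hdeg]
      nlinarith
    · rw [← Polynomial.map_pow, ← Polynomial.map_sub]
      exact lt_of_le_of_lt degree_map_le hlt

/-! ### Moh's inequality for parametrizations -/

theorem norm_le_one_of_isIntegral_of_norm_le {L A : Type*} [NormedField L] [IsUltrametricDist L]
    [CommRing A] (j : A →+* L) (hj : ∀ a, ‖j a‖ ≤ 1) {p : A[X]} (hp : p.Monic) {x : L}
    (hx : p.eval₂ j x = 0) : ‖x‖ ≤ 1 := by
  let j' : A →+* unitBall L := j.codRestrict _ fun a => mem_unitBall.mpr (hj a)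
  have hint : IsIntegral (unitBall L) x := by
    refine ⟨p.map j', hp.map _, ?_⟩
    rw [eval₂_map]
    exact hx
  obtain ⟨y, hy⟩ := (IsIntegrallyClosed.isIntegral_iff (R := unitBall L)).mp hint
  rw [← hy]
  exact mem_unitBall.mp y.2

/-- Moh's inequality for a parametrization: `N` is a ring of functions on the parameter line, finite
over `A` with `D` generators, and `β = V / u` is the value of the second variable. The powers of `β`
lie in the span of the generators, so that `β` has degree at most `D`; and the value `W` of `f` at
`β` is integral over `A`, hence bounded. -/
theorem natDegree_le_of_parametrization {K L : Type*} [NontriviallyNormedField K] [CompleteSpace K]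
    [IsUltrametricDist K] [NormedField L] [NormedAlgebra K L] [Algebra.IsAlgebraic K L]
    [IsAlgClosed L] [CharZero K] (hchar : ∀ n : ℕ, n ≠ 0 → ‖(n : L)‖ = 1)
    {F : Type*} [Field F] [IsAlgClosed F] [CharZero F] (ι : F[X] →+* K) {B : ℝ}
    (hB : 1 < B) (hι : ∀ p : F[X], p ≠ 0 → ‖ι p‖ = B ^ p.natDegree) {f : F[X][X]} (hf : f.Monic)
    (hirr : Irreducible (f.map ι)) {A N M : Type*} [CommRing A] [CommRing N] [Field M]
    (τ : K →+* M)
    (j : A →+* K) (hj : ∀ a, ‖j a‖ ≤ 1) (k : N →+* M) (σ : A →+* N)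
    (hcomm : ∀ a, τ (j a) = k (σ a)) {D : ℕ} (b : Fin D → N)
    (hspan : ∀ h : N, ∃ c : Fin D → A, h = ∑ i, σ (c i) * b i) (u : A) (V W : N)
    (hW : (f.map ι).eval₂ τ (k V / τ (j u)) = k W) : f.natDegree ≤ D := by
  let := τ.toAlgebra
  replace hcomm : ∀ a, algebraMap K M (j a) = k (σ a) := hcomm
  replace hW : aeval (k V / algebraMap K M (j u)) (f.map ι) = k W := hW
  set β : M := k V / algebraMap K M (j u) with hβ
  have hul : IsUltrametricDist L := IsUltrametricDist.of_normedAlgebra K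
  -- the span of the generators is closed under multiplication by elements of `N`
  set S : Submodule K M := Submodule.span K (Set.range fun i => k (b i)) with hS
  have hNS : ∀ h : N, k h ∈ S := by
    intro h
    obtain ⟨c, rfl⟩ := hspan h
    rw [map_sum]
    refine Submodule.sum_mem _ fun i _ => ?_
    rw [map_mul, ← hcomm, ← Algebra.smul_def]
    exact Submodule.smul_mem _ _ (Submodule.subset_span ⟨i, rfl⟩)
  have hβS : ∀ n : ℕ, β ^ n ∈ S := by
    intro n
    have : β ^ n = ((j u) ^ n)⁻¹ • k (V ^ n) := by
      rw [hβ, div_pow, Algebra.smul_def, map_inv₀, map_pow, map_pow, div_eq_inv_mul]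
    rw [this]
    exact Submodule.smul_mem _ _ (hNS _)
  have hSD : Module.finrank K S ≤ D := by
    have := finrank_range_le_card (R := K) (fun i => k (b i))
    simpa [Set.finrank] using this
  have hSfin : Module.Finite K S := Module.Finite.span_of_finite K (Set.finite_range _)
  have hdep : ¬ LinearIndependent K (fun n : Fin (D + 1) => (⟨β ^ (n : ℕ), hβS n⟩ : S)) := by
    intro h
    have := h.fintype_card_le_finrank
    simp at this
    omega
  obtain ⟨p, hp0, hpdeg, hp⟩ : ∃ p : K[X], p ≠ 0 ∧ p.natDegree ≤ D ∧ aeval β p = 0 := by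
    rw [Fintype.not_linearIndependent_iff] at hdep
    obtain ⟨g, hg, i, hi⟩ := hdep
    refine ⟨∑ n : Fin (D + 1), C (g n) * X ^ (n : ℕ), ?_, ?_, ?_⟩
    · intro h0
      have := congrArg (fun q => q.coeff i) h0
      simp only [finsetSum_coeff, coeff_C_mul, coeff_X_pow, coeff_zero] at this
      rw [Finset.sum_eq_single i] at this
      · simp at this; exact hi this
      · intro b _ hb
        rw [if_neg (fun h => hb (Fin.ext h.symm)), mul_zero]
      · simp
    · refine natDegree_sum_le_of_forall_le _ _ fun n _ => ?_
      exact (natDegree_C_mul_X_pow_le _ _).trans (by omega)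
    · have := congrArg Subtype.val hg
      simp only [Submodule.coe_sum, Submodule.coe_smul, Submodule.coe_zero] at this
      simpa [Algebra.smul_def] using this
  have hint : IsIntegral K β := by
    rw [← isAlgebraic_iff_isIntegral]
    exact ⟨p, hp0, hp⟩
  have hmin : (minpoly K β).natDegree ≤ D :=
    (natDegree_le_of_dvd (minpoly.dvd K β hp) hp0).trans hpdeg
  obtain ⟨γ, hγ⟩ := IsAlgClosed.exists_aeval_eq_zero L (minpoly K β)
    (minpoly.degree_pos hint).ne'
  have hγmin : minpoly K γ = minpoly K β :=
    (minpoly.eq_of_irreducible_of_monic (minpoly.irreducible hint) hγ (minpoly.monic hint)).symm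
  rw [← hγmin] at hmin
  refine le_trans (natDegree_le_natDegree_minpoly hchar ι hB hι hf hirr ?_) hmin
  -- integrality of `W` over `A`
  obtain ⟨P, hP, hPW⟩ : ∃ P : A[X], P.Monic ∧ P.eval₂ σ W = 0 := by
    let := σ.toAlgebra
    classical
    have hfin : Module.Finite A N := by
      refine ⟨⟨Finset.univ.image b, ?_⟩⟩
      rw [eq_top_iff]
      intro h _
      obtain ⟨c, rfl⟩ := hspan h
      refine Submodule.sum_mem _ fun i _ => ?_
      have : σ (c i) * b i = c i • b i := (Algebra.smul_def _ _).symm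
      rw [this]
      exact Submodule.smul_mem _ _ (Submodule.subset_span (by simp))
    exact Algebra.IsIntegral.isIntegral (R := A) W
  refine norm_le_one_of_isIntegral_of_norm_le ((algebraMap K L).comp j)
    (fun a => by rw [RingHom.comp_apply, norm_algebraMap']; exact hj a) hP ?_
  have h1 : aeval β ((P.map j).comp (f.map ι)) = 0 := by
    rw [aeval_comp, hW, aeval_def, eval₂_map]
    have : (algebraMap K M).comp j = k.comp σ := RingHom.ext hcomm
    rw [this, ← hom_eval₂, hPW, map_zero]
  have h2 : aeval γ ((P.map j).comp (f.map ι)) = 0 := by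
    obtain ⟨r, hr⟩ := minpoly.dvd K β h1
    rw [hr, map_mul, hγ, zero_mul]
  rw [aeval_comp, aeval_def, eval₂_map] at h2
  exact h2

/-- The absolute value of a complete field extends to an algebraic closure, so that no such closure
need be given in `natDegree_le_of_parametrization`. -/
theorem natDegree_le_of_parametrization_of_complete {K : Type*} [NontriviallyNormedField K] [CompleteSpace K]
    [IsUltrametricDist K] [CharZero K] (hchar : ∀ n : ℕ, n ≠ 0 → ‖(n : K)‖ = 1)
    {F : Type*} [Field F] [IsAlgClosed F] [CharZero F] (ι : F[X] →+* K) {B : ℝ}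
    (hB : 1 < B) (hι : ∀ p : F[X], p ≠ 0 → ‖ι p‖ = B ^ p.natDegree) {f : F[X][X]} (hf : f.Monic)
    (hirr : Irreducible (f.map ι)) {A N M : Type*} [CommRing A] [CommRing N] [Field M]
    (τ : K →+* M)
    (j : A →+* K) (hj : ∀ a, ‖j a‖ ≤ 1) (k : N →+* M) (σ : A →+* N)
    (hcomm : ∀ a, τ (j a) = k (σ a)) {D : ℕ} (b : Fin D → N)
    (hspan : ∀ h : N, ∃ c : Fin D → A, h = ∑ i, σ (c i) * b i) (u : A) (V W : N)
    (hW : (f.map ι).eval₂ τ (k V / τ (j u)) = k W) : f.natDegree ≤ D := by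
  let nL : NormedField (AlgebraicClosure K) := spectralNorm.normedField K (AlgebraicClosure K)
  let aL : NormedAlgebra K (AlgebraicClosure K) :=
    spectralNorm.normedAlgebra K (AlgebraicClosure K)
  refine natDegree_le_of_parametrization (L := AlgebraicClosure K) (fun n hn => ?_) ι hB hι hf
    hirr τ j hj k σ hcomm b hspan u V W hW
  have h1 := norm_algebraMap' (AlgebraicClosure K) (n : K)
  rw [map_natCast] at h1
  rw [h1, hchar n hn]

namespace PowerSeries

/-- A power series ring is generated, as a module over the image of a substitution by a series of
order `D`, by the first `D` powers of the variable. -/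
theorem exists_eq_sum_subst_mul_X_pow {k : Type*} [Field k] {U : k⟦X⟧} {D : ℕ}
    (hD : 1 ≤ D) (hU : U.order = D) (h : k⟦X⟧) :
    ∃ c : Fin D → k⟦X⟧, h = ∑ i, (c i).subst U * X ^ (i : ℕ) := by
  have hUs : HasSubst U := by
    refine HasSubst.of_constantCoeff_zero' ?_
    rw [← coeff_zero_eq_constantCoeff_apply]
    exact coeff_of_lt_order _ (by rw [hU]; exact_mod_cast hD)
  have hU0 : U ≠ 0 := by
    rintro rfl
    simp at hU
  obtain ⟨W, hW⟩ : X ^ D ∣ U := X_pow_dvd_iff.mpr fun m hm =>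
    coeff_of_lt_order _ (by rw [hU]; exact_mod_cast hm)
  have hWc : constantCoeff W ≠ 0 := by
    intro h0
    have h1 := coeff_order hU0
    rw [hU, ENat.toNat_natCast, hW, coeff_X_pow_mul' ] at h1
    simp [h0] at h1
  obtain ⟨w, hw⟩ := (isUnit_iff_constantCoeff.mpr hWc.isUnit : IsUnit W).exists_right_inv
  have hXD : ∀ g : k⟦X⟧, X ^ D * g = U * (w * g) := by
    intro g
    rw [hW, mul_assoc, ← mul_assoc W, hw, one_mul]
  let H : ℕ → k⟦X⟧ := fun n => (fun g => w * mk fun i => coeff (i + D) g)^[n] h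
  have hH : ∀ n, H n = ∑ i : Fin D, C (coeff (i : ℕ) (H n)) * X ^ (i : ℕ) + U * H (n + 1) := by
    intro n
    have h1 : H (n + 1) = w * mk fun i => coeff (i + D) (H n) := Function.iterate_succ_apply' _ _ _
    rw [h1, ← hXD]
    ext m
    rw [map_add, map_sum, coeff_X_pow_mul']
    simp only [coeff_C_mul, coeff_X_pow, coeff_mk]
    by_cases hm : D ≤ m
    · rw [Finset.sum_eq_zero, if_pos hm, Nat.sub_add_cancel hm, zero_add]
      intro i _
      rw [if_neg (by omega), mul_zero]
    · rw [if_neg hm, Finset.sum_eq_single ⟨m, not_le.mp hm⟩, if_pos rfl, mul_one, add_zero]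
      · intro i _ hi
        rw [if_neg (fun h => hi (Fin.ext h.symm)), mul_zero]
      · simp
  let c : ℕ → Fin D → k⟦X⟧ := fun n i => mk fun m => coeff (i : ℕ) (H (n + m))
  have hc : ∀ n i, c n i = C (coeff (i : ℕ) (H n)) + X * c (n + 1) i := by
    intro n i
    ext m
    rcases m with _ | m
    · simp [c]
    · rw [map_add, mul_comm, coeff_succ_mul_X]
      simp [c, add_assoc, add_comm 1 m]
  let E : ℕ → k⟦X⟧ := fun n => H n - ∑ i, (c n i).subst U * X ^ (i : ℕ)
  have hE : ∀ n, E n = U * E (n + 1) := by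
    intro n
    have h1 : ∀ i, (c n i).subst U = C (coeff (i : ℕ) (H n)) + U * (c (n + 1) i).subst U := by
      intro i
      rw [hc n i, subst_add hUs, subst_mul hUs, subst_X hUs, subst_C]
      rfl
    simp only [E, h1, mul_sub, Finset.mul_sum, add_mul, Finset.sum_add_distrib, ← mul_assoc]
    nth_rewrite 1 [hH n]
    ring
  have hE' : ∀ n, E 0 = U ^ n * E n := by
    intro n
    induction n with
    | zero => simp
    | succ n ih => rw [ih, hE n, pow_succ, mul_assoc]
  have hE0 : E 0 = 0 := by
    ext n
    have : X ^ (n + 1) ∣ E 0 := by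
      rw [hE' (n + 1)]
      refine Dvd.dvd.mul_right (pow_dvd_pow_of_dvd ?_ _) _
      rw [hW]
      exact Dvd.dvd.mul_right (dvd_pow_self _ (by omega)) _
    rw [X_pow_dvd_iff.mp this n (Nat.lt_succ_self n), map_zero]
  exact ⟨c 0, sub_eq_zero.mp hE0⟩

end PowerSeries

open Valued in
/-- Moh's inequality for the place at infinity of a plane curve, with uniformizer `1 / x` at infinity
on the line: the complete field is that of the Laurent series, and a polynomial `p` in `x` has norm
`‖x‖ ^ deg p`, because its reverse is a unit of the power series ring. -/
theorem LaurentSeries.natDegree_le_order {k : Type*} [Field k] [IsAlgClosed k] [CharZero k]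
    {f : k[X][X]} (hf : f.Monic) (ι : k[X] →+* LaurentSeries k)
    (hιC : ∀ c, ι (C c) = algebraMap (PowerSeries k) (LaurentSeries k) (PowerSeries.C c))
    (hιX : ι X = (algebraMap (PowerSeries k) (LaurentSeries k) PowerSeries.X)⁻¹)
    (hirr : Irreducible (f.map ι)) {U V W : PowerSeries k} {D : ℕ} (hD : 1 ≤ D) (hU : U.order = D)
    (σ : LaurentSeries k →+* LaurentSeries k)
    (hσ : ∀ a : PowerSeries k, σ (algebraMap _ _ a) = algebraMap (PowerSeries k) (LaurentSeries k) (a.subst U))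
    (hW : (f.map ι).eval₂ σ
      (algebraMap _ (LaurentSeries k) V / algebraMap _ (LaurentSeries k) U) =
        algebraMap _ (LaurentSeries k) W) :
    f.natDegree ≤ D := by
  obtain ⟨hR⟩ : Nonempty (Valuation.RankOne (Valued.v : Valuation (LaurentSeries k) _)) := by
    have : Valuation.IsNontrivial (Valued.v : Valuation (LaurentSeries k) _) := by
      refine ⟨⟨HahnSeries.single 1 1, ?_, ?_⟩⟩
      · simp
      · rw [LaurentSeries.valuation_single_zpow]
        decide
    rw [Valuation.nonempty_rankOne_iff_mulArchimedean]
    infer_instance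
  let nK : NontriviallyNormedField (LaurentSeries k) := Valued.toNontriviallyNormedField _ _
  have hcomp : CompleteSpace (LaurentSeries k) := inferInstance
  have hul : IsUltrametricDist (LaurentSeries k) := inferInstance
  have hle : ∀ a : PowerSeries k, ‖algebraMap (PowerSeries k) (LaurentSeries k) a‖ ≤ 1 := by
    intro a
    rw [Valued.toNormedField.norm_le_one_iff, LaurentSeries.val_le_one_iff_eq_coe]
    exact ⟨a, rfl⟩
  have hunit : ∀ a : PowerSeries k, IsUnit a →
      ‖algebraMap (PowerSeries k) (LaurentSeries k) a‖ = 1 := by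
    intro a ha
    obtain ⟨b, hb⟩ := ha.exists_right_inv
    refine le_antisymm (hle a) ?_
    have h1 : ‖algebraMap (PowerSeries k) (LaurentSeries k) a‖ *
        ‖algebraMap (PowerSeries k) (LaurentSeries k) b‖ = 1 := by
      rw [← norm_mul, ← map_mul, hb, map_one, norm_one]
    nlinarith [hle b, norm_nonneg (algebraMap (PowerSeries k) (LaurentSeries k) a)]
  have hX0 : algebraMap (PowerSeries k) (LaurentSeries k) PowerSeries.X ≠ 0 := by
    rw [ne_eq, FaithfulSMul.algebraMap_eq_zero_iff]
    exact PowerSeries.X_ne_zero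
  have hB : 1 < ‖ι X‖ := by
    rw [hιX, norm_inv]
    refine (one_lt_inv₀ (norm_pos_iff.mpr hX0)).mpr ?_
    rw [Valued.toNormedField.norm_lt_one_iff]
    have := LaurentSeries.valuation_single_zpow k 1
    rw [← PowerSeries.coe_X] at this
    refine lt_of_eq_of_lt this ?_
    decide
  have hι : ∀ p : k[X], p ≠ 0 → ‖ι p‖ = ‖ι X‖ ^ p.natDegree := by
    intro p hp
    have h1 : ι p * (algebraMap (PowerSeries k) (LaurentSeries k) PowerSeries.X) ^ p.natDegree =
        algebraMap (PowerSeries k) (LaurentSeries k) (p.reverse : PowerSeries k) := by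
      let x := algebraMap (PowerSeries k) (LaurentSeries k) PowerSeries.X
      have hx : x ≠ 0 := hX0
      let := invertibleOfNonzero (inv_ne_zero hx)
      have h2 := eval₂_reverse_mul_pow ((algebraMap (PowerSeries k) (LaurentSeries k)).comp
        PowerSeries.C) x⁻¹ p
      have h3 : ι p = p.eval₂ ((algebraMap (PowerSeries k) (LaurentSeries k)).comp
          PowerSeries.C) x⁻¹ := by
        conv_lhs => rw [p.as_sum_range_C_mul_X_pow]
        rw [eval₂_eq_sum_range, map_sum]
        simp only [map_mul, map_pow, hιC, hιX]
        rfl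
      have h4 : (p.reverse : PowerSeries k) = p.reverse.eval₂ PowerSeries.C PowerSeries.X := by
        rw [eval₂_C_X_eq_coe]
      rw [h3, ← h2, mul_assoc, inv_pow, inv_mul_cancel₀ (pow_ne_zero _ hx), mul_one, h4, hom_eval₂,
        invOf_eq_inv, inv_inv]
    have h2 : IsUnit (p.reverse : PowerSeries k) := by
      rw [PowerSeries.isUnit_iff_constantCoeff]
      simpa using hp
    have h3 := congrArg norm h1
    rw [norm_mul, hunit _ h2, norm_pow] at h3
    rw [hιX, norm_inv, inv_pow]
    exact eq_inv_of_mul_eq_one_left h3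
  have hchar0 : CharZero (LaurentSeries k) :=
    charZero_of_injective_algebraMap (algebraMap k (LaurentSeries k)).injective
  have hchar : ∀ n : ℕ, n ≠ 0 → ‖(n : LaurentSeries k)‖ = 1 := by
    intro n hn
    rw [← map_natCast (algebraMap (PowerSeries k) (LaurentSeries k))]
    refine hunit _ ?_
    rw [PowerSeries.isUnit_iff_constantCoeff, map_natCast]
    exact (Nat.cast_ne_zero.mpr hn).isUnit
  have hUs : PowerSeries.HasSubst U := by
    refine PowerSeries.HasSubst.of_constantCoeff_zero' ?_
    rw [← PowerSeries.coeff_zero_eq_constantCoeff_apply]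
    exact PowerSeries.coeff_of_lt_order _ (by rw [hU]; exact_mod_cast hD)
  refine natDegree_le_of_parametrization_of_complete hchar ι hB hι hf
    hirr σ (algebraMap (PowerSeries k) (LaurentSeries k)) hle
    (algebraMap (PowerSeries k) (LaurentSeries k))
    ((PowerSeries.substAlgHom hUs : PowerSeries k →ₐ[k] PowerSeries k) :
      PowerSeries k →+* PowerSeries k) ?_ (fun i : Fin D => PowerSeries.X ^ (i : ℕ)) ?_
    PowerSeries.X V W ?_
  · intro a
    rw [hσ]
    simp [PowerSeries.coe_substAlgHom]
  · intro h
    obtain ⟨c, hc⟩ := PowerSeries.exists_eq_sum_subst_mul_X_pow hD hU h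
    refine ⟨c, ?_⟩
    simpa [PowerSeries.coe_substAlgHom] using hc
  · rw [hσ, PowerSeries.subst_X hUs]
    exact hW

/-! ### Homogeneous forms and germs at infinity -/

/-- A homogeneous form of degree `d` has degree at most `d` in the second variable, and the
coefficient of degree `d` is its value at `(0 : 1 : 0)`. -/
theorem natDegree_aeval_form_le {R : Type*} [CommRing R] [Algebra ℂ R]
    {F : MvPolynomial (Fin 3) ℂ} {d : ℕ} (hF : F.IsHomogeneous d) (a b : R) :
    (MvPolynomial.aeval ![C a, X, C b] F : R[X]).natDegree ≤ d ∧
    (MvPolynomial.aeval ![C a, X, C b] F : R[X]).coeff d =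
      algebraMap ℂ R (MvPolynomial.eval ![0, 1, 0] F) := by
  have hm : ∀ m ∈ F.support, m 0 + m 1 + m 2 = d := by
    intro m hm
    have h1 := hF (MvPolynomial.mem_support_iff.mp hm)
    rw [← h1, Finsupp.weight_apply, Finsupp.sum_fintype _ _ (by simp), Fin.sum_univ_three]
    simp
  have hexp : (MvPolynomial.aeval ![C a, X, C b] F : R[X]) = ∑ m ∈ F.support,
      C (algebraMap ℂ R (F.coeff m) * a ^ m 0 * b ^ m 2) * X ^ m 1 := by
    rw [MvPolynomial.aeval_def, MvPolynomial.eval₂_eq']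
    refine Finset.sum_congr rfl fun m _ => ?_
    rw [Fin.prod_univ_three, Polynomial.algebraMap_apply]
    simp only [Matrix.cons_val_zero, Matrix.cons_val_one, Matrix.cons_val,
      C_mul, C_pow]
    ring
  constructor
  · rw [hexp]
    refine natDegree_sum_le_of_forall_le _ _ fun m hms => ?_
    exact (natDegree_C_mul_X_pow_le _ _).trans (by have := hm m hms; omega)
  · rw [hexp, finsetSum_coeff, MvPolynomial.eval_eq', map_sum]
    refine Finset.sum_congr rfl fun m hms => ?_
    have h1 := hm m hms
    rw [coeff_C_mul, coeff_X_pow, Fin.prod_univ_three]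
    simp only [Matrix.cons_val_zero, Matrix.cons_val_one, Matrix.cons_val,
      one_pow, mul_one]
    by_cases h : d = m 1
    · have h0 : m 0 = 0 := by omega
      have h2 : m 2 = 0 := by omega
      simp [h, h0, h2]
    · rw [if_neg h, mul_zero]
      rcases Nat.eq_zero_or_pos (m 0) with h0 | h0
      · have h2 : m 2 ≠ 0 := by omega
        simp [h2]
      · simp [h0.ne']

theorem aeval_form_smul {S : Type*} [CommRing S] [Algebra ℂ S] {n : ℕ}
    {F : MvPolynomial (Fin n) ℂ} {d : ℕ} (hF : F.IsHomogeneous d) (c : S) (x y : Fin n → S)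
    (hxy : ∀ i, y i = c * x i) :
    MvPolynomial.aeval y F = c ^ d * MvPolynomial.aeval x F := by
  rw [MvPolynomial.aeval_def, MvPolynomial.aeval_def, MvPolynomial.eval₂_eq',
    MvPolynomial.eval₂_eq', Finset.mul_sum]
  refine Finset.sum_congr rfl fun m hms => ?_
  have h1 := hF (MvPolynomial.mem_support_iff.mp hms)
  rw [Finsupp.weight_apply, Finsupp.sum_fintype _ _ (by simp)] at h1
  simp only [hxy, mul_pow, Finset.prod_mul_distrib, Finset.prod_pow_eq_pow_sum]
  rw [← h1]
  simp only [Pi.one_apply, smul_eq_mul, mul_one]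
  ring

theorem map_aeval_form {R S : Type*} [CommRing R] [CommRing S] [Algebra ℂ R]
    [Algebra ℂ S] (g : R →ₐ[ℂ] S) (a b : R) (F : MvPolynomial (Fin 3) ℂ) :
    (MvPolynomial.aeval ![C a, X, C b] F : R[X]).map (g : R →+* S) =
      MvPolynomial.aeval ![C (g a), X, C (g b)] F := by
  have h := MvPolynomial.comp_aeval_apply (f := ![C a, X, C b]) (Polynomial.mapAlgHom g) F
  rw [Polynomial.coe_mapAlgHom] at h
  rw [h]
  congr 2
  funext i
  fin_cases i <;> simp

theorem eval_aeval_form {R : Type*} [CommRing R] [Algebra ℂ R]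
    (a b y : R) (F : MvPolynomial (Fin 3) ℂ) :
    (MvPolynomial.aeval ![C a, X, C b] F : R[X]).eval y = MvPolynomial.aeval ![a, y, b] F := by
  have h := MvPolynomial.comp_aeval_apply (f := ![C a, X, C b])
    ((Polynomial.aeval y : R[X] →ₐ[R] R).restrictScalars ℂ) F
  simp only [AlgHom.coe_restrictScalars', Polynomial.coe_aeval_eq_eval] at h
  rw [h]
  congr 2
  funext i
  fin_cases i <;> simp

namespace PencilCone

theorem OnePlaceAtInfinity.eval_ne_zero {F : MvPolynomial (Fin 3) ℂ} {d : ℕ}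
    (hF : OnePlaceAtInfinity F d) : MvPolynomial.eval ![0, 1, 0] F ≠ 0 := by
  have h := hF.meets ![0, 1, 0] (fun h => by simpa using congrFun h 1) rfl
  rw [ne_eq, h]
  simp

theorem germAt_mul (F G : MvPolynomial (Fin 3) ℂ) : germAt (F * G) = germAt F * germAt G := by
  simp [germAt]

theorem germAt_C (c : ℂ) : germAt (MvPolynomial.C c) = MvPowerSeries.C c := by
  simp [germAt]

/-- The local equation `F(1, y, u)`, as a polynomial in `y` over the power series in `u`, is
irreducible. Indeed it reduces to `y ^ d` modulo `u`, since the curve meets the line at infinity in a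
single point; hence its monic factors reduce to powers of `y`, and they are not units as germs. -/
theorem irreducible_of_unibranch {F : MvPolynomial (Fin 3) ℂ} {d : ℕ}
    (hF : F.IsHomogeneous d) (h1 : MvPolynomial.eval ![0, 1, 0] F = 1)
    (hmeet : ∀ y, MvPolynomial.eval ![1, y, 0] F = 0 → y = 0) (hirr : Irreducible (germAt F)) :
    Irreducible (MvPolynomial.aeval ![C 1, X, C PowerSeries.X] F : (PowerSeries ℂ)[X]) := by
  set G := (MvPolynomial.aeval ![C 1, X, C PowerSeries.X] F : (PowerSeries ℂ)[X]) with hG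
  obtain ⟨hdeg, hcoeff⟩ := natDegree_aeval_form_le hF (1 : PowerSeries ℂ) PowerSeries.X
  rw [h1, (algebraMap ℂ (PowerSeries ℂ)).map_one] at hcoeff
  have hmon : G.Monic := monic_of_natDegree_le_of_coeff_eq_one d hdeg hcoeff
  have hGd : G.natDegree = d := natDegree_eq_of_le_of_coeff_ne_zero hdeg (by rw [hcoeff]; simp)
  have hXs : PowerSeries.HasSubst (MvPowerSeries.X 0 : Germ) := PowerSeries.HasSubst.X 0
  -- the polynomial ring maps to the ring of germs
  let Φ : (PowerSeries ℂ)[X] →+* Germ :=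
    eval₂RingHom ((PowerSeries.substAlgHom (R := ℂ) hXs : PowerSeries ℂ →ₐ[ℂ] Germ) :
      PowerSeries ℂ →+* Germ) (MvPowerSeries.X 1)
  have hΦG : Φ G = germAt F := by
    have e1 : (Φ.comp (MvPolynomial.aeval ![C 1, X, C PowerSeries.X] :
        MvPolynomial (Fin 3) ℂ →ₐ[ℂ] (PowerSeries ℂ)[X]) : MvPolynomial (Fin 3) ℂ →+* Germ) =
        (MvPolynomial.coeToMvPowerSeries.ringHom (R := ℂ) (σ := Fin 2)).comp
          (MvPolynomial.aeval ![1, MvPolynomial.X 1, MvPolynomial.X 0] :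
            MvPolynomial (Fin 3) ℂ →ₐ[ℂ] MvPolynomial (Fin 2) ℂ) := by
      refine MvPolynomial.ringHom_ext (fun c => ?_) fun i => ?_
      · have : algebraMap ℂ (PowerSeries ℂ)[X] c = C (algebraMap ℂ (PowerSeries ℂ) c) := rfl
        simp only [RingHom.comp_apply, RingHom.coe_coe, MvPolynomial.aeval_C, this, Φ,
          coe_eval₂RingHom, eval₂_C, AlgHom.commutes]
        simp [MvPowerSeries.algebraMap_apply, MvPolynomial.algebraMap_eq]
      · fin_cases i <;>
          simp [Φ, PowerSeries.substAlgHom_X]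
    exact RingHom.congr_fun e1 F
  have hΦc : ∀ P, MvPowerSeries.constantCoeff (Φ P) =
      (P.map (PowerSeries.constantCoeff (R := ℂ))).eval 0 := by
    intro P
    have e1 : (MvPowerSeries.constantCoeff (σ := Fin 2) (R := ℂ)).comp Φ =
        (evalRingHom (0 : ℂ)).comp (mapRingHom (PowerSeries.constantCoeff (R := ℂ))) := by
      refine Polynomial.ringHom_ext (fun a => ?_) ?_
      · obtain ⟨b, hb⟩ : PowerSeries.X ∣ a - PowerSeries.C (PowerSeries.constantCoeff a) := by
          rw [PowerSeries.X_dvd_iff]; simp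
        rw [sub_eq_iff_eq_add] at hb
        rw [hb]
        have : (PowerSeries.substAlgHom (R := ℂ) hXs) (PowerSeries.C (PowerSeries.constantCoeff a))
            = MvPowerSeries.C (PowerSeries.constantCoeff a) := by
          rw [PowerSeries.coe_substAlgHom, PowerSeries.subst_C]
        simp [Φ, PowerSeries.substAlgHom_X, this]
      · simp [Φ]
    exact RingHom.congr_fun e1 P
  -- reduction along the line at infinity
  have hbar : G.map (PowerSeries.constantCoeff (R := ℂ)) = X ^ d := by
    have e0 : G.map (PowerSeries.constantCoeff (R := ℂ)) =
        (MvPolynomial.aeval ![C 1, X, C 0] F : ℂ[X]) := by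
      let g : PowerSeries ℂ →ₐ[ℂ] ℂ :=
        { PowerSeries.constantCoeff (R := ℂ) with commutes' := fun r => by simp }
      have hg : ∀ x, g x = PowerSeries.constantCoeff x := fun _ => rfl
      refine (map_aeval_form g 1 PowerSeries.X F).trans ?_
      rw [hg, hg, map_one, PowerSeries.constantCoeff_X]
    obtain ⟨hd0, hc0⟩ := natDegree_aeval_form_le hF (1 : ℂ) 0
    rw [h1, (algebraMap ℂ ℂ).map_one] at hc0
    have hm0 := monic_of_natDegree_le_of_coeff_eq_one d hd0 hc0
    rw [e0]
    have hd1 := natDegree_eq_of_le_of_coeff_ne_zero hd0 (by rw [hc0]; simp)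
    rw [(IsAlgClosed.splits _).eq_prod_roots_of_monic hm0]
    have hroots : (MvPolynomial.aeval ![C 1, X, C 0] F : ℂ[X]).roots = Multiset.replicate d 0 := by
      rw [Multiset.eq_replicate]
      constructor
      · rw [← (IsAlgClosed.splits _).natDegree_eq_card_roots, hd1]
      · intro y hy
        have := (mem_roots'.mp hy).2
        rw [IsRoot, eval_aeval_form] at this
        exact hmeet y (by simpa [MvPolynomial.aeval_eq_eval] using this)
    rw [hroots]
    simp
  rw [hmon.irreducible_iff_natDegree]
  constructor
  · rintro h
    rw [← hΦG, h, map_one] at hirr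
    exact not_irreducible_one hirr
  · intro P Q hP hQ hPQ
    by_contra! hne
    have key : ∀ P : (PowerSeries ℂ)[X], P.Monic → P ∣ G → P.natDegree ≠ 0 → ¬ IsUnit (Φ P) := by
      intro P hP hPG hP0 hu
      have h2 : MvPowerSeries.constantCoeff (Φ P) ≠ 0 := (hu.map MvPowerSeries.constantCoeff).ne_zero
      rw [hΦc] at h2
      have h3 := Polynomial.map_dvd (PowerSeries.constantCoeff (R := ℂ)) hPG
      rw [hbar] at h3
      obtain ⟨i, hi, hass⟩ := (dvd_prime_pow prime_X _).mp h3
      have h4 := eq_of_monic_of_associated (hP.map _) (monic_X_pow i) hass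
      have h5 : i ≠ 0 := by
        have := congrArg natDegree h4
        rw [hP.natDegree_map, natDegree_X_pow] at this
        omega
      rw [h4] at h2
      simp [h5] at h2
    rw [← hΦG, ← hPQ, map_mul] at hirr
    rcases hirr.isUnit_or_isUnit rfl with h | h
    · exact key P hP ⟨Q, hPQ.symm⟩ hne.1 h
    · exact key Q hQ ⟨P, by rw [mul_comm]; exact hPQ.symm⟩ hne.2 h

end PencilCone

/-! ### Moh's inequality for curves with one place at infinity -/

namespace PencilCone

theorem aeval_form_comp {R : Type*} [CommRing R] [Algebra ℂ R] (u : R)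
    (F : MvPolynomial (Fin 3) ℂ) :
    (MvPolynomial.aeval ![C 1, X, C u] F : R[X]).comp (C u * X + C 0) =
      MvPolynomial.aeval ![1, C u * X, C u] F := by
  have h := MvPolynomial.comp_aeval_apply (f := ![C 1, X, C u])
    ((Polynomial.aeval (C u * X + C 0) : R[X] →ₐ[R] R[X]).restrictScalars ℂ) F
  simp only [AlgHom.coe_restrictScalars', ← comp_eq_aeval] at h
  rw [h]
  congr 2
  funext i
  fin_cases i <;> simp

/-- Moh's inequality when the equation of the curve is monic in the second variable. The affine
equation is `F(x, y, 1)`, and `x = 1 / u` on the power series in `u`. -/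
theorem degree_le_order_of_normalized {F : MvPolynomial (Fin 3) ℂ} {d : ℕ}
    (hF : F.IsHomogeneous d) (h1 : MvPolynomial.eval ![0, 1, 0] F = 1)
    (hmeet : ∀ y, MvPolynomial.eval ![1, y, 0] F = 0 → y = 0) (hirr : Irreducible (germAt F))
    {U V W : PowerSeries ℂ} {D : ℕ} (hD : 1 ≤ D) (hU : U.order = D)
    (hW : MvPolynomial.aeval ![1, V, U] F = U ^ d * W) : d ≤ D := by
  set K := LaurentSeries ℂ with hK
  have hC : ∀ r : ℂ, algebraMap (PowerSeries ℂ) K (algebraMap ℂ (PowerSeries ℂ) r) =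
      algebraMap ℂ K r := by
    intro r
    rw [LaurentSeries.algebraMap_apply]
    exact PowerSeries.coe_C r
  let j : PowerSeries ℂ →ₐ[ℂ] K := { algebraMap (PowerSeries ℂ) K with commutes' := hC }
  have hj : ∀ a, j a = algebraMap (PowerSeries ℂ) K a := fun _ => rfl
  have hjinj : Function.Injective j := FaithfulSMul.algebraMap_injective (PowerSeries ℂ) K
  set u : K := j PowerSeries.X with hu
  have hu0 : u ≠ 0 := by
    rw [hu, ne_eq, map_eq_zero_iff _ hjinj]
    exact PowerSeries.X_ne_zero
  let ι : ℂ[X] →ₐ[ℂ] K := Polynomial.aeval u⁻¹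
  set f : ℂ[X][X] := MvPolynomial.aeval ![C X, X, C 1] F with hf
  obtain ⟨hdeg, hcoeff⟩ := natDegree_aeval_form_le hF (X : ℂ[X]) 1
  rw [h1, (algebraMap ℂ ℂ[X]).map_one] at hcoeff
  have hmon : f.Monic := monic_of_natDegree_le_of_coeff_eq_one d hdeg hcoeff
  have hfd : f.natDegree = d := natDegree_eq_of_le_of_coeff_ne_zero hdeg (by rw [hcoeff]; simp)
  have hfι : f.map (ι : ℂ[X] →+* K) = MvPolynomial.aeval ![C u⁻¹, X, C 1] F := by
    rw [hf, map_aeval_form, map_one]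
    simp [ι]
  -- irreducibility at infinity
  have hG := irreducible_of_unibranch hF h1 hmeet hirr
  obtain ⟨hGdeg, hGcoeff⟩ := natDegree_aeval_form_le hF (1 : PowerSeries ℂ) PowerSeries.X
  rw [h1, (algebraMap ℂ (PowerSeries ℂ)).map_one] at hGcoeff
  have hGmon := monic_of_natDegree_le_of_coeff_eq_one d hGdeg hGcoeff
  rw [hGmon.irreducible_iff_irreducible_map_fraction_map (K := K)] at hG
  have hGj := map_aeval_form j 1 PowerSeries.X F
  rw [show j 1 = 1 from map_one j] at hGj
  have hGj' : Irreducible (MvPolynomial.aeval ![C 1, X, C u] F : K[X]) := by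
    rw [← hGj]
    exact hG
  have hcomp : C (u ^ d) * f.map (ι : ℂ[X] →+* K) =
      (MvPolynomial.aeval ![C 1, X, C u] F : K[X]).comp (C u * X + C 0) := by
    rw [aeval_form_comp, hfι, C_pow, ← aeval_form_smul hF (C u)]
    intro i
    fin_cases i
    · simp [← C_mul, hu0]
    · simp
    · simp
  have hirrf : Irreducible (f.map (ι : ℂ[X] →+* K)) := by
    let := invertibleOfNonzero hu0
    have h2 : Irreducible ((MvPolynomial.aeval ![C 1, X, C u] F : K[X]).comp (C u * X + C 0)) := by
      have h3 := (MulEquiv.irreducible_iff (algEquivCMulXAddC u 0)).mpr hGj'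
      simpa [algEquivCMulXAddC_apply, comp_eq_aeval] using h3
    rw [← hcomp] at h2
    exact (irreducible_isUnit_mul (isUnit_C.mpr (pow_ne_zero d hu0).isUnit)).mp h2
  -- the parametrization
  have hUs : PowerSeries.HasSubst U := by
    refine PowerSeries.HasSubst.of_constantCoeff_zero' ?_
    rw [← PowerSeries.coeff_zero_eq_constantCoeff_apply]
    exact PowerSeries.coeff_of_lt_order _ (by rw [hU]; exact_mod_cast hD)
  have hU0 : U ≠ 0 := by
    rintro rfl
    simp at hU
  have hsinj : Function.Injective (PowerSeries.substAlgHom (R := ℂ) hUs :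
      PowerSeries ℂ →ₐ[ℂ] PowerSeries ℂ) := by
    rw [injective_iff_map_eq_zero]
    intro a ha
    by_contra hne
    obtain ⟨n, w, hw⟩ : ∃ n : ℕ, ∃ w : PowerSeries ℂ, IsUnit w ∧ a = PowerSeries.X ^ n * w := by
      obtain ⟨n, w, hw⟩ := IsDiscreteValuationRing.eq_unit_mul_pow_irreducible hne
        PowerSeries.X_irreducible
      exact ⟨n, w, w.isUnit, by rw [hw, mul_comm]⟩
    rw [hw.2, map_mul, map_pow, PowerSeries.substAlgHom_X] at ha
    rcases mul_eq_zero.mp ha with h | h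
    · exact hU0 (eq_zero_of_pow_eq_zero h)
    · exact (hw.1.map (PowerSeries.substAlgHom (R := ℂ) hUs)).ne_zero h
  have hinj : Function.Injective ((j.comp (PowerSeries.substAlgHom (R := ℂ) hUs) :
      PowerSeries ℂ →ₐ[ℂ] K) : PowerSeries ℂ →+* K) := hjinj.comp hsinj
  have hσ₀ : ∀ a : PowerSeries ℂ, IsFractionRing.lift (K := K) hinj (algebraMap _ _ a) =
      algebraMap (PowerSeries ℂ) K (a.subst U : PowerSeries ℂ) := by
    intro a
    rw [IsFractionRing.lift_algebraMap]
    simp [hj, PowerSeries.coe_substAlgHom]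
  let σ : K →ₐ[ℂ] K :=
    { IsFractionRing.lift (K := K) hinj with
      commutes' := fun r => by
        have h2 := hσ₀ (algebraMap ℂ (PowerSeries ℂ) r)
        rw [hC] at h2
        refine h2.trans ?_
        rw [← hC, ← PowerSeries.coe_substAlgHom hUs, AlgHom.commutes] }
  have hσ : ∀ a : PowerSeries ℂ, σ (algebraMap _ _ a) =
      algebraMap (PowerSeries ℂ) K (a.subst U : PowerSeries ℂ) := hσ₀
  have hjU : j U ≠ 0 := by rwa [ne_eq, map_eq_zero_iff _ hjinj]
  rw [← hfd]
  refine LaurentSeries.natDegree_le_order hmon (ι : ℂ[X] →+* K) ?_ ?_ hirrf hD hU (V := V) (W := W)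
    (σ : K →+* K) hσ ?_
  · intro c
    have : ι (C c) = algebraMap ℂ K c := aeval_C _ _
    exact this
  · exact aeval_X _
  · rw [eval₂_eq_eval_map, hfι, map_aeval_form, map_one, map_inv₀, eval_aeval_form]
    have h4 : σ u = j U := by
      rw [hu, hj, hσ, PowerSeries.subst_X hUs]
      rfl
    rw [h4]
    have h5 := aeval_form_smul hF (j U) ![(j U)⁻¹, j V / j U, 1] ![1, j V, j U] (by
      intro i
      fin_cases i
      · exact (mul_inv_cancel₀ hjU).symm
      · simp [mul_div_cancel₀, hjU]
      · simp)
    have h6 := MvPolynomial.comp_aeval_apply (f := ![1, V, U]) j F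
    rw [hW, map_mul, map_pow] at h6
    have h7 : (fun i => j (![1, V, U] i)) = ![1, j V, j U] := by
      funext i
      fin_cases i <;> simp
    rw [h7, h5] at h6
    exact (mul_left_cancel₀ (pow_ne_zero d hjU) h6).symm

/-- **Moh's inequality**: if the function `F / Z ^ d`, where `F` is the equation of a curve of degree
`d` with one place at infinity, has no pole along an arc `(1 : V : U)` centred on the line at
infinity, then the arc meets that line with multiplicity at least `d`. -/
theorem OnePlaceAtInfinity.degree_le_order {F : MvPolynomial (Fin 3) ℂ} {d : ℕ}
    (hF : OnePlaceAtInfinity F d)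
    {U V W : PowerSeries ℂ} {D : ℕ} (hD : 1 ≤ D) (hU : U.order = D)
    (hW : MvPolynomial.aeval ![1, V, U] F = U ^ d * W) : d ≤ D := by
  set c := MvPolynomial.eval ![0, 1, 0] F with hc
  have hc0 : c ≠ 0 := hF.eval_ne_zero
  refine degree_le_order_of_normalized (F := MvPolynomial.C c⁻¹ * F)
    (W := PowerSeries.C c⁻¹ * W) ?_ ?_ ?_ ?_ hD hU ?_ (V := V)
  · simpa using (MvPolynomial.isHomogeneous_C _ c⁻¹).mul hF.homogeneous
  · rw [map_mul, MvPolynomial.eval_C, ← hc, inv_mul_cancel₀ hc0]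
  · intro y hy
    rw [map_mul, MvPolynomial.eval_C, mul_eq_zero, or_iff_right (inv_ne_zero hc0)] at hy
    exact (hF.meets ![1, y, 0] (fun h => by simpa using congrFun h 0) rfl).mp hy
  · rw [germAt_mul, germAt_C]
    refine (irreducible_isUnit_mul ?_).mpr hF.unibranch
    exact (inv_ne_zero hc0).isUnit.map _
  · rw [map_mul, hW, MvPolynomial.aeval_C]
    have : algebraMap ℂ (PowerSeries ℂ) c⁻¹ = PowerSeries.C c⁻¹ := rfl
    rw [this]
    ring

end PencilCone

end

namespace PencilCone

noncomputable section

open MvPowerSeries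

/-! ### Coefficients of germs -/

/-- The exponent of `u ^ i * v ^ j`. -/
def ex (i j : ℕ) : Fin 2 →₀ ℕ := Finsupp.single 0 i + Finsupp.single 1 j

@[simp] theorem ex_zero (i j : ℕ) : ex i j 0 = i := by simp [ex]

@[simp] theorem ex_one (i j : ℕ) : ex i j 1 = j := by simp [ex]

theorem ex_eta (e : Fin 2 →₀ ℕ) : ex (e 0) (e 1) = e := by
  ext i
  fin_cases i <;> simp

theorem ex_inj {i j i' j' : ℕ} : ex i j = ex i' j' ↔ i = i' ∧ j = j' := by
  constructor
  · intro h
    exact ⟨by simpa using DFunLike.congr_fun h 0, by simpa using DFunLike.congr_fun h 1⟩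
  · rintro ⟨rfl, rfl⟩; rfl

theorem ex_add (i j i' j' : ℕ) : ex i j + ex i' j' = ex (i + i') (j + j') := by
  ext k
  fin_cases k <;> simp

theorem ex_le {i j i' j' : ℕ} : ex i j ≤ ex i' j' ↔ i ≤ i' ∧ j ≤ j' := by
  rw [Finsupp.le_def]
  constructor
  · intro h
    exact ⟨by simpa using h 0, by simpa using h 1⟩
  · rintro ⟨h0, h1⟩ k
    fin_cases k <;> simpa

theorem single_zero_eq_ex (n : ℕ) : (Finsupp.single 0 n : Fin 2 →₀ ℕ) = ex n 0 := by
  simp [ex]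

theorem single_one_eq_ex (n : ℕ) : (Finsupp.single 1 n : Fin 2 →₀ ℕ) = ex 0 n := by
  simp [ex]

theorem degree_ex (i j : ℕ) : Finsupp.degree (ex i j) = i + j := by
  simp [ex]

/-- The coefficient of `u ^ i * v ^ j`. -/
def cf (g : Germ) (i j : ℕ) : ℂ := coeff (ex i j) g

theorem ext_cf {g h : Germ} (H : ∀ i j, cf g i j = cf h i j) : g = h := by
  ext e
  rw [← ex_eta e]
  exact H _ _

theorem cf_X_zero_pow_mul (k : ℕ) (g : Germ) (i j : ℕ) :
    cf (X 0 ^ k * g) i j = if k ≤ i then cf g (i - k) j else 0 := by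
  rw [cf, X_pow_eq, coeff_monomial_mul, single_zero_eq_ex]
  simp only [ex_le, zero_le, and_true, one_mul]
  congr 1
  rw [cf]
  congr 2
  ext t
  fin_cases t <;> simp

theorem cf_X_one_pow_mul (k : ℕ) (g : Germ) (i j : ℕ) :
    cf (X 1 ^ k * g) i j = if k ≤ j then cf g i (j - k) else 0 := by
  rw [cf, X_pow_eq, coeff_monomial_mul, single_one_eq_ex]
  simp only [ex_le, zero_le, true_and, one_mul]
  congr 1
  rw [cf]
  congr 2
  ext t
  fin_cases t <;> simp

/-! ### Multiplicity -/

theorem order_eq_mult {g : Germ} (hg : g ≠ 0) : g.order = mult g :=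
  (ne_zero_iff_order_finite.mp hg).symm

theorem cf_eq_zero_of_lt_mult {g : Germ} {i j : ℕ} (h : i + j < mult g) : cf g i j = 0 := by
  by_cases hg : g = 0
  · simp [hg, cf]
  · refine coeff_of_lt_order ?_
    rw [order_eq_mult hg, degree_ex]
    exact_mod_cast h

theorem exists_cf_ne_zero {g : Germ} (hg : g ≠ 0) : ∃ i j, i + j = mult g ∧ cf g i j ≠ 0 := by
  obtain ⟨e, he, hd⟩ := exists_coeff_ne_zero_and_order (ne_zero_iff_order_finite.mp hg)
  refine ⟨e 0, e 1, ?_, ?_⟩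
  · have h1 : ((Finsupp.degree e : ℕ) : ℕ∞) = mult g := by rw [← order_eq_mult hg, ← hd]
    rw [← degree_ex, ex_eta]
    exact_mod_cast h1
  · rwa [cf, ex_eta]

theorem mult_mul {g h : Germ} (hg : g ≠ 0) (hh : h ≠ 0) : mult (g * h) = mult g + mult h := by
  have := MvPowerSeries.order_mul g h
  rw [order_eq_mult hg, order_eq_mult hh, order_eq_mult (mul_ne_zero hg hh)] at this
  exact_mod_cast this

theorem mult_eq_zero_iff {g : Germ} (hg : g ≠ 0) : mult g = 0 ↔ constantCoeff g ≠ 0 := by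
  have := order_ne_zero_iff_constCoeff_eq_zero (f := g)
  rw [order_eq_mult hg] at this
  rw [← not_iff_not, not_not, ← this]
  simp

theorem isUnit_iff {g : Germ} : IsUnit g ↔ constantCoeff g ≠ 0 := by
  rw [isUnit_iff_constantCoeff, isUnit_iff_ne_zero]

theorem mult_eq_zero_of_isUnit {g : Germ} (hg : IsUnit g) : mult g = 0 :=
  (mult_eq_zero_iff hg.ne_zero).mpr (isUnit_iff.mp hg)

theorem mult_X (i : Fin 2) : mult (X i : Germ) = 1 := by
  have h : (X i : Germ).order = 1 := by
    rw [X, order_monomial_of_ne_zero one_ne_zero]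
    simp
  simp [mult, h]

/-! ### Blow-up in coordinates -/

theorem hasSubst_chart (t : Dir) : HasSubst (chart t) := by
  refine hasSubst_of_constantCoeff_zero fun i => ?_
  cases t <;> fin_cases i <;> simp [chart]

/-- The pull-back of germs by the blow-up map. -/
def pull (t : Dir) : Germ →ₐ[ℂ] Germ := substAlgHom (hasSubst_chart t)

theorem totalTransform_eq (t : Dir) (g : Germ) : totalTransform t g = pull t g := by
  rw [totalTransform, pull, coe_substAlgHom]

theorem pull_X (t : Dir) (i : Fin 2) : pull t (X i) = chart t i := substAlgHom_X _ _

theorem cf_subst {a : Fin 2 → Germ} (ha : HasSubst a) (g : Germ) (i j : ℕ) (s : Finset (ℕ × ℕ))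
    (hs : ∀ p q, cf (a 0 ^ p * a 1 ^ q) i j ≠ 0 → (p, q) ∈ s) :
    cf (substAlgHom (R := ℂ) ha g) i j = ∑ p ∈ s, cf g p.1 p.2 * cf (a 0 ^ p.1 * a 1 ^ p.2) i j := by
  classical
  have hprod : ∀ d : Fin 2 →₀ ℕ, (d.prod fun s e => (a s) ^ e) = a 0 ^ d 0 * a 1 ^ d 1 := by
    intro d
    rw [Finsupp.prod_fintype _ _ (by simp), Fin.prod_univ_two]
  rw [cf, coe_substAlgHom, coeff_subst ha]
  simp only [hprod]
  rw [finsum_eq_sum_of_support_subset (s := s.image fun p => ex p.1 p.2)]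
  · rw [Finset.sum_image]
    · simp [cf]
    · intro p _ q _ h
      rw [ex_inj] at h
      exact Prod.ext h.1 h.2
  · intro d hd
    rw [Function.mem_support] at hd
    have h1 : cf (a 0 ^ d 0 * a 1 ^ d 1) i j ≠ 0 := fun h0 => hd (by
      rw [cf] at h0; rw [h0, smul_zero])
    simp only [Finset.coe_image, Set.mem_image]
    exact ⟨_, hs _ _ h1, ex_eta d⟩

theorem cf_one (i j : ℕ) : cf 1 i j = if i = 0 ∧ j = 0 then 1 else 0 := by
  classical
  rw [cf, coeff_one]
  congr 1
  rw [show (0 : Fin 2 →₀ ℕ) = ex 0 0 by simp [ex], ex_inj]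

theorem cf_pull_inf (g : Germ) (i j : ℕ) :
    cf (pull .inf g) i j = if i ≤ j then cf g i (j - i) else 0 := by
  have hmon : ∀ p q, cf ((chart .inf) 0 ^ p * (chart .inf) 1 ^ q) i j =
      if p = i ∧ p + q = j then 1 else 0 := by
    intro p q
    have : (chart .inf) 0 ^ p * (chart .inf) 1 ^ q = (X 0 ^ p * (X 1 ^ (p + q) * 1) : Germ) := by
      simp only [chart, Matrix.cons_val_zero, Matrix.cons_val_one]
      ring
    rw [this, cf_X_zero_pow_mul, cf_X_one_pow_mul, cf_one]
    split_ifs <;> first | rfl | omega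
  rw [pull, cf_subst _ g i j {(i, j - i)}]
  · rw [Finset.sum_singleton, hmon]
    dsimp only
    split_ifs <;> first | (exfalso; omega) | simp
  · intro p q h
    rw [hmon] at h
    have : p = i ∧ p + q = j := by
      by_contra hne
      exact h (if_neg hne)
    simp only [Finset.mem_singleton, Prod.mk.injEq]
    omega

/-- The homogeneous part of degree `k`, dehomogenized by `u = 1`. -/
def form (k : ℕ) (g : Germ) : Polynomial ℂ :=
  ∑ j ∈ Finset.range (k + 1), Polynomial.C (cf g (k - j) j) * Polynomial.X ^ j

theorem coeff_form (k : ℕ) (g : Germ) (j : ℕ) :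
    (form k g).coeff j = if j ≤ k then cf g (k - j) j else 0 := by
  simp only [form, Polynomial.finsetSum_coeff, Polynomial.coeff_C_mul, Polynomial.coeff_X_pow]
  split_ifs with h
  · rw [Finset.sum_eq_single j]
    · simp
    · intro b _ hb
      rw [if_neg (Ne.symm hb), mul_zero]
    · intro hj
      exact absurd (Finset.mem_range.mpr (by omega)) hj
  · refine Finset.sum_eq_zero fun b hb => ?_
    rw [Finset.mem_range] at hb
    rw [if_neg (by omega), mul_zero]

theorem cf_aeval_X_one (p : Polynomial ℂ) (i j : ℕ) :
    cf (Polynomial.aeval (X 1 : Germ) p) i j = if i = 0 then p.coeff j else 0 := by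
  induction p using Polynomial.induction_on' with
  | add p q hp hq =>
    have : ∀ g h : Germ, cf (g + h) i j = cf g i j + cf h i j := fun g h => by simp [cf]
    rw [map_add, this, hp, hq, Polynomial.coeff_add]
    split_ifs <;> simp
  | monomial n a =>
    have h1 : cf (a • (X 1 ^ n * 1 : Germ)) i j = a * cf (X 1 ^ n * 1 : Germ) i j := by simp [cf]
    rw [Polynomial.aeval_monomial, ← Algebra.smul_def, ← mul_one (X 1 ^ n : Germ), h1,
      cf_X_one_pow_mul, cf_one, Polynomial.coeff_monomial]
    split_ifs <;> first | (exfalso; omega) | simp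

theorem cf_pull_fin (c : ℂ) (g : Germ) (i j : ℕ) :
    cf (pull (.fin c) g) i j = (Polynomial.taylor c (form i g)).coeff j := by
  have hmon : ∀ p q, cf ((chart (.fin c)) 0 ^ p * (chart (.fin c)) 1 ^ q) i j =
      if p + q = i then ((Polynomial.X + Polynomial.C c) ^ q : Polynomial ℂ).coeff j else 0 := by
    intro p q
    have : (chart (.fin c)) 0 ^ p * (chart (.fin c)) 1 ^ q =
        (X 0 ^ (p + q) * Polynomial.aeval (X 1 : Germ)
          ((Polynomial.X + Polynomial.C c) ^ q : Polynomial ℂ) : Germ) := by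
      simp only [chart, Matrix.cons_val_zero, Matrix.cons_val_one, map_pow, map_add,
        Polynomial.aeval_X, Polynomial.aeval_C]
      have : algebraMap ℂ Germ c = C c := rfl
      rw [this, mul_pow, pow_add]
      ring
    rw [this, cf_X_zero_pow_mul, cf_aeval_X_one]
    split_ifs <;> first | rfl | omega
  rw [pull, cf_subst _ g i j ((Finset.range (i + 1)).image fun q => (i - q, q))]
  · rw [Finset.sum_image (fun p _ q _ h => (Prod.ext_iff.mp h).2)]
    simp only [form, map_sum, Polynomial.finsetSum_coeff]
    refine Finset.sum_congr rfl fun q hq => ?_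
    rw [Finset.mem_range] at hq
    rw [hmon, if_pos (by omega)]
    simp [Polynomial.taylor_apply]
  · intro p q h
    rw [hmon] at h
    have : p + q = i := by
      by_contra hne
      exact h (if_neg hne)
    simp only [Finset.mem_image, Finset.mem_range, Prod.mk.injEq]
    exact ⟨q, by omega, by omega, rfl⟩

theorem cf_strictStep_inf (g : Germ) (i j : ℕ) :
    cf (strictStep g .inf) i j = cf (pull .inf g) i (j + mult g) := by
  rw [strictStep, totalTransform_eq, cf]
  change coeff (ex i j + Finsupp.single 1 (mult g)) _ = _
  rw [single_one_eq_ex, ex_add, add_zero]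
  rfl

theorem cf_strictStep_fin (c : ℂ) (g : Germ) (i j : ℕ) :
    cf (strictStep g (.fin c)) i j = cf (pull (.fin c) g) (i + mult g) j := by
  rw [strictStep, totalTransform_eq, cf]
  change coeff (ex i j + Finsupp.single 0 (mult g)) _ = _
  rw [single_zero_eq_ex, ex_add, add_zero]
  rfl

theorem form_eq_zero_of_lt {k : ℕ} {g : Germ} (h : k < mult g) : form k g = 0 := by
  ext j
  rw [coeff_form]
  split_ifs with hj
  · rw [cf_eq_zero_of_lt_mult (by omega), Polynomial.coeff_zero]
  · simp

theorem pull_eq (t : Dir) (g : Germ) : pull t g = excEq t ^ mult g * strictStep g t := by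
  cases t with
  | fin c =>
    refine ext_cf fun i j => ?_
    change _ = cf (X 0 ^ mult g * strictStep g (.fin c)) i j
    rw [cf_X_zero_pow_mul]
    split_ifs with h
    · rw [cf_strictStep_fin, Nat.sub_add_cancel h]
    · rw [cf_pull_fin, form_eq_zero_of_lt (not_le.mp h)]
      simp
  | inf =>
    refine ext_cf fun i j => ?_
    change _ = cf (X 1 ^ mult g * strictStep g .inf) i j
    rw [cf_X_one_pow_mul]
    split_ifs with h
    · rw [cf_strictStep_inf, Nat.sub_add_cancel h]
    · rw [cf_pull_inf]
      split_ifs with hij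
      · exact cf_eq_zero_of_lt_mult (by omega)
      · rfl

/-! ### Restriction to the coordinate axes -/

/-- The other variable. -/
def oth (i : Fin 2) : Fin 2 := 1 - i

theorem hasSubst_axis (i : Fin 2) :
    HasSubst (fun j : Fin 2 => if j = i then (0 : MvPowerSeries Unit ℂ) else MvPowerSeries.X ()) := by
  refine hasSubst_of_constantCoeff_zero fun j => ?_
  split_ifs <;> simp

/-- Restriction of germs to the axis `X i = 0`. -/
def axis (i : Fin 2) : Germ →ₐ[ℂ] PowerSeries ℂ := substAlgHom (hasSubst_axis i)

theorem axis_X_self (i : Fin 2) : axis i (X i) = 0 := by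
  rw [axis, substAlgHom_X, if_pos rfl]

theorem axis_X_of_ne {i j : Fin 2} (h : j ≠ i) : axis i (X j) = PowerSeries.X := by
  rw [axis, substAlgHom_X, if_neg h]
  rfl

theorem coeff_axis (i : Fin 2) (g : Germ) (n : ℕ) :
    PowerSeries.coeff n (axis i g) = coeff (Finsupp.single (oth i) n) g := by
  classical
  have hprod : ∀ d : Fin 2 →₀ ℕ, (d.prod fun s e =>
      (if s = i then (0 : MvPowerSeries Unit ℂ) else MvPowerSeries.X ()) ^ e) =
      if d i = 0 then (MvPowerSeries.X () : MvPowerSeries Unit ℂ) ^ d (oth i) else 0 := by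
    intro d
    rw [Finsupp.prod_fintype _ _ (by simp), Fin.prod_univ_two]
    fin_cases i
    · by_cases h : d 0 = 0 <;> simp [oth, h]
    · by_cases h : d 1 = 0 <;> simp [oth, h]
  have hoi : oth i ≠ i := by fin_cases i <;> simp [oth]
  rw [axis, PowerSeries.coeff, coe_substAlgHom, coeff_subst (hasSubst_axis i),
    finsum_eq_single _ (Finsupp.single (oth i) n)]
  · rw [hprod]
    simp [hoi.symm, coeff_X_pow]
  · intro d hd
    rw [hprod]
    split_ifs with h0
    · rw [coeff_X_pow, if_neg, smul_zero]
      intro h1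
      refine hd ?_
      have h2 : n = d (oth i) := by simpa using DFunLike.congr_fun h1 ()
      ext k
      have : k = i ∨ k = oth i := by fin_cases i <;> fin_cases k <;> simp [oth]
      rcases this with rfl | rfl
      · rw [h0, Finsupp.single_eq_of_ne hoi.symm]
      · simp [h2]
    · simp

theorem coeff_axis_zero (g : Germ) (n : ℕ) : PowerSeries.coeff n (axis 0 g) = cf g 0 n := by
  rw [coeff_axis, cf, ← single_one_eq_ex]
  rfl

theorem coeff_axis_one (g : Germ) (n : ℕ) : PowerSeries.coeff n (axis 1 g) = cf g n 0 := by
  rw [coeff_axis, cf, ← single_zero_eq_ex]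
  rfl

theorem constantCoeff_axis (i : Fin 2) (g : Germ) :
    PowerSeries.constantCoeff (axis i g) = constantCoeff g := by
  rw [← PowerSeries.coeff_zero_eq_constantCoeff_apply, coeff_axis, Finsupp.single_zero,
    coeff_zero_eq_constantCoeff_apply]

theorem axis_eq_zero_iff (i : Fin 2) (g : Germ) : axis i g = 0 ↔ X i ∣ g := by
  constructor
  · intro h
    rw [X_dvd_iff]
    intro e he
    have h1 : e = Finsupp.single (oth i) (e (oth i)) := by
      have hoi : oth i ≠ i := by fin_cases i <;> simp [oth]
      ext k
      have : k = i ∨ k = oth i := by fin_cases i <;> fin_cases k <;> simp [oth]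
      rcases this with rfl | rfl
      · rw [he, Finsupp.single_eq_of_ne hoi.symm]
      · simp
    rw [h1, ← coeff_axis, h, map_zero]
  · rintro ⟨b, rfl⟩
    rw [map_mul, axis_X_self, zero_mul]

theorem axis_strictStep_inf_coeff (g : Germ) (n : ℕ) :
    PowerSeries.coeff n (axis 1 (strictStep g .inf)) =
      if n ≤ mult g then cf g n (mult g - n) else 0 := by
  rw [coeff_axis_one, cf_strictStep_inf, zero_add, cf_pull_inf]

theorem axis_strictStep_fin_coeff (c : ℂ) (g : Germ) (n : ℕ) :
    PowerSeries.coeff n (axis 0 (strictStep g (.fin c))) =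
      (Polynomial.taylor c (form (mult g) g)).coeff n := by
  rw [coeff_axis_zero, cf_strictStep_fin, zero_add, cf_pull_fin]

theorem form_mult_ne_zero {g : Germ} (hg : g ≠ 0) : form (mult g) g ≠ 0 := by
  obtain ⟨i, j, hij, hne⟩ := exists_cf_ne_zero hg
  intro h
  have := coeff_form (mult g) g j
  rw [h, if_pos (by omega), show mult g - j = i by omega, Polynomial.coeff_zero] at this
  exact hne this.symm

theorem axis_strictStep_ne_zero {g : Germ} (hg : g ≠ 0) (t : Dir) :
    axis (excIdx t) (strictStep g t) ≠ 0 := by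
  cases t with
  | fin c =>
    intro h
    refine form_mult_ne_zero hg (Polynomial.taylor_injective c ?_)
    ext n
    rw [← axis_strictStep_fin_coeff]
    change PowerSeries.coeff n (axis (excIdx (.fin c)) _) = _
    rw [h]
    simp
  | inf =>
    intro h
    obtain ⟨i, j, hij, hne⟩ := exists_cf_ne_zero hg
    have := axis_strictStep_inf_coeff g i
    change PowerSeries.coeff i (axis (excIdx .inf) _) = _ at this
    rw [h, if_pos (by omega), show mult g - i = j by omega] at this
    exact hne (by simpa using this.symm)

theorem strictStep_ne_zero {g : Germ} (hg : g ≠ 0) (t : Dir) : strictStep g t ≠ 0 := by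
  intro h
  apply axis_strictStep_ne_zero hg t
  rw [h, map_zero]

theorem X_ne_zero (i : Fin 2) : (X i : Germ) ≠ 0 := by
  intro h
  have := coeff_index_single_self_X (R := ℂ) i
  rw [h] at this
  simp at this

theorem excEq_ne_zero (t : Dir) : excEq t ≠ 0 := X_ne_zero _

/-- The strict transform is characterized by not containing the exceptional curve. -/
theorem mult_and_strictStep_of_pull_eq {g b : Germ} {t : Dir} {k : ℕ}
    (h : pull t g = excEq t ^ k * b) (hb : axis (excIdx t) b ≠ 0) :
    mult g = k ∧ strictStep g t = b := by
  have hg : g ≠ 0 := by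
    rintro rfl
    rw [map_zero] at h
    rcases mul_eq_zero.mp h.symm with h1 | h1
    · exact pow_ne_zero _ (excEq_ne_zero t) h1
    · rw [h1, map_zero] at hb; exact hb rfl
  rw [pull_eq] at h
  have hs := axis_strictStep_ne_zero hg t
  have key : ∀ (m n : ℕ) (x y : Germ), axis (excIdx t) x ≠ 0 →
      excEq t ^ m * x = excEq t ^ n * y → n ≤ m := by
    intro m n x y hx hxy
    by_contra hlt
    obtain ⟨r, rfl⟩ := Nat.exists_eq_add_of_lt (not_le.mp hlt)
    rw [add_assoc, pow_add, mul_assoc] at hxy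
    have h1 := mul_left_cancel₀ (pow_ne_zero _ (excEq_ne_zero t)) hxy
    rw [h1, map_mul, pow_succ, map_mul, excEq, axis_X_self] at hx
    simp at hx
  have hmk : mult g = k := le_antisymm (key _ _ _ _ hb h.symm) (key _ _ _ _ hs h)
  refine ⟨hmk, ?_⟩
  rw [hmk] at h
  exact mul_left_cancel₀ (pow_ne_zero _ (excEq_ne_zero t)) h

/-! ### Germs as power series over the power series in `v` -/

/-- The ideal of the origin of the `v`-line. -/
def vIdeal : Ideal (MvPowerSeries (Fin 1) ℂ) := .span (.range X)

instance : IsAdicComplete vIdeal (MvPowerSeries (Fin 1) ℂ) :=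
  inferInstanceAs (IsAdicComplete (.span (.range X)) _)

theorem mem_vIdeal {p : MvPowerSeries (Fin 1) ℂ} : p ∈ vIdeal ↔ constantCoeff p = 0 := by
  rw [vIdeal, Set.range_unique, Ideal.mem_span_singleton, X_dvd_iff]
  constructor
  · intro h
    rw [← coeff_zero_eq_constantCoeff_apply]
    exact h 0 rfl
  · intro h m hm
    have : m = 0 := by
      refine Finsupp.ext fun i => ?_
      rw [Subsingleton.elim i default, hm]; rfl
    rw [this, coeff_zero_eq_constantCoeff_apply, h]

/-- A germ as a power series in `u` whose coefficients are power series in `v`. -/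
abbrev asSeries : Germ ≃ₐ[ℂ] PowerSeries (MvPowerSeries (Fin 1) ℂ) := finSuccEquiv ℂ 1

theorem coeff_coeff_asSeries (g : Germ) (k : ℕ) (x : Fin 1 →₀ ℕ) :
    coeff x (PowerSeries.coeff k (asSeries g)) = cf g k (x 0) := by
  rw [coeff_coeff_finSuccEquiv, cf]
  congr 2
  refine Finsupp.ext fun i => ?_
  fin_cases i
  · simp
  · exact (Finsupp.cons_succ (0 : Fin 1) k x).trans (ex_one _ _).symm

theorem constantCoeff_coeff_asSeries (g : Germ) (k : ℕ) :
    constantCoeff (PowerSeries.coeff k (asSeries g)) = cf g k 0 := by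
  rw [← coeff_zero_eq_constantCoeff_apply, coeff_coeff_asSeries]
  rfl

theorem asSeries_pull_inf (g : Germ) :
    asSeries (pull .inf g) = PowerSeries.rescale (X 0) (asSeries g) := by
  ext k x
  rw [coeff_coeff_asSeries, PowerSeries.coeff_rescale, cf_pull_inf, X_pow_eq, coeff_monomial_mul,
    one_mul]
  have : Finsupp.single 0 k ≤ x ↔ k ≤ x 0 := by
    simp
  simp only [this, coeff_coeff_asSeries]
  congr 1
  simp

theorem map_constantCoeff_asSeries (g : Germ) :
    PowerSeries.map (constantCoeff (σ := Fin 1) (R := ℂ)) (asSeries g) = axis 1 g := by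
  ext n
  rw [PowerSeries.coeff_map, constantCoeff_coeff_asSeries, coeff_axis_one]

theorem order_map_mk_asSeries (p : PowerSeries (MvPowerSeries (Fin 1) ℂ)) :
    (p.map (Ideal.Quotient.mk vIdeal)).order =
      (p.map (constantCoeff (σ := Fin 1) (R := ℂ))).order := by
  have key : ∀ n, PowerSeries.coeff n (p.map (Ideal.Quotient.mk vIdeal)) = 0 ↔
      PowerSeries.coeff n (p.map (constantCoeff (σ := Fin 1) (R := ℂ))) = 0 := by
    intro n
    rw [PowerSeries.coeff_map, PowerSeries.coeff_map, Ideal.Quotient.eq_zero_iff_mem, mem_vIdeal]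
  refine le_antisymm ?_ ?_
  · exact PowerSeries.le_order _ _ fun i hi => (key i).mp (PowerSeries.coeff_of_lt_order _ hi)
  · exact PowerSeries.le_order _ _ fun i hi => (key i).mpr (PowerSeries.coeff_of_lt_order _ hi)

/-- A factor `a` of the strict transform of a branch `φ` at a point of the exceptional curve meets
that curve with the multiplicity of `φ`; so the strict transform is irreducible at this point. By
Weierstrass preparation `a` may be replaced by a distinguished polynomial `P` in `u` of degree `k`.
Since the blow-up is the rescaling `u ↦ u v`, the polynomial `P` is the strict transform of a
distinguished polynomial `P'` of multiplicity `k`. By Weierstrass division `P'` divides `φ`, and so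
is associated to it. -/
theorem order_axis_eq_mult_of_dvd_inf {φ a : Germ} (hφ : Irreducible φ) (ha : ¬ IsUnit a)
    (hdvd : a ∣ strictStep φ .inf) : (axis 1 a).order = mult φ := by
  set κ := PowerSeries.map (constantCoeff (σ := Fin 1) (R := ℂ)) with hκ
  set w : MvPowerSeries (Fin 1) ℂ := X 0 with hw
  have hw0 : w ≠ 0 := by
    intro h
    have := coeff_index_single_self_X (R := ℂ) (0 : Fin 1)
    rw [← hw, h] at this
    simp at this
  have hwI : w ∈ vIdeal := by rw [mem_vIdeal, hw, constantCoeff_X]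
  have hs : axis 1 (strictStep φ .inf) ≠ 0 := axis_strictStep_ne_zero hφ.ne_zero .inf
  have ha0 : axis 1 a ≠ 0 := by
    obtain ⟨b, hb⟩ := hdvd
    rw [hb, map_mul] at hs
    exact left_ne_zero_of_mul hs
  obtain ⟨k, hk⟩ := ENat.ne_top_iff_exists.mp (fun h => ha0 (PowerSeries.order_eq_top.mp h))
  have hk0 : k ≠ 0 := by
    rintro rfl
    have h1 := PowerSeries.coeff_order ha0
    rw [← hk] at h1
    rw [isUnit_iff, not_not, ← constantCoeff_axis 1] at ha
    exact h1 (by simpa using ha)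
  have hAord : ((asSeries a).map (Ideal.Quotient.mk vIdeal)).order = k := by
    rw [order_map_mk_asSeries, map_constantCoeff_asSeries, hk]
  -- a distinguished polynomial associated with `a`
  have hdivA : (asSeries a).IsWeierstrassDivisorAt vIdeal := by
    rw [PowerSeries.IsWeierstrassDivisorAt, hAord, ENat.toNat_natCast, isUnit_iff_constantCoeff,
      constantCoeff_coeff_asSeries, ← coeff_axis_one, isUnit_iff_ne_zero]
    have := PowerSeries.coeff_order ha0
    rwa [← hk, ENat.toNat_natCast] at this
  have hdivision := hdivA.isWeierstrassDivisionAt_div_mod (PowerSeries.X ^ k)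
  set q := hdivA.div (PowerSeries.X ^ k)
  set r := hdivA.mod (PowerSeries.X ^ k)
  have hrdeg := hdivision.degree_lt
  rw [hAord, ENat.toNat_natCast] at hrdeg
  have hrmem : ∀ i < k, r.coeff i ∈ vIdeal := by
    intro i hi
    have := hdivision.coeff_f_sub_r_mem (i := i) (by rw [hAord, ENat.toNat_natCast]; exact hi)
    rw [map_sub, PowerSeries.coeff_X_pow, if_neg hi.ne, zero_sub, neg_mem_iff,
      Polynomial.coeff_coe] at this
    exact this
  set P : Polynomial (MvPowerSeries (Fin 1) ℂ) := Polynomial.X ^ k - r with hP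
  have hPq : asSeries a * q = P := by
    have h1 := hdivision.eq_mul_add
    rw [hP, Polynomial.coe_sub, Polynomial.coe_pow, Polynomial.coe_X, h1]
    ring
  have hPk : P.coeff k = 1 := by
    rw [hP, Polynomial.coeff_sub, Polynomial.coeff_X_pow, if_pos rfl,
      Polynomial.coeff_eq_zero_of_degree_lt hrdeg, sub_zero]
  have hPlt : ∀ i < k, P.coeff i ∈ vIdeal := by
    intro i hi
    rw [hP, Polynomial.coeff_sub, Polynomial.coeff_X_pow, if_neg hi.ne, zero_sub, neg_mem_iff]
    exact hrmem i hi
  have hPgt : ∀ i, k < i → P.coeff i = 0 := by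
    intro i hi
    rw [hP, Polynomial.coeff_sub, Polynomial.coeff_X_pow, if_neg hi.ne',
      Polynomial.coeff_eq_zero_of_degree_lt (hrdeg.trans (by exact_mod_cast hi)), sub_zero]
  -- polynomials whose lower coefficients vanish at the origin
  have hκX : ∀ Q : Polynomial (MvPowerSeries (Fin 1) ℂ), Q.coeff k = 1 →
      (∀ i < k, Q.coeff i ∈ vIdeal) → (∀ i, k < i → Q.coeff i = 0) →
      κ (Q : PowerSeries _) = PowerSeries.X ^ k := by
    intro Q h1 h2 h3
    ext i
    rw [hκ, PowerSeries.coeff_map, Polynomial.coeff_coe, PowerSeries.coeff_X_pow]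
    rcases lt_trichotomy i k with h | h | h
    · rw [mem_vIdeal.mp (h2 i h), if_neg h.ne]
    · rw [h, h1, map_one, if_pos rfl]
    · rw [h3 i h, map_zero, if_neg h.ne']
  have hκP := hκX P hPk hPlt hPgt
  have hqunit : IsUnit q := by
    have h1 := congrArg κ hPq
    rw [map_mul, hκP, hκ, map_constantCoeff_asSeries] at h1
    have h2 := congrArg PowerSeries.order h1
    rw [PowerSeries.order_mul, ← hk, PowerSeries.order_X_pow] at h2
    have h3 : (PowerSeries.map (constantCoeff (σ := Fin 1) (R := ℂ)) q).order = 0 := by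
      generalize (PowerSeries.map (constantCoeff (σ := Fin 1) (R := ℂ)) q).order = o at h2
      induction o using ENat.recTopCoe with
      | top => simp at h2
      | coe o => norm_cast at h2 ⊢; omega
    rw [PowerSeries.isUnit_iff_constantCoeff, isUnit_iff_constantCoeff, isUnit_iff_ne_zero]
    intro h4
    refine PowerSeries.order_ne_zero_iff_constCoeff_eq_zero.mpr ?_ h3
    rw [← PowerSeries.coeff_zero_eq_constantCoeff_apply, PowerSeries.coeff_map,
      PowerSeries.coeff_zero_eq_constantCoeff_apply]
    exact h4
  have hPdvd : (P : PowerSeries (MvPowerSeries (Fin 1) ℂ)) ∣ asSeries (strictStep φ .inf) := by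
    rw [← hPq]
    exact (hqunit.mul_right_dvd).mpr (map_dvd asSeries hdvd)
  -- the blown down polynomial `v ^ k * P (u / v)`
  set P' : Polynomial (MvPowerSeries (Fin 1) ℂ) :=
    ∑ i ∈ Finset.range (k + 1), Polynomial.C (P.coeff i * w ^ (k - i)) * Polynomial.X ^ i with hP'
  have hP'c : ∀ i, P'.coeff i = if i ≤ k then P.coeff i * w ^ (k - i) else 0 := by
    intro i
    simp only [hP', Polynomial.finsetSum_coeff, Polynomial.coeff_C_mul, Polynomial.coeff_X_pow]
    split_ifs with h
    · rw [Finset.sum_eq_single i]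
      · simp
      · intro b _ hb
        rw [if_neg (Ne.symm hb), mul_zero]
      · intro hj
        exact absurd (Finset.mem_range.mpr (by omega)) hj
    · refine Finset.sum_eq_zero fun b hb => ?_
      rw [Finset.mem_range] at hb
      rw [if_neg (by omega), mul_zero]
  have hP'k : P'.coeff k = 1 := by rw [hP'c, if_pos le_rfl, hPk]; simp
  have hP'lt : ∀ i < k, P'.coeff i ∈ vIdeal := by
    intro i hi
    rw [hP'c, if_pos hi.le]
    exact Ideal.mul_mem_right _ _ (hPlt i hi)
  have hP'gt : ∀ i, k < i → P'.coeff i = 0 := by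
    intro i hi
    rw [hP'c, if_neg (not_le.mpr hi)]
  have hκP' := hκX P' hP'k hP'lt hP'gt
  have hresc : PowerSeries.rescale w (P' : PowerSeries (MvPowerSeries (Fin 1) ℂ)) =
      PowerSeries.C w ^ k * P := by
    ext1 i
    rw [PowerSeries.coeff_rescale, Polynomial.coeff_coe, hP'c, ← map_pow, PowerSeries.coeff_C_mul,
      Polynomial.coeff_coe]
    split_ifs with h
    · have : w ^ k = w ^ i * w ^ (k - i) := by rw [← pow_add]; congr 1; omega
      rw [this]; ring
    · rw [hPgt i (not_le.mp h)]; simp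
  have hord' : ((P' : PowerSeries (MvPowerSeries (Fin 1) ℂ)).map
      (Ideal.Quotient.mk vIdeal)).order = k := by
    rw [order_map_mk_asSeries]
    exact (congrArg PowerSeries.order hκP').trans (PowerSeries.order_X_pow k)
  have hordP : ((P : PowerSeries (MvPowerSeries (Fin 1) ℂ)).map
      (Ideal.Quotient.mk vIdeal)).order = k := by
    rw [order_map_mk_asSeries]
    exact (congrArg PowerSeries.order hκP).trans (PowerSeries.order_X_pow k)
  have hdivP' : (P' : PowerSeries (MvPowerSeries (Fin 1) ℂ)).IsWeierstrassDivisorAt vIdeal := by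
    rw [PowerSeries.IsWeierstrassDivisorAt, hord', ENat.toNat_natCast, Polynomial.coeff_coe, hP'k]
    exact isUnit_one
  have hdivP : (P : PowerSeries (MvPowerSeries (Fin 1) ℂ)).IsWeierstrassDivisorAt vIdeal := by
    rw [PowerSeries.IsWeierstrassDivisorAt, hordP, ENat.toNat_natCast, Polynomial.coeff_coe, hPk]
    exact isUnit_one
  have hD := hdivP'.isWeierstrassDivisionAt_div_mod (asSeries φ)
  set q' := hdivP'.div (asSeries φ)
  set r' := hdivP'.mod (asSeries φ)
  have hr'deg := hD.degree_lt
  rw [hord', ENat.toNat_natCast] at hr'deg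
  obtain ⟨b, hb⟩ := hPdvd
  -- the remainder vanishes after rescaling, by uniqueness of the division by `P`
  have hr'0 : r' = 0 := by
    have h1 := congrArg (PowerSeries.rescale w) hD.eq_mul_add
    rw [← asSeries_pull_inf, pull_eq, map_mul, map_pow, map_add, map_mul, hresc, hb] at h1
    have hexc : asSeries (excEq .inf) = PowerSeries.C w := finSuccEquiv_X_succ (R := ℂ) (n := 1) 0
    rw [hexc] at h1
    set r'' : Polynomial (MvPowerSeries (Fin 1) ℂ) := r'.comp (Polynomial.C w * Polynomial.X)
    have hr'' : ∀ i, r''.coeff i = r'.coeff i * w ^ i := by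
      intro i
      exact Polynomial.comp_C_mul_X_coeff
    have hr''coe : PowerSeries.rescale w (r' : PowerSeries (MvPowerSeries (Fin 1) ℂ)) = r'' := by
      ext1 i
      rw [PowerSeries.coeff_rescale, Polynomial.coeff_coe, Polynomial.coeff_coe, hr'', mul_comm]
    have h2 := hdivP.eq_zero_of_mul_eq (q := PowerSeries.C w ^ mult φ * b -
      PowerSeries.C w ^ k * PowerSeries.rescale w q') (r := r'') (by
        rw [hordP, ENat.toNat_natCast, Polynomial.degree_lt_iff_coeff_zero]
        intro i hi
        rw [hr'', Polynomial.coeff_eq_zero_of_degree_lt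
          (hr'deg.trans_le (by exact_mod_cast hi)), zero_mul]) (by
        rw [← hr''coe]
        linear_combination h1)
    ext1 i
    have h3 := congrArg (fun p => Polynomial.coeff p i) h2.2
    simp only [hr'', Polynomial.coeff_zero] at h3
    exact (mul_eq_zero.mp h3).resolve_right (pow_ne_zero _ hw0)
  have hφeq : φ = asSeries.symm P' * asSeries.symm q' := by
    apply asSeries.injective
    rw [map_mul, AlgEquiv.apply_symm_apply, AlgEquiv.apply_symm_apply, hD.eq_mul_add, hr'0]
    simp
  have hmultP' : mult (asSeries.symm (P' : PowerSeries (MvPowerSeries (Fin 1) ℂ))) = k := by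
    refine (mult_and_strictStep_of_pull_eq (t := .inf)
      (b := asSeries.symm (P : PowerSeries (MvPowerSeries (Fin 1) ℂ))) ?_ ?_).1
    · apply asSeries.injective
      have hexc : asSeries (excEq .inf) = PowerSeries.C w := finSuccEquiv_X_succ (R := ℂ) (n := 1) 0
      rw [asSeries_pull_inf, AlgEquiv.apply_symm_apply, map_mul, map_pow, hexc,
        AlgEquiv.apply_symm_apply]
      exact hresc
    · change axis 1 _ ≠ 0
      rw [← map_constantCoeff_asSeries, AlgEquiv.apply_symm_apply]
      change κ _ ≠ 0
      rw [hκP]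
      exact pow_ne_zero _ PowerSeries.X_ne_zero
  have hne := hφ.ne_zero
  rw [hφeq] at hne
  rcases hφ.isUnit_or_isUnit hφeq with h | h
  · exact absurd (mult_eq_zero_of_isUnit h) (by rw [hmultP']; exact hk0)
  · rw [← hk, hφeq, mult_mul (left_ne_zero_of_mul hne) (right_ne_zero_of_mul hne), hmultP',
      mult_eq_zero_of_isUnit h, add_zero]

/-! ### Linear changes of coordinates -/

theorem substAlgHom_comp_eq {τ : Type*} {a : Fin 2 → Germ} {b c : Fin 2 → MvPowerSeries τ ℂ}
    (ha : HasSubst a) (hb : HasSubst b) (hc : HasSubst c)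
    (h : ∀ i, substAlgHom (R := ℂ) hb (a i) = c i) (g : Germ) :
    substAlgHom (R := ℂ) hb (substAlgHom (R := ℂ) ha g) = substAlgHom (R := ℂ) hc g := by
  simp only [coe_substAlgHom] at h ⊢
  rw [subst_comp_subst_apply ha hb]
  congr 1
  funext i
  exact h i

theorem substAlgHom_X_eq (g : Germ) (h : HasSubst (X : Fin 2 → Germ)) :
    substAlgHom (R := ℂ) h g = g := by
  rw [coe_substAlgHom, subst_self]
  rfl

theorem hasSubst_swap : HasSubst (![X 1, X 0] : Fin 2 → Germ) :=
  hasSubst_of_constantCoeff_zero fun i => by fin_cases i <;> simp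

/-- Exchange of the two coordinates. -/
def swap : Germ →ₐ[ℂ] Germ := substAlgHom hasSubst_swap

theorem swap_swap (g : Germ) : swap (swap g) = g := by
  rw [swap, substAlgHom_comp_eq _ _ HasSubst.X (fun i => ?_) g, substAlgHom_X_eq]
  fin_cases i
  · exact substAlgHom_X hasSubst_swap 1
  · exact substAlgHom_X hasSubst_swap 0

theorem axis_swap (g : Germ) : axis 1 (swap g) = axis 0 g := by
  refine substAlgHom_comp_eq _ _ _ (fun i => ?_) g
  fin_cases i
  · exact (substAlgHom_X (hasSubst_axis 1) 1).trans (by simp)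
  · exact (substAlgHom_X (hasSubst_axis 1) 0).trans (by simp)

theorem hasSubst_shear (c : ℂ) : HasSubst (![X 1, X 0 + C c * X 1] : Fin 2 → Germ) :=
  hasSubst_of_constantCoeff_zero fun i => by fin_cases i <;> simp

/-- The linear change of coordinates carrying the direction `v = c u` to `u = 0`. -/
def shear (c : ℂ) : Germ →ₐ[ℂ] Germ := substAlgHom (hasSubst_shear c)

theorem hasSubst_unshear (c : ℂ) : HasSubst (![X 1 - C c * X 0, X 0] : Fin 2 → Germ) :=
  hasSubst_of_constantCoeff_zero fun i => by fin_cases i <;> simp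

/-- The inverse of `shear`. -/
def unshear (c : ℂ) : Germ →ₐ[ℂ] Germ := substAlgHom (hasSubst_unshear c)

theorem map_C_eq (f : Germ →ₐ[ℂ] Germ) (c : ℂ) : f (C c) = C c := f.commutes c

theorem unshear_shear (c : ℂ) (g : Germ) : unshear c (shear c g) = g := by
  have h0 : unshear c (X 0) = X 1 - C c * X 0 := substAlgHom_X (hasSubst_unshear c) 0
  have h1 : unshear c (X 1) = X 0 := substAlgHom_X (hasSubst_unshear c) 1
  rw [shear]
  refine (substAlgHom_comp_eq (hasSubst_shear c) (hasSubst_unshear c) HasSubst.X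
    (fun i => ?_) g).trans (substAlgHom_X_eq _ _)
  fin_cases i
  · exact h1
  · change unshear c (X 0 + C c * X 1) = X 1
    rw [map_add, map_mul, map_C_eq, h0, h1]
    ring

theorem shear_unshear (c : ℂ) (g : Germ) : shear c (unshear c g) = g := by
  have h0 : shear c (X 0) = X 1 := substAlgHom_X (hasSubst_shear c) 0
  have h1 : shear c (X 1) = X 0 + C c * X 1 := substAlgHom_X (hasSubst_shear c) 1
  rw [unshear]
  refine (substAlgHom_comp_eq (hasSubst_unshear c) (hasSubst_shear c) HasSubst.X
    (fun i => ?_) g).trans (substAlgHom_X_eq _ _)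
  fin_cases i
  · change shear c (X 1 - C c * X 0) = X 0
    rw [map_sub, map_mul, map_C_eq, h0, h1]
    ring
  · exact h0

theorem irreducible_shear {c : ℂ} {g : Germ} (hg : Irreducible g) : Irreducible (shear c g) := by
  let e : Germ ≃ₐ[ℂ] Germ := AlgEquiv.ofAlgHom (shear c) (unshear c)
    (AlgHom.ext (shear_unshear c)) (AlgHom.ext (unshear_shear c))
  exact (MulEquiv.irreducible_iff e).mpr hg

theorem pull_inf_shear (c : ℂ) (g : Germ) : pull .inf (shear c g) = swap (pull (.fin c) g) := by
  have hc : HasSubst (![X 1, X 0 * X 1 + C c * X 1] : Fin 2 → Germ) :=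
    hasSubst_of_constantCoeff_zero fun i => by fin_cases i <;> simp
  have e1 : pull .inf (shear c g) = substAlgHom hc g := by
    refine substAlgHom_comp_eq _ (hasSubst_chart .inf) _ (fun i => ?_) g
    fin_cases i
    · exact pull_X .inf 1
    · change pull .inf (X 0 + C c * X 1) = X 0 * X 1 + C c * X 1
      rw [map_add, map_mul, map_C_eq, pull_X, pull_X]
      simp [chart]
  have e2 : swap (pull (.fin c) g) = substAlgHom hc g := by
    have h0 : swap (X 0) = X 1 := substAlgHom_X hasSubst_swap 0
    have h1 : swap (X 1) = X 0 := substAlgHom_X hasSubst_swap 1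
    refine substAlgHom_comp_eq _ hasSubst_swap _ (fun i => ?_) g
    fin_cases i
    · exact h0
    · change swap (X 0 * (X 1 + C c)) = X 0 * X 1 + C c * X 1
      rw [map_mul, map_add, map_C_eq, h0, h1]
      ring
  rw [e1, e2]

theorem strictStep_shear {c : ℂ} {g : Germ} (hg : g ≠ 0) :
    mult (shear c g) = mult g ∧ strictStep (shear c g) .inf = swap (strictStep g (.fin c)) := by
  refine mult_and_strictStep_of_pull_eq ?_ ?_
  · rw [pull_inf_shear, pull_eq, map_mul, map_pow]
    congr 2
    exact substAlgHom_X hasSubst_swap 0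
  · change axis 1 _ ≠ 0
    rw [axis_swap]
    exact axis_strictStep_ne_zero hg (.fin c)

/-! ### Strict transforms of branches -/

theorem order_axis_eq_mult_of_dvd {φ a : Germ} {t : Dir} (hφ : Irreducible φ) (ha : ¬ IsUnit a)
    (hdvd : a ∣ strictStep φ t) : (axis (excIdx t) a).order = mult φ := by
  cases t with
  | inf => exact order_axis_eq_mult_of_dvd_inf hφ ha hdvd
  | fin c =>
    obtain ⟨h1, h2⟩ := strictStep_shear (c := c) hφ.ne_zero
    have h3 := order_axis_eq_mult_of_dvd_inf (a := swap a) (irreducible_shear hφ (c := c)) (fun h => by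
      have := h.map swap
      rw [swap_swap] at this
      exact ha this) (by rw [h2]; exact map_dvd swap hdvd)
    rw [axis_swap, h1] at h3
    exact h3

/-- The strict transform of a branch meets the exceptional curve with the multiplicity of the
branch. -/
theorem order_axis_strictStep {φ : Germ} {t : Dir} (hφ : Irreducible φ)
    (ht : constantCoeff (strictStep φ t) = 0) :
    (axis (excIdx t) (strictStep φ t)).order = mult φ :=
  order_axis_eq_mult_of_dvd hφ (by rw [isUnit_iff, not_not]; exact ht) dvd_rfl

theorem mult_pos_of_not_isUnit {φ : Germ} (hφ : φ ≠ 0) (h : ¬ IsUnit φ) : 1 ≤ mult φ := by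
  rw [isUnit_iff, not_not] at h
  rw [Nat.one_le_iff_ne_zero, ne_eq, mult_eq_zero_iff hφ, not_not]
  exact h

theorem irreducible_strictStep {φ : Germ} {t : Dir} (hφ : Irreducible φ)
    (ht : constantCoeff (strictStep φ t) = 0) : Irreducible (strictStep φ t) := by
  refine ⟨by rw [isUnit_iff, not_not]; exact ht, fun {a b} hab => ?_⟩
  by_contra! hne
  have h1 := order_axis_strictStep hφ ht
  have ha := order_axis_eq_mult_of_dvd hφ hne.1 ⟨b, hab⟩
  have hb := order_axis_eq_mult_of_dvd hφ hne.2 ⟨a, by rw [hab, mul_comm]⟩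
  rw [hab, map_mul, PowerSeries.order_mul, ha, hb] at h1
  have h2 := mult_pos_of_not_isUnit hφ.ne_zero hφ.not_isUnit
  norm_cast at h1
  omega

theorem constantCoeff_strictStep_inf (g : Germ) :
    constantCoeff (strictStep g .inf) = cf g 0 (mult g) := by
  have := axis_strictStep_inf_coeff g 0
  rw [PowerSeries.coeff_zero_eq_constantCoeff_apply, constantCoeff_axis] at this
  simpa using this

theorem constantCoeff_strictStep_fin (c : ℂ) (g : Germ) :
    constantCoeff (strictStep g (.fin c)) = (form (mult g) g).eval c := by
  have := axis_strictStep_fin_coeff c g 0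
  rw [PowerSeries.coeff_zero_eq_constantCoeff_apply, constantCoeff_axis] at this
  rw [this, Polynomial.taylor_coeff_zero]

theorem natDegree_form_le (k : ℕ) (g : Germ) : (form k g).natDegree ≤ k := by
  rw [Polynomial.natDegree_le_iff_coeff_eq_zero]
  intro j hj
  rw [coeff_form, if_neg (not_le.mpr hj)]

theorem exists_passes {g : Germ} (h : 1 ≤ mult g) : ∃ t, constantCoeff (strictStep g t) = 0 := by
  by_cases h0 : cf g 0 (mult g) = 0
  · exact ⟨.inf, by rw [constantCoeff_strictStep_inf, h0]⟩
  · have hc : (form (mult g) g).coeff (mult g) ≠ 0 := by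
      rw [coeff_form, if_pos le_rfl, Nat.sub_self]; exact h0
    have hd : (form (mult g) g).degree ≠ 0 := by
      have h1 := Polynomial.le_degree_of_ne_zero hc
      intro h2
      rw [h2] at h1
      norm_cast at h1
      omega
    obtain ⟨c, hc⟩ := IsAlgClosed.exists_root _ hd
    exact ⟨.fin c, by rw [constantCoeff_strictStep_fin]; exact hc⟩

/-- If the strict transform meets the exceptional curve with full multiplicity at one point, then the
initial form is a power of a linear form and there is no other point. -/
theorem passes_unique {g : Germ} {t t' : Dir} (hg : g ≠ 0)
    (ht : (axis (excIdx t) (strictStep g t)).order = mult g)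
    (ht' : constantCoeff (strictStep g t') = 0) : t' = t := by
  obtain ⟨m, hm⟩ : ∃ m, m = mult g := ⟨_, rfl⟩
  rw [← hm] at ht
  have hF := form_mult_ne_zero hg
  rw [← hm] at hF
  cases t with
  | inf =>
    have ht1 : (axis 1 (strictStep g .inf)).order = m := ht
    have hlow : ∀ n < m, cf g n (m - n) = 0 := by
      intro n hn
      rw [hm, ← (axis_strictStep_inf_coeff g n).trans (if_pos (hm ▸ hn.le))]
      exact PowerSeries.coeff_of_lt_order _ (by rw [ht1]; exact_mod_cast hn)
    cases t' with
    | inf => rfl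
    | fin c =>
      exfalso
      have hform : form m g = Polynomial.C (cf g m 0) := by
        ext j
        rw [coeff_form, Polynomial.coeff_C]
        rcases Nat.eq_zero_or_pos j with rfl | hj
        · simp
        · rw [if_neg hj.ne']
          split_ifs with h
          · have := hlow (m - j) (by omega)
            rwa [show m - (m - j) = j by omega] at this
          · rfl
      rw [constantCoeff_strictStep_fin, ← hm, hform, Polynomial.eval_C] at ht'
      rw [hform, ht'] at hF
      simp at hF
  | fin c =>
    obtain ⟨T, hT⟩ : ∃ T, T = Polynomial.taylor c (form m g) := ⟨_, rfl⟩
    have ht1 : (axis 0 (strictStep g (.fin c))).order = m := ht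
    have hlow : ∀ n < m, T.coeff n = 0 := by
      intro n hn
      rw [hT, hm, ← axis_strictStep_fin_coeff]
      exact PowerSeries.coeff_of_lt_order _ (by rw [ht1]; exact_mod_cast hn)
    have hTdeg : T.natDegree ≤ m := by
      rw [hT, Polynomial.natDegree_taylor]
      exact natDegree_form_le _ _
    have hTeq : T = Polynomial.C (T.coeff m) * Polynomial.X ^ m := by
      ext j
      rw [Polynomial.coeff_C_mul, Polynomial.coeff_X_pow]
      rcases lt_trichotomy j m with h | h | h
      · rw [hlow j h, if_neg h.ne, mul_zero]
      · rw [if_pos h, mul_one, h]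
      · rw [Polynomial.coeff_eq_zero_of_natDegree_lt (hTdeg.trans_lt h), if_neg h.ne', mul_zero]
    have hT0 : T ≠ 0 := by
      intro h
      exact hF (Polynomial.taylor_injective c (by rw [← hT, h, map_zero]))
    have hTm : T.coeff m ≠ 0 := by
      intro h
      rw [h] at hTeq
      simp at hTeq
      exact hT0 hTeq
    cases t' with
    | inf =>
      exfalso
      have hc : (form m g).coeff m = 0 := by
        rw [coeff_form, if_pos le_rfl, Nat.sub_self, hm, ← constantCoeff_strictStep_inf, ht']
      have h1 : T.natDegree = m := le_antisymm hTdeg (Polynomial.le_natDegree_of_ne_zero hTm)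
      rw [hT, Polynomial.natDegree_taylor] at h1
      exact hF (Polynomial.leadingCoeff_eq_zero.mp (by rw [Polynomial.leadingCoeff, h1, hc]))
    | fin c' =>
      rw [constantCoeff_strictStep_fin, ← hm] at ht'
      have h1 : T.eval (c' - c) = 0 := by
        rw [hT, Polynomial.taylor_eval, sub_add_cancel, ht']
      rw [hTeq] at h1
      simp only [Polynomial.eval_mul, Polynomial.eval_C, Polynomial.eval_pow,
        Polynomial.eval_X] at h1
      have h2 := eq_zero_of_pow_eq_zero ((mul_eq_zero.mp h1).resolve_left hTm)
      rw [sub_eq_zero.mp h2]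

/-- A branch goes through a single point of the exceptional curve. -/
theorem dir_unique {φ : Germ} {t t' : Dir} (hφ : Irreducible φ)
    (ht : constantCoeff (strictStep φ t) = 0) (ht' : constantCoeff (strictStep φ t') = 0) :
    t' = t :=
  passes_unique hφ.ne_zero (order_axis_strictStep hφ ht) ht'

/-! ### Intersection with the axes -/

/-- The tangent direction of the axis `X i = 0`. -/
def axisDir (i : Fin 2) : Dir := if i = 0 then .inf else .fin 0

theorem axis_eq_pow_mul_axis (i : Fin 2) (g : Germ) :
    axis i g = PowerSeries.X ^ mult g * axis i (strictStep g (axisDir i)) := by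
  fin_cases i
  · change axis 0 g = PowerSeries.X ^ mult g * axis 0 (strictStep g .inf)
    ext n
    rw [PowerSeries.coeff_X_pow_mul', coeff_axis_zero]
    split_ifs with h
    · rw [coeff_axis_zero, cf_strictStep_inf, cf_pull_inf, if_pos (Nat.zero_le _), Nat.sub_zero,
        Nat.sub_add_cancel h]
    · exact cf_eq_zero_of_lt_mult (by omega)
  · change axis 1 g = PowerSeries.X ^ mult g * axis 1 (strictStep g (.fin 0))
    ext n
    rw [PowerSeries.coeff_X_pow_mul', coeff_axis_one]
    split_ifs with h
    · rw [coeff_axis_one, cf_strictStep_fin, cf_pull_fin, Nat.sub_add_cancel h,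
        Polynomial.taylor_coeff_zero, ← Polynomial.coeff_zero_eq_eval_zero, coeff_form,
        if_pos (Nat.zero_le _), Nat.sub_zero]
    · exact cf_eq_zero_of_lt_mult (by omega)

theorem order_axis (i : Fin 2) (g : Germ) :
    (axis i g).order = mult g + (axis i (strictStep g (axisDir i))).order := by
  rw [axis_eq_pow_mul_axis, PowerSeries.order_mul, PowerSeries.order_X_pow]

theorem order_axis_of_not_passes {i : Fin 2} {g : Germ}
    (h : constantCoeff (strictStep g (axisDir i)) ≠ 0) : (axis i g).order = mult g := by
  rw [order_axis, PowerSeries.order_zero_of_unit, add_zero]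
  rw [PowerSeries.isUnit_iff_constantCoeff, constantCoeff_axis]
  exact h.isUnit

theorem mult_le_order_axis (i : Fin 2) (g : Germ) : (mult g : ℕ∞) ≤ (axis i g).order := by
  rw [order_axis]
  exact le_self_add

theorem strictStep_X_axisDir (i : Fin 2) : strictStep (X i) (axisDir i) = X i := by
  fin_cases i
  · refine (mult_and_strictStep_of_pull_eq (t := .inf) (k := 1) ?_ ?_).2
    · change pull .inf (X 0) = X 1 ^ 1 * X 0
      rw [pull_X]
      simp [chart, mul_comm]
    · change axis 1 (X 0) ≠ 0
      rw [axis_X_of_ne (by decide)]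
      exact PowerSeries.X_ne_zero
  · refine (mult_and_strictStep_of_pull_eq (t := .fin 0) (k := 1) ?_ ?_).2
    · change pull (.fin 0) (X 1) = X 0 ^ 1 * X 1
      rw [pull_X]
      simp [chart]
    · change axis 0 (X 1) ≠ 0
      rw [axis_X_of_ne (by decide)]
      exact PowerSeries.X_ne_zero

theorem isUnit_strictStep_X {i : Fin 2} {t : Dir} (h : t ≠ axisDir i) :
    IsUnit (strictStep (X i) t) := by
  have key : ∀ (t : Dir) (b : Germ), IsUnit b → pull t (X i) = excEq t ^ 1 * b →
      IsUnit (strictStep (X i) t) := by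
    intro t b hb h
    rw [(mult_and_strictStep_of_pull_eq h (hb.map (axis (excIdx t))).ne_zero).2]
    exact hb
  cases t with
  | inf =>
    fin_cases i
    · exact absurd rfl h
    · refine key .inf 1 isUnit_one ?_
      change pull .inf (X 1) = X 1 ^ 1 * 1
      rw [pull_X]
      simp [chart]
  | fin c =>
    fin_cases i
    · refine key (.fin c) 1 isUnit_one ?_
      change pull (.fin c) (X 0) = X 0 ^ 1 * 1
      rw [pull_X]
      simp [chart]
    · have hc : c ≠ 0 := by
        rintro rfl
        exact h rfl
      refine key (.fin c) (X 1 + C c) ?_ ?_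
      · rw [isUnit_iff]
        simpa using hc
      · change pull (.fin c) (X 1) = X 0 ^ 1 * (X 1 + C c)
        rw [pull_X]
        simp [chart]

theorem isUnit_strictStep {g : Germ} (hg : IsUnit g) (t : Dir) : IsUnit (strictStep g t) := by
  have h := pull_eq t g
  rw [mult_eq_zero_of_isUnit hg, pow_zero, one_mul] at h
  rw [← h]
  exact hg.map (pull t)

/-! ### Intersection multiplicities with an axis -/

theorem intMult_comm (g h : Germ) : intMult g h = intMult h g := by
  rw [intMult, intMult, Set.pair_comm]

theorem axis_surjective (i : Fin 2) : Function.Surjective (axis i) := by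
  intro p
  have hoi : oth i ≠ i := by fin_cases i <;> simp [oth]
  let g : Germ := fun e => if e i = 0 then PowerSeries.coeff (e (oth i)) p else 0
  refine ⟨g, ?_⟩
  ext n
  rw [coeff_axis]
  change (if (Finsupp.single (oth i) n) i = 0 then
    PowerSeries.coeff ((Finsupp.single (oth i) n) (oth i)) p else 0) = _
  rw [Finsupp.single_eq_of_ne hoi.symm, if_pos rfl, Finsupp.single_eq_same]

/-- Truncation of the restriction to an axis. -/
def axisTrunc (i : Fin 2) (n : ℕ) : Germ →ₗ[ℂ] (Fin n → ℂ) :=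
  LinearMap.pi fun k => (PowerSeries.coeff (R := ℂ) (k : ℕ)) ∘ₗ (axis i).toLinearMap

theorem axisTrunc_surjective (i : Fin 2) (n : ℕ) : Function.Surjective (axisTrunc i n) := by
  intro c
  obtain ⟨g, hg⟩ := axis_surjective i (PowerSeries.mk fun k => if h : k < n then c ⟨k, h⟩ else 0)
  refine ⟨g, ?_⟩
  funext k
  simp [axisTrunc, hg]

theorem axisTrunc_eq_zero_iff {i : Fin 2} {n : ℕ} {g : Germ} :
    axisTrunc i n g = 0 ↔ PowerSeries.X ^ n ∣ axis i g := by
  rw [PowerSeries.X_pow_dvd_iff]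
  constructor
  · intro h m hm
    exact congrFun h ⟨m, hm⟩
  · intro h
    funext k
    exact h k k.2

theorem mem_span_pair_X_iff {i : Fin 2} {g x : Germ} :
    x ∈ Ideal.span {g, X i} ↔ axis i g ∣ axis i x := by
  rw [Ideal.mem_span_pair]
  constructor
  · rintro ⟨a, b, rfl⟩
    rw [map_add, map_mul, map_mul, axis_X_self, mul_zero, add_zero]
    exact dvd_mul_left _ _
  · rintro ⟨b, hb⟩
    obtain ⟨b', rfl⟩ := axis_surjective i b
    have : axis i (x - g * b') = 0 := by rw [map_sub, hb, map_mul, sub_self]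
    rw [axis_eq_zero_iff] at this
    obtain ⟨y, hy⟩ := this
    exact ⟨b', y, by rw [mul_comm y, ← hy]; ring⟩

/-- The intersection multiplicity with a coordinate axis is the order of the restriction to it. -/
theorem intMult_X_eq {i : Fin 2} {g : Germ} {n : ℕ} (h : (axis i g).order = n) :
    intMult g (X i) = n := by
  have hker : LinearMap.ker (axisTrunc i n) =
      (Ideal.span {g, (X i : Germ)}).restrictScalars ℂ := by
    ext x
    rw [LinearMap.mem_ker, axisTrunc_eq_zero_iff, Submodule.restrictScalars_mem,
      mem_span_pair_X_iff]
    have hne : axis i g ≠ 0 := by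
      intro h0
      rw [h0, PowerSeries.order_zero] at h
      exact ENat.top_ne_natCast n h
    have hass : Associated (axis i g) (PowerSeries.X ^ n) := by
      obtain ⟨w, hw⟩ : PowerSeries.X ^ n ∣ axis i g := PowerSeries.X_pow_dvd_iff.mpr fun m hm =>
        PowerSeries.coeff_of_lt_order _ (by rw [h]; exact_mod_cast hm)
      have hwc : IsUnit w := by
        rw [PowerSeries.isUnit_iff_constantCoeff, isUnit_iff_ne_zero]
        intro h0
        have h1 := PowerSeries.coeff_order hne
        rw [h, ENat.toNat_natCast, hw, PowerSeries.coeff_X_pow_mul'] at h1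
        simp [h0] at h1
      rw [hw]
      exact (associated_mul_unit_right _ _ hwc).symm
    exact hass.symm.dvd_iff_dvd_left
  have e1 := (axisTrunc i n).quotKerEquivOfSurjective (axisTrunc_surjective i n)
  rw [hker] at e1
  have e2 := Submodule.Quotient.restrictScalarsEquiv ℂ (Ideal.span {g, (X i : Germ)})
  rw [intMult, ← e2.finrank_eq, e1.finrank_eq]
  simp

/-- An intersection multiplicity equal to `1` is not the junk value of an infinite-dimensional
quotient. -/
theorem order_axis_eq_one_of_intMult {i : Fin 2} {g : Germ} (h : intMult g (X i) = 1) :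
    (axis i g).order = 1 := by
  rcases eq_or_ne (axis i g).order ⊤ with htop | hne
  · exfalso
    have hg : axis i g = 0 := PowerSeries.order_eq_top.mp htop
    have hle : (Ideal.span {g, (X i : Germ)}).restrictScalars ℂ ≤ LinearMap.ker (axisTrunc i 2) := by
      intro x hx
      rw [Submodule.restrictScalars_mem, mem_span_pair_X_iff, hg, zero_dvd_iff] at hx
      rw [LinearMap.mem_ker, axisTrunc_eq_zero_iff, hx]
      exact dvd_zero _
    have e2 := Submodule.Quotient.restrictScalarsEquiv ℂ (Ideal.span {g, (X i : Germ)})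
    have hf : Function.Surjective
        ((Submodule.liftQ _ (axisTrunc i 2) hle) ∘ₗ e2.symm.toLinearMap) := by
      intro y
      obtain ⟨x, hx⟩ := axisTrunc_surjective i 2 y
      refine ⟨e2 (Submodule.Quotient.mk x), ?_⟩
      rw [LinearMap.comp_apply, LinearEquiv.coe_coe, LinearEquiv.symm_apply_apply,
        Submodule.liftQ_apply, hx]
    have hfin : Module.Finite ℂ (Germ ⧸ Ideal.span {g, (X i : Germ)}) :=
      Module.finite_of_finrank_pos (by
        change 0 < intMult g (X i)
        rw [h]; exact one_pos)
    have := LinearMap.finrank_le_finrank_of_surjective hf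
    change _ ≤ intMult g (X i) at this
    rw [h] at this
    simp at this
  · obtain ⟨n, hn⟩ := ENat.ne_top_iff_exists.mp hne
    rw [intMult_X_eq hn.symm] at h
    rw [← hn, h]
    rfl

/-! ### Branches along sequences of infinitely near points -/

theorem strictAt_nil (g : Germ) : strictAt [] g = g := rfl

theorem strictAt_cons (t : Dir) (q : Pt) (g : Germ) :
    strictAt (t :: q) g = strictAt q (strictStep g t) := rfl

theorem strictAt_append (q r : Pt) (g : Germ) : strictAt (q ++ r) g = strictAt r (strictAt q g) :=
  List.foldl_append

theorem strictAt_concat (q : Pt) (t : Dir) (g : Germ) :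
    strictAt (q ++ [t]) g = strictStep (strictAt q g) t :=
  strictAt_append q [t] g

theorem passesThrough_append {q r : Pt} {g : Germ} :
    PassesThrough g (q ++ r) ↔ PassesThrough (strictAt q g) r := by
  rw [PassesThrough, PassesThrough, strictAt_append]

theorem passesThrough_cons {t : Dir} {q : Pt} {g : Germ} :
    PassesThrough g (t :: q) ↔ PassesThrough (strictStep g t) q := Iff.rfl

theorem not_passesThrough_iff {q : Pt} {g : Germ} :
    ¬ PassesThrough g q ↔ IsUnit (strictAt q g) := by
  rw [PassesThrough, isUnit_iff]

theorem isUnit_strictAt {g : Germ} (hg : IsUnit g) (q : Pt) : IsUnit (strictAt q g) := by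
  induction q generalizing g with
  | nil => exact hg
  | cons t q ih => exact ih (isUnit_strictStep hg t)

theorem PassesThrough.of_append {q r : Pt} {g : Germ} (h : PassesThrough g (q ++ r)) :
    PassesThrough g q := by
  by_contra hq
  rw [not_passesThrough_iff] at hq
  rw [passesThrough_append] at h
  exact not_passesThrough_iff.mpr (isUnit_strictAt hq r) h

theorem PassesThrough.of_prefix {q r : Pt} {g : Germ} (h : PassesThrough g r) (hq : q <+: r) :
    PassesThrough g q := by
  obtain ⟨s, rfl⟩ := hq
  exact h.of_append

theorem not_isUnit_of_passesThrough {q : Pt} {g : Germ} (h : PassesThrough g q) : ¬ IsUnit g :=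
  fun hg => not_passesThrough_iff.mpr (isUnit_strictAt hg q) h

theorem irreducible_strictAt {φ : Germ} {q : Pt} (hφ : Irreducible φ) (h : PassesThrough φ q) :
    Irreducible (strictAt q φ) := by
  induction q generalizing φ with
  | nil => exact hφ
  | cons t q ih =>
    have h1 : PassesThrough φ [t] := PassesThrough.of_append (q := [t]) h
    exact ih (irreducible_strictStep hφ h1) h

theorem strictAt_ne_zero {g : Germ} (hg : g ≠ 0) (q : Pt) : strictAt q g ≠ 0 := by
  induction q generalizing g with
  | nil => exact hg
  | cons t q ih => exact ih (strictStep_ne_zero hg t)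

theorem eq_of_passesThrough {φ : Germ} {q r : Pt} (hφ : Irreducible φ) (hq : PassesThrough φ q)
    (hr : PassesThrough φ r) (hl : q.length = r.length) : q = r := by
  induction q generalizing φ r with
  | nil => exact (List.length_eq_zero_iff.mp hl.symm).symm
  | cons t q ih =>
    cases r with
    | nil => simp at hl
    | cons t' r =>
      have h1 : PassesThrough φ [t] := PassesThrough.of_append (q := [t]) hq
      have h2 : PassesThrough φ [t'] := PassesThrough.of_append (q := [t']) hr
      obtain rfl := dir_unique hφ h1 h2
      rw [ih (irreducible_strictStep hφ h1) hq hr (by simpa using hl)]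

theorem multAt_eq_zero {g : Germ} {q : Pt} (h : ¬ PassesThrough g q) : multAt q g = 0 :=
  mult_eq_zero_of_isUnit (not_passesThrough_iff.mp h)

theorem one_le_multAt {g : Germ} {q : Pt} (hg : g ≠ 0) (h : PassesThrough g q) :
    1 ≤ multAt q g :=
  mult_pos_of_not_isUnit (strictAt_ne_zero hg q) (by rwa [← not_passesThrough_iff, not_not])

theorem passesThrough_X_nil (i : Fin 2) : PassesThrough (X i) [] := constantCoeff_X i

theorem passesThrough_X_cons {i : Fin 2} {t : Dir} {q : Pt} :
    PassesThrough (X i) (t :: q) ↔ t = axisDir i ∧ PassesThrough (X i) q := by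
  rw [passesThrough_cons]
  constructor
  · intro h
    by_cases ht : t = axisDir i
    · rw [ht, strictStep_X_axisDir] at h
      exact ⟨ht, h⟩
    · exact absurd (isUnit_strictStep_X ht) (not_isUnit_of_passesThrough h)
  · rintro ⟨rfl, h⟩
    rwa [strictStep_X_axisDir]

theorem strictAt_X {i : Fin 2} {q : Pt} (h : PassesThrough (X i) q) : strictAt q (X i) = X i := by
  induction q with
  | nil => rfl
  | cons t q ih =>
    obtain ⟨rfl, h'⟩ := passesThrough_X_cons.mp h
    rw [strictAt_cons, strictStep_X_axisDir, ih h']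

open Classical in
theorem multAt_X (i : Fin 2) (q : Pt) :
    multAt q (X i) = if PassesThrough (X i) q then 1 else 0 := by
  split_ifs with h
  · rw [multAt, strictAt_X h, mult_X]
  · exact multAt_eq_zero h

open Classical in
/-- Noether's formula for the intersection of a branch with a coordinate axis: it is the sum of
the multiplicities of the branch at the points shared with the axis. -/
theorem order_axis_eq_sum {φ : Germ} {i : Fin 2} {q : Pt} (hφ : Irreducible φ)
    (hq : PassesThrough φ q) (hX : ¬ PassesThrough (X i) q) :
    (axis i φ).order = ((∑ ℓ ∈ Finset.range q.length,
      if PassesThrough (X i) (q.take ℓ) then multAt (q.take ℓ) φ else 0 : ℕ) : ℕ∞) := by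
  induction q generalizing φ with
  | nil => exact absurd (passesThrough_X_nil i) hX
  | cons t q ih =>
    have h1 : PassesThrough φ [t] := PassesThrough.of_append (q := [t]) hq
    rw [List.length_cons, Finset.sum_range_succ', List.take_zero, if_pos (passesThrough_X_nil i)]
    have hm : multAt [] φ = mult φ := rfl
    rw [hm]
    by_cases ht : t = axisDir i
    · subst ht
      have hX' : ¬ PassesThrough (X i) q := fun h => hX (passesThrough_X_cons.mpr ⟨rfl, h⟩)
      rw [order_axis, ih (irreducible_strictStep hφ h1) hq hX', add_comm, Nat.cast_add]
      congr 2
      refine Finset.sum_congr rfl fun ℓ _ => ?_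
      refine if_congr ?_ rfl rfl
      rw [List.take_succ_cons, passesThrough_X_cons, and_iff_right rfl]
    · rw [Finset.sum_eq_zero, zero_add]
      · refine order_axis_of_not_passes fun h => ht (dir_unique hφ h h1)
      · intro ℓ _
        refine if_neg fun h => ht ?_
        rw [List.take_succ_cons] at h
        exact (passesThrough_X_cons.mp h).1

theorem proximate_concat (q : Pt) (t : Dir) : Proximate (q ++ [t]) q :=
  ⟨t, [], rfl, passesThrough_X_nil _⟩

theorem Proximate.prefix {q r : Pt} (h : Proximate q r) : r <+: q := by
  obtain ⟨t, q', rfl, -⟩ := h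
  exact List.prefix_append _ _

theorem Proximate.length_lt {q r : Pt} (h : Proximate q r) : r.length < q.length := by
  obtain ⟨t, q', rfl, -⟩ := h
  simp

theorem proximate_append_cons {r q : Pt} {t : Dir} :
    Proximate (r ++ t :: q) r ↔ PassesThrough (excEq t) q := by
  constructor
  · rintro ⟨t', q', h, h'⟩
    obtain ⟨rfl, rfl⟩ := List.cons.inj (List.append_cancel_left h)
    exact h'
  · intro h
    exact ⟨t, q, rfl, h⟩

/-! ### Curvettes -/

theorem IsCurvette.exists_dir {φ : Germ} {q : Pt} (h : IsCurvette φ q) : ∃ t : Dir,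
    Irreducible φ ∧ PassesThrough φ (q ++ [t]) ∧ multAt q φ = 1 ∧
    (∀ r : Pt, Proximate (q ++ [t]) r → r = q) ∧ ¬ PassesThrough lineGerm (q ++ [t]) := by
  obtain ⟨hφ, t, h1, h2, h3⟩ := h
  have h4 := order_axis_eq_one_of_intMult h1
  have h5 : PassesThrough φ (q ++ [t]) := by
    by_contra h
    rw [not_passesThrough_iff] at h
    rw [PowerSeries.order_zero_of_unit (h.map (axis (excIdx t)))] at h4
    exact zero_ne_one h4
  refine ⟨t, hφ, h5, ?_, h2, h3⟩
  have h6 := order_axis_strictStep (t := t) (irreducible_strictAt hφ h5.of_append)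
    (by rw [← strictAt_concat]; exact h5)
  rw [← strictAt_concat, h4] at h6
  exact_mod_cast h6.symm

open Classical in
/-- Noether's formula for the intersection of a curvette with the line at infinity. -/
theorem IsCurvette.intMult_lineGerm {φ : Germ} {q : Pt} (h : IsCurvette φ q) :
    intMult lineGerm φ = ∑ ℓ ∈ Finset.range (q.length + 1),
      if PassesThrough lineGerm (q.take ℓ) then multAt (q.take ℓ) φ else 0 := by
  obtain ⟨t, hφ, h1, -, -, h3⟩ := h.exists_dir
  have h4 := order_axis_eq_sum hφ h1 h3
  rw [intMult_comm]
  refine (intMult_X_eq h4).trans ?_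
  rw [List.length_append, List.length_singleton]
  refine Finset.sum_congr rfl fun ℓ hℓ => ?_
  rw [List.take_append_of_le_length (Nat.lt_succ_iff.mp (Finset.mem_range.mp hℓ))]
  rfl

open Classical in
/-- The proximity equality for curvettes: the multiplicity at `r` is the sum of the multiplicities at
the points proximate to `r`, with one more unit if `r` is the last point `q`, where the curvette meets
the exceptional curve transversally at a further point. -/
theorem IsCurvette.proximity {φ : Germ} {q : Pt} (h : IsCurvette φ q) (r : Pt) :
    (∑ ℓ ∈ Finset.range (q.length + 1), if q.take ℓ = r then (multAt (q.take ℓ) φ : ℝ) else 0) -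
      ∑ ℓ ∈ Finset.range (q.length + 1),
        (if Proximate (q.take ℓ) r then (multAt (q.take ℓ) φ : ℝ) else 0) =
      if q = r then 1 else 0 := by
  obtain ⟨t, hφ, h1, h2, h3, -⟩ := h.exists_dir
  by_cases hr : r <+: q
  · obtain ⟨s, rfl⟩ := hr
    have hlen : (r ++ s).length + 1 = r.length + (s.length + 1) := by
      rw [List.length_append, add_assoc]
    rw [hlen, Finset.sum_range_add _ r.length, Finset.sum_range_add _ r.length, Finset.sum_range_succ' _ s.length,
      Finset.sum_range_succ' _ s.length]
    have e1 : ∀ ℓ < r.length, ((r ++ s).take ℓ).length < r.length := by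
      intro ℓ hℓ
      rw [List.length_take]
      exact (min_le_left _ _).trans_lt hℓ
    rw [Finset.sum_eq_zero (s := Finset.range r.length), Finset.sum_eq_zero (s := Finset.range r.length),
      Finset.sum_eq_zero (s := Finset.range s.length)]
    rotate_left
    · intro ℓ hℓ
      rw [if_neg]
      intro h
      have := congrArg List.length h
      rw [List.length_take, List.length_append] at this
      have := Finset.mem_range.mp hℓ
      omega
    · intro ℓ hℓ
      rw [if_neg]
      intro h
      have := h.length_lt
      have := e1 ℓ (Finset.mem_range.mp hℓ)
      omega
    · intro ℓ hℓ
      rw [if_neg]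
      intro h
      have := e1 ℓ (Finset.mem_range.mp hℓ)
      rw [h] at this
      exact lt_irrefl _ this
    have e2 : (r ++ s).take (r.length + 0) = r := by simp
    rw [e2, if_pos rfl, if_neg fun h => lt_irrefl _ h.length_lt, zero_add, zero_add, zero_add,
      add_zero]
    cases s with
    | nil =>
      rw [List.append_nil] at h2 ⊢
      simp [h2]
    | cons u s =>
      rw [if_neg (by simp)]
      have h4 : PassesThrough φ (r ++ [u]) := h1.of_prefix (by simp)
      have h5 := order_axis_strictStep (t := u) (irreducible_strictAt hφ h4.of_append)
        (by rw [← strictAt_concat]; exact h4)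
      rw [← strictAt_concat] at h5
      have h6 : r ++ u :: s ++ [t] = (r ++ [u]) ++ (s ++ [t]) := by simp
      have h7 := order_axis_eq_sum (i := excIdx u) (q := s ++ [t]) (irreducible_strictAt hφ h4)
        (by rw [← passesThrough_append, ← h6]; exact h1) (by
          intro h
          have h8 : Proximate (r ++ u :: s ++ [t]) r := ⟨u, s ++ [t], by simp, h⟩
          have h9 := congrArg List.length (h3 r h8)
          simp at h9)
      rw [h5] at h7
      have h8 : multAt r φ = _ := Nat.cast_injective h7
      rw [sub_eq_zero, h8, Nat.cast_sum, List.length_append, List.length_singleton,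
        List.length_cons]
      refine Finset.sum_congr rfl fun ℓ hℓ => ?_
      rw [List.take_append_of_le_length (Nat.lt_succ_iff.mp (Finset.mem_range.mp hℓ))]
      have e3 : (r ++ u :: s).take (r.length + (ℓ + 1)) = r ++ u :: s.take ℓ := by
        rw [List.take_length_add_append, List.take_succ_cons]
      rw [e3, proximate_append_cons, multAt, multAt, ← strictAt_append,
        show r ++ [u] ++ List.take ℓ s = r ++ u :: List.take ℓ s by simp]
      push_cast
      rfl
  · rw [if_neg (by rintro rfl; exact hr List.prefix_rfl), Finset.sum_eq_zero, Finset.sum_eq_zero,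
      sub_zero]
    · intro ℓ _
      rw [if_neg fun h => hr (h.prefix.trans (List.take_prefix _ _))]
    · intro ℓ _
      rw [if_neg]
      rintro rfl
      exact hr (List.take_prefix _ _)

/-! ### The intersection lattice of a configuration -/

namespace Config

variable (S : Config)

theorem pt_inl (i : Fin S.s₀) : S.pt (.inl i) = S.last.take i := rfl

theorem pt_inr (j : Fin S.k) (ℓ : Fin (S.s j)) :
    S.pt (.inr ⟨j, ℓ⟩) = S.last ++ (S.tail j).take (ℓ + 1) := rfl

theorem length_pt_inl (i : Fin S.s₀) : (S.pt (.inl i)).length = i := by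
  rw [pt_inl, List.length_take]
  exact min_eq_left (Nat.lt_succ_iff.mp i.2)

theorem length_pt_inr (j : Fin S.k) (ℓ : Fin (S.s j)) :
    (S.pt (.inr ⟨j, ℓ⟩)).length = S.last.length + (ℓ + 1) := by
  rw [pt_inr, List.length_append, List.length_take]
  congr 1
  exact min_eq_left ℓ.2

theorem pt_injective : Function.Injective S.pt := by
  rintro (i | ⟨j, ℓ⟩) (i' | ⟨j', ℓ'⟩) h
  · have := congrArg List.length h
    rw [length_pt_inl, length_pt_inl] at this
    rw [Fin.ext this]
  · have := congrArg List.length h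
    rw [length_pt_inl, length_pt_inr] at this
    have hi : (i : ℕ) < S.last.length + 1 := i.2
    omega
  · have := congrArg List.length h
    rw [length_pt_inl, length_pt_inr] at this
    have hi : (i' : ℕ) < S.last.length + 1 := i'.2
    omega
  · have hl := congrArg List.length h
    rw [length_pt_inr, length_pt_inr] at hl
    have hℓ : (ℓ : ℕ) = ℓ' := by omega
    rw [pt_inr, pt_inr, hℓ] at h
    have h2 := congrArg (List.take 1) (List.append_cancel_left h)
    rw [List.take_take, List.take_take, min_eq_left (by omega)] at h2
    have hj : j = j' := by
      by_contra hne
      exact S.first_ne _ _ hne h2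
    subst hj
    rw [Fin.ext hℓ]

theorem exists_pt_eq_of_prefix {q : S.Idx} {r : Pt} (h : r <+: S.pt q) : ∃ x, S.pt x = r := by
  have base : ∀ r : Pt, r <+: S.last → ∃ x, S.pt x = r := by
    intro r hr
    refine ⟨.inl ⟨r.length, Nat.lt_succ_iff.mpr hr.length_le⟩, ?_⟩
    exact (List.prefix_iff_eq_take.mp hr).symm
  rcases q with i | ⟨j, ℓ⟩
  · exact base r (h.trans (List.take_prefix _ _))
  · rw [pt_inr] at h
    rcases List.prefix_or_prefix_of_prefix h (List.prefix_append S.last _) with h' | ⟨r', rfl⟩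
    · exact base r h'
    · replace h := (List.prefix_append_right_inj _).mp h
      rcases Nat.eq_zero_or_pos r'.length with h0 | h0
      · obtain rfl := List.length_eq_zero_iff.mp h0
        exact base _ (by simp)
      · have h1 := h.trans (List.take_prefix _ _)
        refine ⟨.inr ⟨j, ⟨r'.length - 1, ?_⟩⟩, ?_⟩
        · have := h1.length_le
          change _ < (S.tail j).length
          omega
        · rw [pt_inr]
          congr 1
          rw [Nat.sub_add_cancel h0]
          exact (List.prefix_iff_eq_take.mp h1).symm

open Classical in
theorem sum_prefix (q : S.Idx) (h : Pt → ℝ) :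
    (∑ x, if S.pt x <+: S.pt q then h (S.pt x) else 0) =
      ∑ ℓ ∈ Finset.range ((S.pt q).length + 1), h ((S.pt q).take ℓ) := by
  rw [← Finset.sum_filter]
  refine Finset.sum_nbij (fun x => (S.pt x).length) ?_ ?_ ?_ ?_
  · intro x hx
    exact Finset.mem_range.mpr (Nat.lt_succ_iff.mpr (Finset.mem_filter.mp hx).2.length_le)
  · intro x hx y hy hxy
    have hx' := (Finset.mem_filter.mp (Finset.mem_coe.mp hx)).2
    have hy' := (Finset.mem_filter.mp (Finset.mem_coe.mp hy)).2
    refine S.pt_injective ?_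
    have hxy' : (S.pt x).length = (S.pt y).length := hxy
    rw [List.prefix_iff_eq_take.mp hx', List.prefix_iff_eq_take.mp hy', hxy']
  · intro ℓ hℓ
    have hℓ' := Finset.mem_range.mp (Finset.mem_coe.mp hℓ)
    obtain ⟨x, hx⟩ := S.exists_pt_eq_of_prefix (List.take_prefix ℓ (S.pt q))
    refine ⟨x, Finset.mem_coe.mpr (Finset.mem_filter.mpr ⟨Finset.mem_univ _, ?_⟩), ?_⟩
    · rw [hx]
      exact List.take_prefix _ _
    · change (S.pt x).length = ℓ
      rw [hx, List.length_take]
      omega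
  · intro x hx
    rw [← List.prefix_iff_eq_take.mp (Finset.mem_filter.mp hx).2]

theorem inter_apply (x y : S.NS) : S.inter x y = x.1 * y.1 - ∑ q, x.2 q * y.2 q := rfl

theorem inter_comm (x y : S.NS) : S.inter x y = S.inter y x := by
  rw [inter_apply, inter_apply, mul_comm]
  simp only [mul_comm]

theorem excTotal_fst (q : S.Idx) : (S.excTotal q).1 = 0 := rfl

open Classical in
theorem excTotal_snd (q r : S.Idx) : (S.excTotal q).2 r = if r = q then 1 else 0 := by
  change (Pi.single q 1 : S.Idx → ℝ) r = _
  rw [Pi.single_apply]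

theorem lineClass_fst : S.lineClass.1 = 1 := rfl

theorem lineClass_snd (r : S.Idx) : S.lineClass.2 r = 0 := rfl

theorem curveClass_fst (G : MvPolynomial (Fin 3) ℂ) (e : ℕ) : (S.curveClass G e).1 = e := by
  simp [curveClass, lineClass_fst, Prod.fst_sum, excTotal_fst]

theorem curveClass_snd (G : MvPolynomial (Fin 3) ℂ) (e : ℕ) (r : S.Idx) :
    (S.curveClass G e).2 r = -multAt (S.pt r) (germAt G) := by
  classical
  simp [curveClass, Prod.snd_sum, excTotal_snd, lineClass_snd, -Fintype.sum_sum_type]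

theorem excStrict_fst (q : S.Idx) : (S.excStrict q).1 = 0 := by
  simp only [excStrict, Prod.fst_sub, excTotal_fst, Prod.fst_sum, zero_sub, neg_eq_zero]
  refine Finset.sum_eq_zero fun x _ => ?_
  split_ifs
  · rfl
  · rfl

open Classical in
theorem excStrict_snd (q r : S.Idx) : (S.excStrict q).2 r =
    (if r = q then 1 else 0) - if Proximate (S.pt r) (S.pt q) then 1 else 0 := by
  have h : ∀ x, (if Proximate (S.pt x) (S.pt q) then S.excTotal x else 0).2 r =
      if r = x then (if Proximate (S.pt x) (S.pt q) then 1 else 0) else 0 := by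
    intro x
    by_cases hx : Proximate (S.pt x) (S.pt q)
    · rw [if_pos hx, if_pos hx, excTotal_snd]
    · rw [if_neg hx, if_neg hx, ite_self]
      rfl
  rw [excStrict, Prod.snd_sub, Pi.sub_apply, excTotal_snd, Prod.snd_sum, Finset.sum_apply]
  congr 1
  simp only [h]
  rw [Finset.sum_ite_eq, if_pos (Finset.mem_univ _)]

theorem D_fst (φ : S.Idx → Germ) (q : S.Idx) : (S.D φ q).1 = intMult lineGerm (φ q) := by
  simp only [D, Prod.fst_sub, Prod.smul_fst, lineClass_fst, Prod.fst_sum, smul_eq_mul, mul_one]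
  rw [Finset.sum_eq_zero, sub_zero]
  intro x _
  split_ifs
  · rw [Prod.smul_fst, excTotal_fst, smul_zero]
  · rfl

open Classical in
theorem D_snd (φ : S.Idx → Germ) (q r : S.Idx) : (S.D φ q).2 r =
    -if S.pt r <+: S.pt q then (multAt (S.pt r) (φ q) : ℝ) else 0 := by
  have h : ∀ x, (if S.pt x <+: S.pt q then (multAt (S.pt x) (φ q) : ℝ) • S.excTotal x else 0).2 r =
      if r = x then (if S.pt x <+: S.pt q then (multAt (S.pt x) (φ q) : ℝ) else 0) else 0 := by
    intro x
    by_cases hx : S.pt x <+: S.pt q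
    · rw [if_pos hx, if_pos hx, Prod.smul_snd, Pi.smul_apply, excTotal_snd, smul_eq_mul, mul_ite,
        mul_one, mul_zero]
    · rw [if_neg hx, if_neg hx, ite_self]
      rfl
  rw [D, Prod.snd_sub, Pi.sub_apply, Prod.smul_snd, Pi.smul_apply, lineClass_snd, smul_zero,
    zero_sub, Prod.snd_sum, Finset.sum_apply]
  congr 1
  simp only [h]
  rw [Finset.sum_ite_eq, if_pos (Finset.mem_univ _)]

open Classical in
theorem inter_excStrict (v : S.NS) (r : S.Idx) : S.inter v (S.excStrict r) =
    -v.2 r + ∑ x, if Proximate (S.pt x) (S.pt r) then v.2 x else 0 := by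
  rw [inter_apply, excStrict_fst, mul_zero, zero_sub]
  simp only [excStrict_snd, mul_sub, mul_ite, mul_one, mul_zero]
  rw [Finset.sum_sub_distrib, Finset.sum_ite_eq', if_pos (Finset.mem_univ _)]
  ring

theorem inter_curveClass (v : S.NS) (G : MvPolynomial (Fin 3) ℂ) (e : ℕ) :
    S.inter v (S.curveClass G e) = v.1 * e + ∑ x, v.2 x * multAt (S.pt x) (germAt G) := by
  rw [inter_apply, curveClass_fst]
  simp only [curveClass_snd, mul_neg, Finset.sum_neg_distrib, sub_neg_eq_add]

/-- The class of the strict transform of the line at infinity. -/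
def lineStrict : S.NS := S.curveClass (MvPolynomial.X 2) 1

theorem germAt_X_two : germAt (MvPolynomial.X 2) = X 0 := by
  simp [germAt]

theorem inter_lineStrict (v : S.NS) :
    S.inter v S.lineStrict = v.1 + ∑ x, v.2 x * multAt (S.pt x) (X 0) := by
  rw [lineStrict, inter_curveClass, germAt_X_two, Nat.cast_one, mul_one]

theorem inter_D_lineStrict {φ : S.Idx → Germ} {q : S.Idx} (h : IsCurvette (φ q) (S.pt q)) :
    S.inter (S.D φ q) S.lineStrict = 0 := by
  classical
  rw [inter_lineStrict, D_fst, h.intMult_lineGerm, ← eq_neg_iff_add_eq_zero,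
    ← Finset.sum_neg_distrib]
  push_cast
  rw [← S.sum_prefix q fun r => if PassesThrough lineGerm r then (multAt r (φ q) : ℝ) else 0]
  refine Finset.sum_congr rfl fun x _ => ?_
  rw [D_snd, multAt_X, neg_mul, neg_neg]
  change _ = _ * ((if PassesThrough lineGerm (S.pt x) then 1 else 0 : ℕ) : ℝ)
  split_ifs <;> simp

open Classical in
theorem inter_D_excStrict {φ : S.Idx → Germ} {q : S.Idx} (h : IsCurvette (φ q) (S.pt q))
    (r : S.Idx) : S.inter (S.D φ q) (S.excStrict r) = if q = r then 1 else 0 := by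
  have h1 := h.proximity (S.pt r)
  rw [← S.sum_prefix q fun x => if x = S.pt r then (multAt x (φ q) : ℝ) else 0,
    ← S.sum_prefix q fun x => if Proximate x (S.pt r) then (multAt x (φ q) : ℝ) else 0] at h1
  rw [inter_excStrict]
  simp only [D_snd]
  rw [if_congr S.pt_injective.eq_iff rfl rfl] at h1
  rw [← h1, neg_neg, sub_eq_add_neg, ← Finset.sum_neg_distrib]
  congr 1
  · rw [Finset.sum_eq_single r]
    · simp
    · intro x _ hx
      rw [if_neg (S.pt_injective.ne hx), ite_self]
    · intro h
      exact absurd (Finset.mem_univ r) h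
  · refine Finset.sum_congr rfl fun x _ => ?_
    split_ifs <;> simp

theorem inter_lineClass_lineStrict : S.inter S.lineClass S.lineStrict = 1 := by
  simp [inter_lineStrict, lineClass_fst, lineClass_snd]

theorem inter_lineClass_excStrict (r : S.Idx) : S.inter S.lineClass (S.excStrict r) = 0 := by
  classical
  simp [inter_excStrict, lineClass_snd]

theorem eq_zero_of_inter {v : S.NS} (hL : S.inter v S.lineStrict = 0)
    (hE : ∀ r, S.inter v (S.excStrict r) = 0) : v = 0 := by
  classical
  have h2 : ∀ r, v.2 r = 0 := by
    have hN : ∀ r, (S.pt r).length ≤ ∑ x, (S.pt x).length := fun r =>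
      Finset.single_le_sum (f := fun x => (S.pt x).length) (fun _ _ => Nat.zero_le _)
        (Finset.mem_univ r)
    suffices H : ∀ n r, (∑ x, (S.pt x).length) - (S.pt r).length = n → v.2 r = 0 from
      fun r => H _ r rfl
    intro n
    induction n using Nat.strong_induction_on with
    | _ n ih =>
      intro r hr
      have h := hE r
      rw [inter_excStrict, Finset.sum_eq_zero, add_zero, neg_eq_zero] at h
      · exact h
      · intro x _
        split_ifs with hp
        · refine ih _ ?_ x rfl
          have := hp.length_lt
          have := hN x
          omega
        · rfl
  have h1 : v.1 = 0 := by
    rw [inter_lineStrict] at hL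
    simpa [h2] using hL
  exact Prod.ext h1 (funext h2)

/-- A class is determined by its intersections with the strict transforms of the line at infinity
and of the exceptional curves. -/
theorem ext_inter {v w : S.NS} (hL : S.inter v S.lineStrict = S.inter w S.lineStrict)
    (hE : ∀ r, S.inter v (S.excStrict r) = S.inter w (S.excStrict r)) : v = w := by
  refine sub_eq_zero.mp (S.eq_zero_of_inter ?_ fun r => ?_)
  · rw [map_sub, LinearMap.sub_apply, hL, sub_self]
  · rw [map_sub, LinearMap.sub_apply, hE, sub_self]

/-- The classes `D` form, together with the class of a line, the basis dual to the strict
transforms. -/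
theorem eq_sum_D {φ : S.Idx → Germ} (hφ : ∀ q, IsCurvette (φ q) (S.pt q)) (x : S.NS) :
    x = S.inter x S.lineStrict • S.lineClass + ∑ q, S.inter x (S.excStrict q) • S.D φ q := by
  classical
  refine S.ext_inter ?_ fun r => ?_
  · simp [inter_lineClass_lineStrict, S.inter_D_lineStrict (hφ _)]
  · simp [inter_lineClass_excStrict, S.inter_D_excStrict (hφ _), -Fintype.sum_sum_type]

theorem D_eq_of_curvette {φ ψ : S.Idx → Germ} {q : S.Idx} (h : IsCurvette (φ q) (S.pt q))
    (h' : IsCurvette (ψ q) (S.pt q)) : S.D φ q = S.D ψ q := by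
  classical
  refine S.ext_inter ?_ fun r => ?_
  · rw [S.inter_D_lineStrict h, S.inter_D_lineStrict h']
  · rw [S.inter_D_excStrict h, S.inter_D_excStrict h']

end Config

/-! ### Exponents of monomials under blowing up -/

/-- The monomial germ with the given exponents. -/
def monoE (e : Fin 2 → ℕ) : Germ := X 0 ^ e 0 * X 1 ^ e 1

/-- The exponents of the total transform at the point `t` of a monomial germ, after removing `μ`
times the exceptional curve. -/
def stepExp (e : Fin 2 → ℕ) (t : Dir) (μ : ℕ) : Fin 2 → ℕ :=
  open Classical in
  fun i => if i = excIdx t then e 0 + e 1 - μ else if t = axisDir i then e i else 0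

/-- The intersection multiplicity of a germ with a monomial germ. -/
def wt (e : Fin 2 → ℕ) (g : Germ) : ℕ∞ := e 0 * (axis 0 g).order + e 1 * (axis 1 g).order

theorem axisDir_zero : axisDir 0 = .inf := rfl

theorem axisDir_one : axisDir 1 = .fin 0 := rfl

theorem excIdx_axisDir_ne (i : Fin 2) : excIdx (axisDir i) ≠ i := by
  fin_cases i <;> decide

theorem stepExp_excIdx (e : Fin 2 → ℕ) (t : Dir) (μ : ℕ) :
    stepExp e t μ (excIdx t) = e 0 + e 1 - μ := by
  rw [stepExp, if_pos rfl]

theorem stepExp_axisDir (e : Fin 2 → ℕ) (i : Fin 2) (μ : ℕ) :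
    stepExp e (axisDir i) μ i = e i := by
  rw [stepExp, if_neg (excIdx_axisDir_ne i).symm, if_pos rfl]

theorem stepExp_of_ne {e : Fin 2 → ℕ} {t : Dir} {i : Fin 2} (μ : ℕ) (h : i ≠ excIdx t)
    (h' : t ≠ axisDir i) : stepExp e t μ i = 0 := by
  rw [stepExp, if_neg h, if_neg h']

theorem stepExp_inf (e : Fin 2 → ℕ) (μ : ℕ) :
    stepExp e .inf μ 0 = e 0 ∧ stepExp e .inf μ 1 = e 0 + e 1 - μ :=
  ⟨stepExp_axisDir e 0 μ, stepExp_excIdx e .inf μ⟩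

theorem stepExp_fin_zero (e : Fin 2 → ℕ) (μ : ℕ) :
    stepExp e (.fin 0) μ 0 = e 0 + e 1 - μ ∧ stepExp e (.fin 0) μ 1 = e 1 :=
  ⟨stepExp_excIdx e (.fin 0) μ, stepExp_axisDir e 1 μ⟩

theorem fin_ne_axisDir_one {c : ℂ} (hc : c ≠ 0) : Dir.fin c ≠ axisDir 1 :=
  fun h => hc (Dir.fin.inj h)

theorem stepExp_fin {c : ℂ} (hc : c ≠ 0) (e : Fin 2 → ℕ) (μ : ℕ) :
    stepExp e (.fin c) μ 0 = e 0 + e 1 - μ ∧ stepExp e (.fin c) μ 1 = 0 :=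
  ⟨stepExp_excIdx e (.fin c) μ, stepExp_of_ne μ (by decide : (1 : Fin 2) ≠ 0) (fin_ne_axisDir_one hc)⟩

theorem pull_monoE (e : Fin 2 → ℕ) (t : Dir) {μ : ℕ} (hμ : μ ≤ e 0 + e 1) :
    ∃ w, IsUnit w ∧ pull t (monoE e) = excEq t ^ μ * (w * monoE (stepExp e t μ)) := by
  obtain ⟨k, hk⟩ := Nat.exists_eq_add_of_le hμ
  have hk' : e 0 + e 1 - μ = k := by omega
  rw [monoE, map_mul, map_pow, map_pow, pull_X, pull_X]
  cases t with
  | inf =>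
    refine ⟨1, isUnit_one, ?_⟩
    rw [monoE, (stepExp_inf e μ).1, (stepExp_inf e μ).2, hk']
    change (X 0 * X 1) ^ e 0 * X 1 ^ e 1 = X 1 ^ μ * (1 * (X 0 ^ e 0 * X 1 ^ k))
    rw [mul_pow, mul_assoc, ← pow_add, hk, pow_add]
    ring
  | fin c =>
    by_cases hc : c = 0
    · subst hc
      refine ⟨1, isUnit_one, ?_⟩
      rw [monoE, (stepExp_fin_zero e μ).1, (stepExp_fin_zero e μ).2, hk']
      change X 0 ^ e 0 * (X 0 * (X 1 + C 0)) ^ e 1 = X 0 ^ μ * (1 * (X 0 ^ k * X 1 ^ e 1))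
      rw [map_zero, add_zero, mul_pow, ← mul_assoc, ← pow_add, hk, pow_add]
      ring
    · refine ⟨(X 1 + C c) ^ e 1, IsUnit.pow _ (by rw [isUnit_iff]; simpa using hc), ?_⟩
      rw [monoE, (stepExp_fin hc e μ).1, (stepExp_fin hc e μ).2, hk']
      change X 0 ^ e 0 * (X 0 * (X 1 + C c)) ^ e 1 =
        X 0 ^ μ * ((X 1 + C c) ^ e 1 * (X 0 ^ k * X 1 ^ 0))
      rw [mul_pow, ← mul_assoc, ← pow_add, hk, pow_add]
      ring

theorem mult_X_pow (i : Fin 2) (n : ℕ) : mult (X i ^ n : Germ) = n := by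
  induction n with
  | zero => rw [pow_zero]; exact mult_eq_zero_of_isUnit isUnit_one
  | succ n ih => rw [pow_succ, mult_mul (pow_ne_zero _ (X_ne_zero i)) (X_ne_zero i), ih, mult_X]

theorem monoE_ne_zero (e : Fin 2 → ℕ) : monoE e ≠ 0 :=
  mul_ne_zero (pow_ne_zero _ (X_ne_zero 0)) (pow_ne_zero _ (X_ne_zero 1))

theorem mult_unit_mul_monoE {w : Germ} (hw : IsUnit w) (e : Fin 2 → ℕ) :
    mult (w * monoE e) = e 0 + e 1 := by
  rw [mult_mul hw.ne_zero (monoE_ne_zero e), mult_eq_zero_of_isUnit hw, zero_add, monoE,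
    mult_mul (pow_ne_zero _ (X_ne_zero 0)) (pow_ne_zero _ (X_ne_zero 1)), mult_X_pow, mult_X_pow]

theorem divExc_excEq_pow_mul (t : Dir) (m : ℕ) (h : Germ) : divExc t m (excEq t ^ m * h) = h := by
  have key : ∀ i j, cf (divExc t m (excEq t ^ m * h)) i j = cf h i j := by
    intro i j
    cases t with
    | fin c =>
      change coeff (ex i j + Finsupp.single 0 m) (X 0 ^ m * h) = _
      rw [single_zero_eq_ex, ex_add, add_zero]
      change cf (X 0 ^ m * h) _ _ = _
      rw [cf_X_zero_pow_mul, if_pos (Nat.le_add_left _ _), Nat.add_sub_cancel]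
    | inf =>
      change coeff (ex i j + Finsupp.single 1 m) (X 1 ^ m * h) = _
      rw [single_one_eq_ex, ex_add, add_zero]
      change cf (X 1 ^ m * h) _ _ = _
      rw [cf_X_one_pow_mul, if_pos (Nat.le_add_left _ _), Nat.add_sub_cancel]
  exact ext_cf key

/-- Noether's formula for the intersection of a branch with a monomial germ, for a single
blow-up. -/
theorem wt_eq {φ : Germ} {t : Dir} (hφ : Irreducible φ) (ht : constantCoeff (strictStep φ t) = 0)
    {e : Fin 2 → ℕ} {μ : ℕ} (hμ : μ ≤ e 0 + e 1) :
    wt e φ = μ * mult φ + wt (stepExp e t μ) (strictStep φ t) := by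
  obtain ⟨k, hk⟩ := Nat.exists_eq_add_of_le hμ
  have hk' : e 0 + e 1 - μ = k := by omega
  have hkc : (e 0 : ℕ∞) + e 1 = μ + k := by exact_mod_cast hk
  have hE := order_axis_strictStep hφ ht
  have hax : ∀ i, t ≠ axisDir i → (axis i φ).order = mult φ := fun i hi =>
    order_axis_of_not_passes fun h => hi (dir_unique hφ h ht)
  rw [wt, wt]
  cases t with
  | inf =>
    have hE' : (axis 1 (strictStep φ .inf)).order = mult φ := hE
    rw [(stepExp_inf e μ).1, (stepExp_inf e μ).2, hk', hE', order_axis 0,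
      hax 1 (fun h => Dir.noConfusion h), axisDir_zero]
    calc _ = ((e 0 : ℕ∞) + e 1) * mult φ + e 0 * (axis 0 (strictStep φ .inf)).order := by ring
      _ = _ := by rw [hkc]; ring
  | fin c =>
    have hE' : (axis 0 (strictStep φ (.fin c))).order = mult φ := hE
    by_cases hc : c = 0
    · subst hc
      rw [(stepExp_fin_zero e μ).1, (stepExp_fin_zero e μ).2, hk', hE', order_axis 1,
        hax 0 (fun h => Dir.noConfusion h), axisDir_one]
      calc _ = ((e 0 : ℕ∞) + e 1) * mult φ + e 1 * (axis 1 (strictStep φ (.fin 0))).order := by ring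
        _ = _ := by rw [hkc]; ring
    · rw [(stepExp_fin hc e μ).1, (stepExp_fin hc e μ).2, hk', hE',
        hax 0 (fun h => Dir.noConfusion h), hax 1 (fin_ne_axisDir_one hc)]
      calc _ = ((e 0 : ℕ∞) + e 1) * mult φ := by ring
        _ = _ := by rw [hkc, Nat.cast_zero]; ring

/-! ### Composite blow-ups and arcs -/

/-- The total transform at an infinitely near point. -/
def pullAt (q : Pt) : Germ →ₐ[ℂ] Germ := q.foldl (fun f t => (pull t).comp f) (AlgHom.id ℂ Germ)

theorem pullAt_nil (g : Germ) : pullAt [] g = g := rfl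

theorem pullAt_concat (q : Pt) (t : Dir) (g : Germ) :
    pullAt (q ++ [t]) g = pull t (pullAt q g) := by
  rw [pullAt, List.foldl_append]
  rfl

/-- The pull-back to the arc `u = v = s`. -/
def arc : Germ →ₐ[ℂ] PowerSeries ℂ := (axis 1).comp (pull (.fin 1))

theorem arc_X (i : Fin 2) : arc (X i) = PowerSeries.X := by
  change axis 1 (pull (.fin 1) (X i)) = _
  rw [pull_X]
  fin_cases i
  · exact axis_X_of_ne (by decide)
  · change axis 1 (X 0 * (X 1 + C 1)) = _
    rw [map_mul, map_add, axis_X_self, axis_X_of_ne (by decide), map_one, map_one, zero_add,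
      mul_one]

theorem X_pow_mult_dvd_arc (g : Germ) : PowerSeries.X ^ mult g ∣ arc g := by
  change _ ∣ axis 1 (pull (.fin 1) g)
  rw [pull_eq, map_mul, map_pow]
  have : axis 1 (excEq (.fin 1)) = PowerSeries.X := axis_X_of_ne (by decide)
  rw [this]
  exact dvd_mul_right _ _

theorem arc_monoE (e : Fin 2 → ℕ) : arc (monoE e) = PowerSeries.X ^ (e 0 + e 1) := by
  rw [monoE, map_mul, map_pow, map_pow, arc_X, arc_X, pow_add]

/-- The germ at infinity, as an algebra homomorphism. -/
def germHom : MvPolynomial (Fin 3) ℂ →ₐ[ℂ] Germ :=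
  (MvPolynomial.coeToMvPowerSeries.algHom ℂ).comp
    (MvPolynomial.aeval ![1, MvPolynomial.X 1, MvPolynomial.X 0])

theorem germHom_apply (G : MvPolynomial (Fin 3) ℂ) : germHom G = germAt G := by
  simp [germHom, germAt, MvPolynomial.coeToMvPowerSeries.algHom_apply]

theorem map_germAt {A : Type*} [CommRing A] [Algebra ℂ A] (ψ : Germ →ₐ[ℂ] A)
    (G : MvPolynomial (Fin 3) ℂ) :
    ψ (germAt G) = MvPolynomial.aeval ![1, ψ (X 1), ψ (X 0)] G := by
  rw [← germHom_apply, ← AlgHom.comp_apply]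
  congr 1
  refine MvPolynomial.algHom_ext fun i => ?_
  rw [AlgHom.comp_apply, germHom_apply, MvPolynomial.aeval_X]
  fin_cases i <;> simp [germAt]

theorem germAt_member (F : MvPolynomial (Fin 3) ℂ) (d : ℕ) (c : ℂ) :
    germAt (member F d c) = germAt F + C c * X 0 ^ d := by
  rw [member, ← germHom_apply, map_add, map_mul, map_pow, germHom_apply, germHom_apply,
    germHom_apply, germAt_C]
  congr 3
  simp [germAt]

theorem germAt_X_two_pow (d : ℕ) : germAt (MvPolynomial.X 2 ^ d) = X 0 ^ d := by
  rw [← germHom_apply, map_pow, germHom_apply]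
  congr 1
  simp [germAt]

theorem OnePlaceAtInfinity.one_le {F : MvPolynomial (Fin 3) ℂ} {d : ℕ}
    (hF : OnePlaceAtInfinity F d) : 1 ≤ d := by
  by_contra! h
  obtain rfl : d = 0 := by omega
  obtain ⟨c, hc⟩ : ∃ c, F = MvPolynomial.C c := by
    refine ⟨F.coeff 0, MvPolynomial.totalDegree_eq_zero_iff_eq_C.mp ?_⟩
    exact Nat.le_zero.mp hF.homogeneous.totalDegree_le
  have h1 := hF.integral
  rw [hc] at h1
  have hc0 : c ≠ 0 := by
    rintro rfl
    rw [map_zero] at h1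
    exact not_irreducible_zero h1
  exact h1.not_isUnit (hc0.isUnit.map MvPolynomial.C)

/-- The curve meets the line at infinity with multiplicity `d` at `p`. -/
theorem OnePlaceAtInfinity.order_axis_zero {F : MvPolynomial (Fin 3) ℂ} {d : ℕ}
    (hF : OnePlaceAtInfinity F d) : (axis 0 (germAt F)).order = d := by
  have hc := hF.eval_ne_zero
  obtain ⟨hd0, hc0⟩ := natDegree_aeval_form_le hF.homogeneous (1 : ℂ) 0
  obtain ⟨P, hP⟩ : ∃ P, P = (MvPolynomial.aeval ![Polynomial.C 1, Polynomial.X, Polynomial.C 0] F :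
    Polynomial ℂ) := ⟨_, rfl⟩
  rw [← hP] at hd0 hc0
  have hdeg : P.natDegree = d :=
    Polynomial.natDegree_eq_of_le_of_coeff_ne_zero hd0 (by rw [hc0]; exact hc)
  have hroots : P.roots = Multiset.replicate d 0 := by
    rw [Multiset.eq_replicate]
    constructor
    · rw [← (IsAlgClosed.splits P).natDegree_eq_card_roots, hdeg]
    · intro y hy
      have h1 := (Polynomial.mem_roots'.mp hy).2
      rw [hP, Polynomial.IsRoot, eval_aeval_form] at h1
      refine (hF.meets ![1, y, 0] (fun h => by simpa using congrFun h 0) rfl).mp ?_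
      simpa [MvPolynomial.aeval_eq_eval] using h1
  have hPe : P = Polynomial.C P.leadingCoeff * Polynomial.X ^ d := by
    conv_lhs => rw [(IsAlgClosed.splits P).eq_prod_roots, hroots]
    simp
  have hax : axis 0 (germAt F) = Polynomial.aeval (PowerSeries.X : PowerSeries ℂ) P := by
    rw [hP, map_germAt, axis_X_self, axis_X_of_ne (by decide), MvPolynomial.comp_aeval_apply]
    congr 2
    funext i
    fin_cases i <;> simp
  have hl : P.leadingCoeff ≠ 0 := by
    rw [Polynomial.leadingCoeff, hdeg, hc0]
    exact hc
  rw [hax, hPe, map_mul, map_pow, Polynomial.aeval_X, Polynomial.aeval_C, PowerSeries.order_mul,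
    PowerSeries.order_X_pow, PowerSeries.order_zero_of_unit (hl.isUnit.map _), zero_add]

/-! ### Smooth branches -/

theorem irreducible_of_mult_eq_one {g : Germ} (h : mult g = 1) : Irreducible g := by
  have h0 : g ≠ 0 := by
    rintro rfl
    simp [mult] at h
  refine ⟨fun hu => ?_, fun {a b} hab => ?_⟩
  · rw [mult_eq_zero_of_isUnit hu] at h
    exact zero_ne_one h
  · subst hab
    have ha := left_ne_zero_of_mul h0
    have hb := right_ne_zero_of_mul h0
    rw [mult_mul ha hb] at h
    rw [isUnit_iff, isUnit_iff, ← mult_eq_zero_iff ha, ← mult_eq_zero_iff hb]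
    omega

theorem multAt_of_mult_eq_one {g : Germ} {q : Pt} (h : mult g = 1) (hq : PassesThrough g q) :
    multAt q g = 1 := by
  induction q generalizing g with
  | nil => exact h
  | cons t q ih =>
    have hirr := irreducible_of_mult_eq_one h
    have h1 : PassesThrough g [t] := PassesThrough.of_append (q := [t]) hq
    refine ih ?_ hq
    have h2 := mult_le_order_axis (excIdx t) (strictStep g t)
    rw [order_axis_strictStep hirr h1, h] at h2
    have h3 := mult_pos_of_not_isUnit (strictStep_ne_zero hirr.ne_zero t)
      (by rw [isUnit_iff, not_not]; exact h1)
    have h4 : mult (strictStep g t) ≤ 1 := by exact_mod_cast h2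
    omega

theorem ne_axisDir_of_order_axis {g : Germ} {t : Dir} {i : Fin 2} (h : (axis i g).order = 1)
    (hm : mult g = 1) (ht : constantCoeff (strictStep g t) = 0) : t ≠ axisDir i := by
  rintro rfl
  rw [order_axis, hm] at h
  have hg := (irreducible_of_mult_eq_one hm).ne_zero
  have h1 := mult_pos_of_not_isUnit (strictStep_ne_zero hg (axisDir i))
      (by rw [isUnit_iff, not_not]; exact ht)
  have h2 : (1 : ℕ∞) ≤ (axis i (strictStep g (axisDir i))).order :=
    le_trans (by exact_mod_cast h1) (mult_le_order_axis i _)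
  have h5 : ((1 : ℕ) : ℕ∞) + 1 ≤ 1 := by
    conv_rhs => rw [← h]
    exact add_le_add_right h2 _
  exact absurd h5 (by decide)

theorem constantCoeff_unit_mul_monoE {w : Germ} (hw : IsUnit w) (e : Fin 2 → ℕ) :
    constantCoeff (w * monoE e) = 0 ↔ 0 < e 0 + e 1 := by
  have h := mult_eq_zero_iff (mul_ne_zero hw.ne_zero (monoE_ne_zero e))
  rw [mult_unit_mul_monoE hw] at h
  rw [Nat.pos_iff_ne_zero, ne_eq, h, not_not]

/-! ### The pencil at its base points -/

theorem pencilAt_concat (F : MvPolynomial (Fin 3) ℂ) (d : ℕ) (q : Pt) (t : Dir) :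
    pencilAt F d (q ++ [t]) = pencilStep (pencilAt F d q) t := by
  rw [pencilAt, List.foldl_append]
  rfl

/-- The local shape of the pencil spanned by `F` and `Z ^ d` at the point `q`: the first member is
the strict transform of the curve, the second one is a monomial germ with exponents `e` (up to a
unit), and the total transform of the line at infinity is a monomial germ with exponents `A`. The
conditions are preserved by blowing up a point of the curve (`PencilShape.concat`). -/
structure PencilShape (F : MvPolynomial (Fin 3) ℂ) (d : ℕ) (q : Pt) (e A : Fin 2 → ℕ) : Prop where
  passes : PassesThrough (germAt F) q
  fst : (pencilAt F d q).1 = strictAt q (germAt F)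
  snd : ∃ w, IsUnit w ∧ (pencilAt F d q).2 = w * monoE e
  line_total : ∃ w, IsUnit w ∧ pullAt q (X 0) = w * monoE A
  /-- the pencil at `q` is proportional to the total transform of the pencil -/
  rel : pullAt q (germAt F) * (pencilAt F d q).2 =
    pullAt q (X 0) ^ d * strictAt q (germAt F)
  /-- the axes through `q` contained in the two monomial germs are the same -/
  pos_iff : ∀ i, 0 < e i ↔ 0 < A i
  /-- these axes include the strict transform of the line at infinity -/
  line : ∀ i, strictAt q (X 0) = X i → 0 < A i
  /-- these axes include the strict transforms of the exceptional curves -/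
  exc : ∀ r s q' i, q = r ++ s :: q' → strictAt q' (excEq s) = X i → 0 < A i
  /-- the strict transform of the curve meets the total transform of the line at infinity with
  multiplicity `d` -/
  weight : wt A (strictAt q (germAt F)) = d
  /-- Noether's formula for the intersection of a branch with `Z ^ d` -/
  noether : ∀ φ, Irreducible φ → PassesThrough φ q → d * (axis 0 φ).order =
    ((∑ ℓ ∈ Finset.range q.length, multAt (q.take ℓ) (germAt F) * multAt (q.take ℓ) φ : ℕ) : ℕ∞) +
      wt e (strictAt q φ)
  /-- the strict transforms of the members of the pencil are the members of its transform -/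
  member : ∀ c, strictAt q (germAt (member F d c)) =
    strictAt q (germAt F) + C c * (pencilAt F d q).2
  member_mult : ∀ c, ∀ ℓ < q.length,
    multAt (q.take ℓ) (germAt (PencilCone.member F d c)) = multAt (q.take ℓ) (germAt F)

variable {F : MvPolynomial (Fin 3) ℂ} {d : ℕ}

theorem X_eq_iff {i j : Fin 2} : (X i : Germ) = X j ↔ i = j := X_inj

theorem PencilShape.nil (hF : OnePlaceAtInfinity F d) : PencilShape F d [] ![d, 0] ![1, 0] where
  passes := by
    have h := hF.unibranch.not_isUnit
    rw [isUnit_iff, not_not] at h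
    exact h
  fst := rfl
  snd := ⟨1, isUnit_one, by
    change germAt (MvPolynomial.X 2 ^ d) = _
    rw [germAt_X_two_pow]
    simp [monoE]⟩
  line_total := ⟨1, isUnit_one, by
    rw [pullAt_nil]
    simp [monoE]⟩
  rel := by
    change germAt F * germAt (MvPolynomial.X 2 ^ d) = X 0 ^ d * germAt F
    rw [germAt_X_two_pow, mul_comm]
  pos_iff := by
    intro i
    have := hF.one_le
    fin_cases i
    · simp only [Fin.zero_eta, Matrix.cons_val_zero]
      omega
    · simp
  line := by
    intro i h
    obtain rfl := X_eq_iff.mp h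
    simp
  exc := by
    intro r s q' i h
    simp at h
  weight := by
    rw [strictAt_nil, wt, hF.order_axis_zero]
    simp
  noether := by
    intro φ _ _
    simp [wt, strictAt_nil]
  member := by
    intro c
    change germAt (PencilCone.member F d c) = germAt F + C c * germAt (MvPolynomial.X 2 ^ d)
    rw [germAt_member, germAt_X_two_pow]
  member_mult := by
    intro c ℓ h
    simp at h

theorem PencilShape.pos_of_isBasePoint {q : Pt} {e A : Fin 2 → ℕ}
    (h : PencilShape F d q e A) (hq : IsBasePoint F d q) : 0 < e 0 + e 1 := by
  obtain ⟨w, hw, hg⟩ := h.snd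
  have := hq.2
  rwa [hg, constantCoeff_unit_mul_monoE hw] at this

/-- At a base point where the multiplicity of the curve is at least that of the monomial member of
the pencil, the curve is smooth and transversal to the only axis contained in that member. Indeed
`F / Z ^ d` has no pole along the arc `u = v = s` at this point, so that `d ≤ A 0 + A 1` by Moh's
inequality. On the other hand the curve, of multiplicity `m`, meets the total transform of the line
with multiplicity `d ≥ (A 0 + A 1) * m`. -/
theorem PencilShape.transversal (hF : OnePlaceAtInfinity F d) {q : Pt} {e A : Fin 2 → ℕ}
    (h : PencilShape F d q e A) (he : 0 < e 0 + e 1) (hm : e 0 + e 1 ≤ multAt q (germAt F)) :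
    multAt q (germAt F) = 1 ∧ ∃ i, e i = 1 ∧ e (oth i) = 0 ∧
      (axis i (strictAt q (germAt F))).order = 1 := by
  have hA : 1 ≤ A 0 + A 1 := by
    rcases Nat.eq_zero_or_pos (e 0) with h0 | h0
    · have := (h.pos_iff 1).mp (by omega)
      omega
    · have := (h.pos_iff 0).mp h0
      omega
  have hd : d ≤ A 0 + A 1 := by
    obtain ⟨w, hw, hg⟩ := h.snd
    obtain ⟨w', hw', hL⟩ := h.line_total
    obtain ⟨Z, hZ⟩ := X_pow_mult_dvd_arc (strictAt q (germAt F))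
    obtain ⟨k, hk⟩ := Nat.exists_eq_add_of_le hm
    have hk' : mult (strictAt q (germAt F)) = e 0 + e 1 + k := hk
    obtain ⟨v, hv⟩ := (hw.map arc).exists_right_inv
    have hU : (arc (pullAt q (X 0))).order = (A 0 + A 1 : ℕ) := by
      rw [hL, map_mul, arc_monoE, PowerSeries.order_mul, PowerSeries.order_X_pow,
        PowerSeries.order_zero_of_unit (hw'.map arc), zero_add]
    refine hF.degree_le_order (U := arc (pullAt q (X 0))) (V := arc (pullAt q (X 1)))
      (W := v * (PowerSeries.X ^ k * Z)) hA hU ?_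
    have h1 := map_germAt (arc.comp (pullAt q)) F
    simp only [AlgHom.comp_apply] at h1
    rw [← h1]
    have h2 := congrArg arc h.rel
    rw [map_mul, map_mul, map_pow, hg, map_mul, arc_monoE, hZ, hk', pow_add] at h2
    have hX : (PowerSeries.X : PowerSeries ℂ) ^ (e 0 + e 1) ≠ 0 :=
      pow_ne_zero _ PowerSeries.X_ne_zero
    refine mul_right_cancel₀ hX ?_
    linear_combination v * h2 - (arc (pullAt q (germAt F)) * PowerSeries.X ^ (e 0 + e 1)) * hv
  have hw := h.weight
  rw [wt] at hw
  have hle : ∀ i, ((multAt q (germAt F) : ℕ) : ℕ∞) ≤ (axis i (strictAt q (germAt F))).order :=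
    fun i => mult_le_order_axis i _
  have h1 : ((A 0 + A 1 : ℕ) : ℕ∞) * multAt q (germAt F) ≤ d := by
    rw [← hw, Nat.cast_add, add_mul]
    exact add_le_add (mul_le_mul_right (hle 0) _) (mul_le_mul_right (hle 1) _)
  norm_cast at h1
  have hm1 : multAt q (germAt F) = 1 := by
    have h2 : (A 0 + A 1) * multAt q (germAt F) ≤ (A 0 + A 1) * 1 := by omega
    have := Nat.le_of_mul_le_mul_left h2 hA
    omega
  have h2 : d = A 0 + A 1 := by
    rw [hm1] at h1
    omega
  refine ⟨hm1, ?_⟩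
  have key : ∀ n : ℕ, 0 < n → ∀ o : ℕ∞, (n : ℕ∞) * o = n → o = 1 := by
    intro n hn o ho
    cases o with
    | top =>
      rw [ENat.mul_top (by exact_mod_cast hn.ne')] at ho
      exact absurd ho (ENat.top_ne_natCast n)
    | coe m =>
      norm_cast at ho ⊢
      exact Nat.eq_of_mul_eq_mul_left hn (by omega)
  have h3 : e 0 = 1 ∧ e 1 = 0 ∨ e 0 = 0 ∧ e 1 = 1 := by omega
  rcases h3 with ⟨h3, h4⟩ | ⟨h3, h4⟩
  · refine ⟨0, h3, h4, ?_⟩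
    have h5 : A 1 = 0 := by
      have := h.pos_iff 1
      omega
    rw [h5, h2, h5] at hw
    refine key (A 0) (by omega) _ ?_
    simpa using hw
  · refine ⟨1, h4, h3, ?_⟩
    have h5 : A 0 = 0 := by
      have := h.pos_iff 0
      omega
    rw [h5, h2, h5] at hw
    refine key (A 1) (by omega) _ ?_
    simpa using hw

/-- As long as the curve has the smaller multiplicity, the transform of the pencil consists of its
strict transform and of a monomial germ. -/
theorem PencilShape.pencil_concat {q : Pt} {e A : Fin 2 → ℕ} (h : PencilShape F d q e A)
    (t : Dir) (hm : multAt q (germAt F) ≤ e 0 + e 1) :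
    (pencilAt F d (q ++ [t])).1 = strictAt (q ++ [t]) (germAt F) ∧
    pull t (pencilAt F d q).2 =
      excEq t ^ multAt q (germAt F) * (pencilAt F d (q ++ [t])).2 ∧
    ∃ w, IsUnit w ∧ (pencilAt F d (q ++ [t])).2 =
      w * monoE (stepExp e t (multAt q (germAt F))) := by
  obtain ⟨w, hw, hg⟩ := h.snd
  have hmin : min (mult (pencilAt F d q).1) (mult (pencilAt F d q).2) = multAt q (germAt F) := by
    rw [h.fst, hg, mult_unit_mul_monoE hw]
    exact min_eq_left hm
  have h2 : (pencilAt F d (q ++ [t])).2 =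
      divExc t (multAt q (germAt F)) (pull t (pencilAt F d q).2) := by
    rw [pencilAt_concat, pencilStep, hmin, totalTransform_eq, totalTransform_eq]
  obtain ⟨w', hw', hp⟩ := pull_monoE e t hm
  have h3 : pull t (pencilAt F d q).2 = excEq t ^ multAt q (germAt F) *
      (pull t w * w' * monoE (stepExp e t (multAt q (germAt F)))) := by
    rw [hg, map_mul, hp]
    ring
  rw [h3, divExc_excEq_pow_mul] at h2
  refine ⟨?_, by rw [h2, h3], _, (hw.map (pull t)).mul hw', h2⟩
  rw [pencilAt_concat, pencilStep, hmin, h.fst, strictAt_concat]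
  rfl

theorem stepExp_pos_iff {q : Pt} {e A : Fin 2 → ℕ} (h : PencilShape F d q e A) {μ : ℕ}
    (hm : μ < e 0 + e 1) (t : Dir) (i : Fin 2) :
    0 < stepExp e t μ i ↔ 0 < stepExp A t 0 i := by
  by_cases hi : i = excIdx t
  · rw [hi, stepExp_excIdx, stepExp_excIdx]
    have h0 := h.pos_iff 0
    have h1 := h.pos_iff 1
    omega
  · by_cases ht : t = axisDir i
    · rw [ht, stepExp_axisDir, stepExp_axisDir]
      exact h.pos_iff i
    · rw [stepExp_of_ne _ hi ht, stepExp_of_ne _ hi ht]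

theorem stepExp_pos_of_strictStep {A : Fin 2 → ℕ} {g : Germ} {t : Dir} {i : Fin 2}
    (hg : ∀ i, g = X i → 0 < A i) (hgX : IsUnit g ∨ ∃ j, g = X j)
    (h : strictStep g t = X i) : 0 < stepExp A t 0 i := by
  have hX : ¬ IsUnit (X i : Germ) := by rw [isUnit_iff]; simp
  rcases hgX with hu | ⟨j, rfl⟩
  · exact absurd (h ▸ isUnit_strictStep hu t) hX
  · by_cases ht : t = axisDir j
    · subst ht
      rw [strictStep_X_axisDir] at h
      obtain rfl := X_eq_iff.mp h
      rw [stepExp_axisDir]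
      exact hg _ rfl
    · exact absurd (h ▸ isUnit_strictStep_X ht) hX

theorem isUnit_or_eq_X_strictAt (i : Fin 2) (q : Pt) :
    IsUnit (strictAt q (X i)) ∨ ∃ j, strictAt q (X i) = X j := by
  by_cases h : PassesThrough (X i) q
  · exact Or.inr ⟨i, strictAt_X h⟩
  · exact Or.inl (not_passesThrough_iff.mp h)

theorem PencilShape.concat (hF : OnePlaceAtInfinity F d) {q : Pt} {e A : Fin 2 → ℕ}
    (h : PencilShape F d q e A) {t : Dir} (ht : PassesThrough (germAt F) (q ++ [t]))
    (hm : multAt q (germAt F) < e 0 + e 1) :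
    PencilShape F d (q ++ [t]) (stepExp e t (multAt q (germAt F))) (stepExp A t 0) := by
  obtain ⟨h1, h2, h3⟩ := h.pencil_concat t hm.le
  have hirr := irreducible_strictAt hF.unibranch h.passes
  have ht' : constantCoeff (strictStep (strictAt q (germAt F)) t) = 0 := by
    rw [← strictAt_concat]; exact ht
  have hpull : pull t (strictAt q (germAt F)) =
      excEq t ^ multAt q (germAt F) * strictAt (q ++ [t]) (germAt F) := by
    rw [pull_eq, strictAt_concat]
    rfl
  have hE : excEq t ^ multAt q (germAt F) ≠ 0 := pow_ne_zero _ (excEq_ne_zero t)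
  have htake : ∀ ℓ < q.length, (q ++ [t]).take ℓ = q.take ℓ := fun ℓ hℓ =>
    List.take_append_of_le_length hℓ.le
  have htake' : (q ++ [t]).take q.length = q := by simp
  -- the multiplicity of a member of the pencil
  have hmem : ∀ c, multAt q (germAt (PencilCone.member F d c)) = multAt q (germAt F) ∧
      strictAt (q ++ [t]) (germAt (PencilCone.member F d c)) =
        strictAt (q ++ [t]) (germAt F) + C c * (pencilAt F d (q ++ [t])).2 := by
    intro c
    rw [strictAt_concat q t (germAt (PencilCone.member F d c)), multAt, h.member c]
    refine mult_and_strictStep_of_pull_eq ?_ ?_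
    · rw [map_add, map_mul, map_C_eq, hpull, h2]
      ring
    · obtain ⟨w, -, hw⟩ := h3
      have h0 : axis (excIdx t) (pencilAt F d (q ++ [t])).2 = 0 := by
        rw [axis_eq_zero_iff, hw]
        refine Dvd.dvd.mul_left ?_ w
        have h5 : 0 < stepExp e t (multAt q (germAt F)) (excIdx t) := by
          rw [stepExp_excIdx]
          omega
        rw [monoE]
        generalize excIdx t = i at h5 ⊢
        fin_cases i
        · exact (dvd_pow_self _ h5.ne').mul_right _
        · exact (dvd_pow_self _ h5.ne').mul_left _
      rw [map_add, map_mul, h0, mul_zero, add_zero, strictAt_concat]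
      exact axis_strictStep_ne_zero hirr.ne_zero t
  refine
    { passes := ht
      fst := h1
      snd := h3
      line_total := ?_
      rel := ?_
      pos_iff := stepExp_pos_iff h hm t
      line := ?_
      exc := ?_
      weight := ?_
      noether := ?_
      member := fun c => (hmem c).2
      member_mult := ?_ }
  · obtain ⟨w, hw, hL⟩ := h.line_total
    obtain ⟨w', hw', hp⟩ := pull_monoE A t (Nat.zero_le _)
    refine ⟨pull t w * w', (hw.map (pull t)).mul hw', ?_⟩
    rw [pullAt_concat, hL, map_mul, hp, pow_zero, one_mul, mul_assoc]
  · have h4 := congrArg (pull t) h.rel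
    rw [map_mul, map_mul, map_pow, h2, hpull] at h4
    rw [pullAt_concat, pullAt_concat]
    refine mul_left_cancel₀ hE ?_
    linear_combination h4
  · intro i hi
    rw [strictAt_concat] at hi
    exact stepExp_pos_of_strictStep h.line (isUnit_or_eq_X_strictAt 0 q) hi
  · intro r s q' i hq hi
    rcases List.eq_nil_or_concat q' with rfl | ⟨q'', t', rfl⟩
    · obtain ⟨rfl, h5⟩ := List.append_inj' hq rfl
      obtain rfl := List.singleton_inj.mp h5
      rw [strictAt_nil, excEq] at hi
      obtain rfl := X_eq_iff.mp hi
      rw [stepExp_excIdx, Nat.sub_zero]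
      have h0 := h.pos_iff 0
      have h1 := h.pos_iff 1
      omega
    · rw [List.concat_eq_append] at hq hi
      have h5 : q ++ [t] = (r ++ s :: q'') ++ [t'] := by rw [hq]; simp
      obtain ⟨rfl, h6⟩ := List.append_inj' h5 rfl
      obtain rfl := List.singleton_inj.mp h6
      rw [strictAt_concat] at hi
      exact stepExp_pos_of_strictStep (fun i hi => h.exc r s q'' i rfl hi)
        (isUnit_or_eq_X_strictAt _ q'') hi
  · have h4 := h.weight
    rw [wt_eq hirr ht' (Nat.zero_le _), Nat.cast_zero, zero_mul, zero_add] at h4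
    rw [strictAt_concat]
    exact h4
  · intro φ hφ hφq
    have h5 : constantCoeff (strictStep (strictAt q φ) t) = 0 := by
      rw [← strictAt_concat]; exact hφq
    rw [h.noether φ hφ hφq.of_append,
      wt_eq (irreducible_strictAt hφ hφq.of_append) h5 hm.le, List.length_append,
      List.length_singleton, Finset.sum_range_succ, strictAt_concat, htake', Nat.cast_add,
      Nat.cast_mul (multAt q (germAt F)), add_assoc]
    congr 2
    refine Finset.sum_congr rfl fun ℓ hℓ => ?_
    rw [htake ℓ (Finset.mem_range.mp hℓ)]
  · intro c ℓ hℓ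
    rw [List.length_append, List.length_singleton] at hℓ
    rcases Nat.lt_succ_iff_lt_or_eq.mp hℓ with hℓ | rfl
    · rw [htake ℓ hℓ]
      exact h.member_mult c ℓ hℓ
    · rw [htake']
      exact (hmem c).1

/-- At a base point which is followed by another one, the multiplicity of the curve is smaller
than that of the monomial member of the pencil: otherwise the curve would be smooth and transversal
to the monomial member, and the pencil would have no base point after the blow-up. -/
theorem PencilShape.mult_lt (hF : OnePlaceAtInfinity F d) {q : Pt} {e A : Fin 2 → ℕ}
    (h : PencilShape F d q e A) (he : 0 < e 0 + e 1) {t : Dir}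
    (ht : IsBasePoint F d (q ++ [t])) : multAt q (germAt F) < e 0 + e 1 := by
  by_contra! hm
  obtain ⟨hm1, i, hi, hi', ho⟩ := h.transversal hF he hm
  have hle : multAt q (germAt F) ≤ e 0 + e 1 := by omega
  obtain ⟨h1, -, w, hw, h3⟩ := h.pencil_concat t hle
  obtain ⟨hb1, hb2⟩ := ht
  rw [h1, strictAt_concat] at hb1
  have ht : t ≠ axisDir i := ne_axisDir_of_order_axis ho hm1 hb1
  rw [h3, map_mul] at hb2
  have h6 : ∀ j, stepExp e t (multAt q (germAt F)) j = 0 := by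
    intro j
    by_cases hj : j = excIdx t
    · rw [hj, stepExp_excIdx, hm1]
      have : e 0 + e 1 = 1 := by omega
      omega
    · by_cases htj : t = axisDir j
      · rw [htj, stepExp_axisDir]
        have hji : j ≠ i := fun h => ht (h ▸ htj)
        have : j = oth i := by
          fin_cases i <;> fin_cases j <;> simp_all [oth]
        rw [this, hi']
      · exact stepExp_of_ne _ hj htj
  rw [monoE, h6, h6] at hb2
  rw [isUnit_iff] at hw
  simp at hb2
  exact hw hb2

namespace Config

variable (S : Config)

/-! ### The base points of the pencil of a configuration -/

theorem exists_shape {q : Pt} (hq : q <+: S.last) : ∃ e A, PencilShape S.F S.d q e A := by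
  induction q using List.reverseRecOn with
  | nil => exact ⟨_, _, PencilShape.nil S.onePlace⟩
  | append_singleton q t ih =>
    have hq' : q <+: S.last := (List.prefix_append q [t]).trans hq
    obtain ⟨e, A, h⟩ := ih hq'
    have hb := (S.base _).mpr hq
    have hlt := h.mult_lt S.onePlace (h.pos_of_isBasePoint ((S.base _).mpr hq')) hb
    refine ⟨_, _, h.concat S.onePlace ?_ hlt⟩
    have h1 := hb.1
    rw [(h.pencil_concat t hlt.le).1] at h1
    exact h1

/-- At the last base point, the curve is smooth and transversal to the only axis of the monomial
member of the pencil. -/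
theorem exists_shape_last : ∃ e A i, PencilShape S.F S.d S.last e A ∧
    multAt S.last (germAt S.F) = 1 ∧ e i = 1 ∧ e (oth i) = 0 ∧
    (axis i (strictAt S.last (germAt S.F))).order = 1 := by
  obtain ⟨e, A, h⟩ := S.exists_shape List.prefix_rfl
  have hm : e 0 + e 1 ≤ multAt S.last (germAt S.F) := by
    by_contra! hlt
    obtain ⟨t, ht⟩ := exists_passes (one_le_multAt S.onePlace.unibranch.ne_zero h.passes)
    have h1 := h.concat S.onePlace (t := t) (by rw [PassesThrough, strictAt_concat]; exact ht) hlt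
    have hb : IsBasePoint S.F S.d (S.last ++ [t]) := by
      refine ⟨by rw [h1.fst]; exact h1.passes, ?_⟩
      obtain ⟨w, hw, hg⟩ := h1.snd
      rw [hg, constantCoeff_unit_mul_monoE hw]
      have h2 := stepExp_excIdx e t (multAt S.last (germAt S.F))
      generalize excIdx t = i at h2
      fin_cases i <;> simp only [Fin.zero_eta, Fin.mk_one] at h2 <;> omega
    have := ((S.base _).mp hb).length_le
    simp at this
  obtain ⟨h1, i, h2⟩ :=
    h.transversal S.onePlace (h.pos_of_isBasePoint ((S.base _).mpr List.prefix_rfl)) hm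
  exact ⟨e, A, i, h, h1, h2⟩

theorem exists_shape_mult_le {q : Pt} (hq : q <+: S.last) :
    ∃ e A, PencilShape S.F S.d q e A ∧ multAt q (germAt S.F) ≤ e 0 + e 1 := by
  by_cases hl : q = S.last
  · subst hl
    obtain ⟨e, A, i, h, h1, h2, -⟩ := S.exists_shape_last
    refine ⟨e, A, h, ?_⟩
    rw [h1]
    fin_cases i <;> simp only [Fin.zero_eta, Fin.mk_one] at h2 <;> omega
  · obtain ⟨e, A, h⟩ := S.exists_shape hq
    refine ⟨e, A, h, ?_⟩
    obtain ⟨s, hs⟩ := hq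
    cases s with
    | nil => exact absurd (by simpa using hs) hl
    | cons t s =>
      refine (h.mult_lt S.onePlace (h.pos_of_isBasePoint ((S.base _).mpr ⟨_, hs⟩)) (t := t) ?_).le
      rw [S.base]
      exact ⟨s, by rw [← hs]; simp⟩

/-- The germ at `p` of the member `F + c Z ^ d` of the pencil. -/
def germ (c : ℂ) : Germ := germAt (PencilCone.member S.F S.d c)

theorem germ_zero : S.germ 0 = germAt S.F := by
  simp [germ, PencilCone.member]

/-- At the last base point, the members of the pencil differ by multiples of the equation of an axis,
hence they are all smooth and transversal to it. -/
theorem order_axis_member {e A : Fin 2 → ℕ} {i : Fin 2} (h : PencilShape S.F S.d S.last e A)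
    (hi : e i = 1) (ho : (axis i (strictAt S.last (germAt S.F))).order = 1) (c : ℂ) :
    mult (strictAt S.last (S.germ c)) = 1 ∧ (axis i (strictAt S.last (S.germ c))).order = 1 := by
  have hb := ((S.base S.last).mpr List.prefix_rfl).2
  have h0 : axis i (pencilAt S.F S.d S.last).2 = 0 := by
    obtain ⟨w, -, hw⟩ := h.snd
    rw [axis_eq_zero_iff, hw]
    refine Dvd.dvd.mul_left ?_ w
    rw [monoE]
    fin_cases i
    · exact (dvd_pow_self _ (by simp_all)).mul_right _
    · exact (dvd_pow_self _ (by simp_all)).mul_left _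
  have h1 : (axis i (strictAt S.last (S.germ c))).order = 1 := by
    rw [germ, h.member, map_add, map_mul, h0, mul_zero, add_zero, ho]
  refine ⟨?_, h1⟩
  have h2 := mult_le_order_axis i (strictAt S.last (S.germ c))
  rw [h1] at h2
  have h3 : strictAt S.last (S.germ c) ≠ 0 := by
    intro h4
    rw [h4, map_zero, PowerSeries.order_zero] at h1
    exact absurd h1 (by decide)
  have h4 := mult_pos_of_not_isUnit h3 (by
    rw [isUnit_iff, not_not, germ, h.member, map_add, map_mul, hb, mul_zero, add_zero]
    exact h.passes)
  have h5 : mult (strictAt S.last (S.germ c)) ≤ 1 := by exact_mod_cast h2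
  omega

theorem mult_last (c : ℂ) : mult (strictAt S.last (S.germ c)) = 1 := by
  obtain ⟨e, A, i, h, -, hi, -, ho⟩ := S.exists_shape_last
  exact (S.order_axis_member h hi ho c).1

theorem multAt_member (c : ℂ) {q : Pt} (hq : q <+: S.last) :
    multAt q (S.germ c) = multAt q (germAt S.F) := by
  obtain ⟨e, A, i, h, h1, hi, -, ho⟩ := S.exists_shape_last
  rcases hq.length_le.lt_or_eq with hl | hl
  · have := h.member_mult c _ hl
    rw [← List.prefix_iff_eq_take.mp hq] at this
    exact this
  · obtain rfl := hq.eq_of_length hl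
    rw [h1]
    exact S.mult_last c

/-- The members of the pencil leave the last base point through general points of its exceptional
curve. -/
theorem general_direction {c : ℂ} {t : Dir} (ht : PassesThrough (S.germ c) (S.last ++ [t])) :
    (∀ r, Proximate (S.last ++ [t]) r → r = S.last) ∧
      ¬ PassesThrough lineGerm (S.last ++ [t]) := by
  obtain ⟨e, A, i, h, h1, hi, hi', ho⟩ := S.exists_shape_last
  obtain ⟨hm, ho'⟩ := S.order_axis_member h hi ho c
  rw [PassesThrough, strictAt_concat] at ht
  have hti := ne_axisDir_of_order_axis ho' hm ht
  have key : ∀ j (q : Pt), (∀ l, strictAt q (X j) = X l → 0 < A l) →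
      ¬ PassesThrough (X j) (q ++ [t]) := by
    intro j q hA hp
    have h2 := strictAt_X hp.of_append
    have h3 := (h.pos_iff j).mpr (hA j h2)
    have hji : j = i := by
      by_contra hne
      have : j = oth i := by
        fin_cases i <;> fin_cases j <;> simp_all [oth]
      rw [this, hi'] at h3
      exact lt_irrefl _ h3
    rw [passesThrough_append, h2, passesThrough_X_cons] at hp
    exact hti (hji ▸ hp.1)
  constructor
  · rintro r ⟨s, q', hq, hp⟩
    rcases List.eq_nil_or_concat q' with rfl | ⟨q'', t', rfl⟩
    · exact (List.append_inj' hq rfl).1.symm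
    · rw [List.concat_eq_append] at hq hp
      have h5 : S.last ++ [t] = (r ++ s :: q'') ++ [t'] := by rw [hq]; simp
      obtain ⟨h6, h7⟩ := List.append_inj' h5 rfl
      obtain rfl := List.singleton_inj.mp h7
      exact absurd hp (key _ _ fun l hl => h.exc r s q'' l h6 hl)
  · exact key 0 S.last h.line

/-- The curve itself is a curvette at the last base point. -/
theorem isCurvette_last : IsCurvette (germAt S.F) S.last := by
  refine ⟨S.onePlace.unibranch, ?_⟩
  have hm := S.mult_last 0
  have hirr := irreducible_of_mult_eq_one hm
  obtain ⟨t, ht⟩ := exists_passes hm.ge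
  have hp : PassesThrough (S.germ 0) (S.last ++ [t]) := by
    rw [PassesThrough, strictAt_concat]; exact ht
  have ho := order_axis_strictStep hirr ht
  rw [hm, ← strictAt_concat, germ_zero] at ho
  exact ⟨t, intMult_X_eq ho, S.general_direction hp⟩

/-! ### The classes of the members of the pencil -/

/-- The index of the last base point. -/
def lastIdx : S.Idx := .inl (Fin.last S.last.length)

theorem pt_lastIdx : S.pt S.lastIdx = S.last := List.take_length

/-- The class of the moving part of the pencil on the blow-up of its base points. -/
def V : S.NS := S.D (fun _ => germAt S.F) S.lastIdx

theorem V_fst : S.V.1 = S.d := by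
  rw [V, D_fst, intMult_comm]
  exact congrArg _ (intMult_X_eq S.onePlace.order_axis_zero)

theorem V_snd_inl (x : Fin S.s₀) : S.V.2 (.inl x) = -multAt (S.pt (.inl x)) (germAt S.F) := by
  rw [V, D_snd, if_pos]
  rw [pt_lastIdx]
  exact List.take_prefix _ _

theorem V_snd_inr (x : Σ j : Fin S.k, Fin (S.s j)) : S.V.2 (.inr x) = 0 := by
  rw [V, D_snd, if_neg, neg_zero]
  intro h
  have := h.length_le
  rw [pt_lastIdx, length_pt_inr] at this
  omega

theorem D_last {φ : S.Idx → Germ} (h : IsCurvette (φ S.lastIdx) S.last) :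
    S.D φ S.lastIdx = S.V :=
  S.D_eq_of_curvette (by rw [pt_lastIdx]; exact h) (by rw [pt_lastIdx]; exact S.isCurvette_last)

/-- The class of the strict transform of the curve `C_j`. -/
def memberClass (j : Fin S.k) : S.NS := S.curveClass (PencilCone.member S.F S.d (S.c j)) S.d

theorem memberClass_fst (j : Fin S.k) : (S.memberClass j).1 = S.d := S.curveClass_fst _ _

theorem memberClass_snd_inl (j : Fin S.k) (x : Fin S.s₀) :
    (S.memberClass j).2 (.inl x) = S.V.2 (.inl x) := by
  rw [memberClass, curveClass_snd, V_snd_inl]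
  congr 2
  exact S.multAt_member (S.c j) (List.take_prefix _ _)

open Classical in
theorem memberClass_snd_inr (j : Fin S.k) (x : Σ j : Fin S.k, Fin (S.s j)) :
    (S.memberClass j).2 (.inr x) = if x.1 = j then -1 else 0 := by
  obtain ⟨j', ℓ⟩ := x
  rw [memberClass, curveClass_snd]
  have hm := S.mult_last (S.c j)
  have hmul : multAt (S.pt (.inr ⟨j', ℓ⟩)) (S.germ (S.c j)) =
      multAt ((S.tail j').take (ℓ + 1)) (strictAt S.last (S.germ (S.c j))) := by
    rw [multAt, multAt, pt_inr, strictAt_append]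
  change -(multAt (S.pt (.inr ⟨j', ℓ⟩)) (S.germ (S.c j)) : ℝ) = _
  rw [hmul]
  split_ifs with hj
  · change j' = j at hj
    subst hj
    rw [multAt_of_mult_eq_one hm (passesThrough_append.mp (S.passes j' ℓ)), Nat.cast_one]
  · rw [multAt_eq_zero, Nat.cast_zero, neg_zero]
    intro hp
    have h0 : 0 < (S.tail j).length := List.length_pos_iff.mpr (S.tail_ne_nil j)
    have h1 : PassesThrough (strictAt S.last (S.germ (S.c j))) ((S.tail j).take 1) :=
      passesThrough_append.mp (S.passes j ⟨0, h0⟩)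
    have h2 : PassesThrough (strictAt S.last (S.germ (S.c j))) ((S.tail j').take 1) :=
      hp.of_prefix (List.take_prefix_take_left (by omega))
    refine S.first_ne j' j hj
      (eq_of_passesThrough (irreducible_of_mult_eq_one hm) h2 h1 ?_)
    have h0' : 0 < (S.tail j').length := List.length_pos_iff.mpr (S.tail_ne_nil j')
    rw [List.length_take, List.length_take]
    omega

theorem inter_eq_of_snd_inr {x v w : S.NS} (hx : ∀ z, x.2 (.inr z) = 0) (h1 : v.1 = w.1)
    (h2 : ∀ z, v.2 (.inl z) = w.2 (.inl z)) : S.inter x v = S.inter x w := by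
  simp only [inter_apply, Fintype.sum_sum_type, hx, h1, h2, zero_mul]

theorem D_inl_snd_inr (φ : S.Idx → Germ) (i : Fin S.s₀) (z : Σ j : Fin S.k, Fin (S.s j)) :
    (S.D φ (.inl i)).2 (.inr z) = 0 := by
  rw [D_snd, if_neg, neg_zero]
  intro h
  have := h.length_le
  rw [length_pt_inl, length_pt_inr] at this
  have hi : (i : ℕ) < S.last.length + 1 := i.2
  omega

theorem inter_memberClass_eq {x : S.NS} (hx : ∀ z, x.2 (.inr z) = 0) (j : Fin S.k) :
    S.inter x (S.memberClass j) = S.inter x S.V :=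
  S.inter_eq_of_snd_inr hx (by rw [memberClass_fst, V_fst]) (S.memberClass_snd_inl j)

theorem sum_V_mul (i : Fin S.s₀) (φ : S.Idx → Germ) :
    S.inter (S.D φ (.inl i)) S.V = intMult lineGerm (φ (.inl i)) * S.d -
      ∑ ℓ ∈ Finset.range ((S.pt (.inl i)).length + 1),
        (multAt ((S.pt (.inl i)).take ℓ) (germAt S.F) : ℝ) *
          multAt ((S.pt (.inl i)).take ℓ) (φ (.inl i)) := by
  classical
  rw [inter_apply, D_fst, V_fst, ← S.sum_prefix (.inl i)
    fun r => (multAt r (germAt S.F) : ℝ) * multAt r (φ (.inl i))]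
  congr 1
  refine Finset.sum_congr rfl fun x _ => ?_
  rw [D_snd]
  by_cases h : S.pt x <+: S.pt (.inl i)
  · rw [if_pos h, if_pos h]
    rcases x with x | x
    · rw [V_snd_inl]
      ring
    · have := h.length_le
      rw [length_pt_inl, length_pt_inr] at this
      have hi : (i : ℕ) < S.last.length + 1 := i.2
      omega
  · rw [if_neg h, if_neg h, neg_zero, zero_mul]

/-- This intersection number is the order, along the curvette and after blowing up the point, of the
transform of `Z ^ d` in the pencil. -/
theorem inter_D_V_nonneg {φ : S.Idx → Germ} (i : Fin S.s₀)
    (h : IsCurvette (φ (.inl i)) (S.pt (.inl i))) : 0 ≤ S.inter (S.D φ (.inl i)) S.V := by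
  classical
  rw [sum_V_mul, sub_nonneg]
  obtain ⟨e, A, hs, hm⟩ := S.exists_shape_mult_le (q := S.pt (.inl i)) (List.take_prefix _ _)
  obtain ⟨t, hφ, hp, -, -, hL⟩ := h.exists_dir
  have ho := order_axis_eq_sum hφ hp hL
  have hn := hs.noether _ hφ hp.of_append
  have ht : constantCoeff (strictStep (strictAt (S.pt (.inl i)) (φ (.inl i))) t) = 0 := by
    rw [← strictAt_concat]; exact hp
  rw [wt_eq (irreducible_strictAt hφ hp.of_append) ht hm] at hn
  have hI : intMult lineGerm (φ (.inl i)) = _ := (intMult_comm _ _).trans (intMult_X_eq ho)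
  rw [ho, ← hI, ← add_assoc] at hn
  have h1 : ((∑ ℓ ∈ Finset.range ((S.pt (.inl i)).length + 1),
      multAt ((S.pt (.inl i)).take ℓ) (germAt S.F) *
        multAt ((S.pt (.inl i)).take ℓ) (φ (.inl i)) : ℕ) : ℕ∞) ≤
      ((S.d * intMult lineGerm (φ (.inl i)) : ℕ) : ℕ∞) := by
    rw [Nat.cast_mul S.d, hn, Finset.sum_range_succ, List.take_length, Nat.cast_add,
      Nat.cast_mul (multAt (S.pt (.inl i)) (germAt S.F))]
    exact le_self_add
  rw [mul_comm]
  exact_mod_cast h1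

/-- The moving part of the pencil has self-intersection zero. -/
theorem inter_V_V : S.inter S.V S.V = 0 := by
  obtain ⟨e, A, i, h, h1, hi, hi', ho⟩ := S.exists_shape_last
  have hn := h.noether _ S.onePlace.unibranch h.passes
  have hw : wt e (strictAt S.last (germAt S.F)) = 1 := by
    rw [wt]
    fin_cases i
    · have e0 : e 0 = 1 := hi
      have e1 : e 1 = 0 := hi'
      have o0 : (axis 0 (strictAt S.last (germAt S.F))).order = 1 := ho
      rw [e0, e1, o0]
      simp
    · have e1 : e 1 = 1 := hi
      have e0 : e 0 = 0 := hi'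
      have o1 : (axis 1 (strictAt S.last (germAt S.F))).order = 1 := ho
      rw [e0, e1, o1]
      simp
  rw [hw, S.onePlace.order_axis_zero] at hn
  have h2 : S.d * S.d = ∑ ℓ ∈ Finset.range (S.last.length + 1),
      multAt (S.last.take ℓ) (germAt S.F) * multAt (S.last.take ℓ) (germAt S.F) := by
    rw [Finset.sum_range_succ, List.take_length, h1]
    exact_mod_cast hn
  have h3 := S.sum_V_mul (Fin.last S.last.length) (fun _ => germAt S.F)
  have h4 : S.D (fun _ => germAt S.F) (.inl (Fin.last S.last.length)) = S.V := rfl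
  have h5 : S.pt (.inl (Fin.last S.last.length)) = S.last := S.pt_lastIdx
  have h6 : (intMult lineGerm (germAt S.F) : ℝ) = S.d := by
    rw [← S.V_fst, V, D_fst]
  rw [h4, h5, h6] at h3
  rw [h3, sub_eq_zero]
  exact_mod_cast h2

/-! ### The additional points -/

/-- The index of the point preceding an additional point. -/
def predIdx (j : Fin S.k) (ℓ : Fin (S.s j)) : S.Idx :=
  if h : (ℓ : ℕ) = 0 then S.lastIdx else .inr ⟨j, ⟨ℓ - 1, by omega⟩⟩

theorem exists_pt_inr_eq (j : Fin S.k) (ℓ : Fin (S.s j)) :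
    ∃ t, S.pt (.inr ⟨j, ℓ⟩) = S.pt (S.predIdx j ℓ) ++ [t] := by
  have hlt : (ℓ : ℕ) < (S.tail j).length := ℓ.2
  refine ⟨(S.tail j)[(ℓ : ℕ)], ?_⟩
  have h1 : S.pt (S.predIdx j ℓ) = S.last ++ (S.tail j).take ℓ := by
    rw [predIdx]
    split_ifs with h
    · rw [pt_lastIdx, h, List.take_zero, List.append_nil]
    · rw [pt_inr]
      congr 2
      change (ℓ : ℕ) - 1 + 1 = ℓ
      omega
  rw [h1, pt_inr, List.append_assoc, List.take_append_getElem]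

theorem proximate_inr_iff (j : Fin S.k) (ℓ : Fin (S.s j)) (r : S.Idx) :
    Proximate (S.pt (.inr ⟨j, ℓ⟩)) (S.pt r) ↔ S.predIdx j ℓ = r := by
  obtain ⟨t, ht⟩ := S.exists_pt_inr_eq j ℓ
  have hp : Proximate (S.pt (.inr ⟨j, ℓ⟩)) (S.pt (S.predIdx j ℓ)) := by
    rw [ht]
    exact proximate_concat _ _
  constructor
  · intro h
    exact S.pt_injective (S.free j ℓ _ _ hp h)
  · rintro rfl
    exact hp

theorem not_passesThrough_lineGerm (j : Fin S.k) (ℓ : Fin (S.s j)) :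
    ¬ PassesThrough lineGerm (S.pt (.inr ⟨j, ℓ⟩)) := by
  intro h
  have h0 : 0 < (S.tail j).length := List.length_pos_iff.mpr (S.tail_ne_nil j)
  obtain ⟨t, ht⟩ := S.exists_pt_inr_eq j ⟨0, h0⟩
  have h1 : S.predIdx j ⟨0, h0⟩ = S.lastIdx := dif_pos rfl
  rw [h1, pt_lastIdx] at ht
  have h2 : PassesThrough (S.germ (S.c j)) (S.last ++ [t]) := by
    rw [← ht]
    exact S.passes j ⟨0, h0⟩
  refine (S.general_direction h2).2 (h.of_prefix ?_)
  rw [← ht, pt_inr, pt_inr, List.prefix_append_right_inj]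
  exact List.take_prefix_take_left (by simp)

theorem inter_excTotal (x : S.NS) (q : S.Idx) : S.inter x (S.excTotal q) = -x.2 q := by
  classical
  rw [inter_apply, excTotal_fst]
  simp only [excTotal_snd]
  simp [-Fintype.sum_sum_type]

open Classical in
theorem inter_excTotal_inr_excStrict (j : Fin S.k) (ℓ : Fin (S.s j)) (r : S.Idx) :
    S.inter (S.excTotal (.inr ⟨j, ℓ⟩)) (S.excStrict r) =
      (if S.predIdx j ℓ = r then 1 else 0) - if .inr ⟨j, ℓ⟩ = r then 1 else 0 := by
  rw [inter_comm, inter_excTotal, excStrict_snd, if_congr (S.proximate_inr_iff j ℓ r) rfl rfl,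
    neg_sub]

/-- The additional points are free and do not lie on the line at infinity, so that each of them only
subtracts the class of its exceptional divisor. -/
theorem D_inr_eq {φ : S.Idx → Germ} (hφ : ∀ q, IsCurvette (φ q) (S.pt q)) (j : Fin S.k)
    (ℓ : Fin (S.s j)) :
    S.D φ (.inr ⟨j, ℓ⟩) = S.D φ (S.predIdx j ℓ) - S.excTotal (.inr ⟨j, ℓ⟩) := by
  classical
  refine S.ext_inter ?_ fun r => ?_
  · rw [map_sub, LinearMap.sub_apply, S.inter_D_lineStrict (hφ _), S.inter_D_lineStrict (hφ _),
      inter_comm, inter_excTotal, lineStrict, curveClass_snd, germAt_X_two]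
    have := multAt_eq_zero (S.not_passesThrough_lineGerm j ℓ)
    rw [lineGerm] at this
    rw [this]
    simp
  · rw [map_sub, LinearMap.sub_apply, S.inter_D_excStrict (hφ _), S.inter_D_excStrict (hφ _),
      inter_excTotal_inr_excStrict]
    ring

open Classical in
theorem inter_D_inr_memberClass {φ : S.Idx → Germ} (hφ : ∀ q, IsCurvette (φ q) (S.pt q))
    (j j' : Fin S.k) (ℓ : Fin (S.s j)) : S.inter (S.D φ (.inr ⟨j, ℓ⟩)) (S.memberClass j') =
      if j = j' then -((ℓ : ℝ) + 1) else 0 := by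
  obtain ⟨n, hn⟩ := ℓ
  induction n with
  | zero =>
    rw [S.D_inr_eq hφ, map_sub, LinearMap.sub_apply, S.inter_comm (S.excTotal _), inter_excTotal,
      memberClass_snd_inr]
    have h1 : S.predIdx j ⟨0, hn⟩ = S.lastIdx := dif_pos rfl
    rw [h1, S.D_last (by have := hφ S.lastIdx; rwa [pt_lastIdx] at this),
      S.inter_memberClass_eq S.V_snd_inr, inter_V_V]
    change 0 - -(if j = j' then _ else _) = _
    split_ifs <;> simp
  | succ n ih =>
    rw [S.D_inr_eq hφ, map_sub, LinearMap.sub_apply, S.inter_comm (S.excTotal _), inter_excTotal,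
      memberClass_snd_inr]
    have h1 : S.predIdx j ⟨n + 1, hn⟩ = .inr ⟨j, ⟨n, by omega⟩⟩ := dif_neg (by simp)
    rw [h1, ih]
    change _ - -(if j = j' then _ else _) = _
    split_ifs
    · push_cast
      ring
    · simp

/-! ### The dual cone -/

theorem mem_dualP_iff {x : S.NS} : x ∈ S.dualP ↔ 0 ≤ S.inter x S.lineStrict ∧
    (∀ j, 0 ≤ S.inter x (S.memberClass j)) ∧ ∀ q, 0 ≤ S.inter x (S.excStrict q) := by
  rw [dualP, P, PointedCone.dual_hull, PointedCone.mem_dual]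
  constructor
  · intro h
    refine ⟨?_, fun j => ?_, fun q => ?_⟩
    · rw [inter_comm]
      exact h (Or.inl (Or.inl rfl))
    · rw [inter_comm]
      exact h (Or.inl (Or.inr ⟨j, rfl⟩))
    · rw [inter_comm]
      exact h (Or.inr ⟨q, rfl⟩)
  · rintro ⟨h1, h2, h3⟩ y ((hy | ⟨j, rfl⟩) | ⟨q, rfl⟩)
    · obtain rfl := Set.mem_singleton_iff.mp hy
      rw [inter_comm]
      exact h1
    · rw [inter_comm]
      exact h2 j
    · rw [inter_comm]
      exact h3 q

variable {S} {φ : S.Idx → Germ}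

theorem D0_zero : S.D0 φ 0 = S.lineClass := rfl

theorem D0_succ (i : Fin S.s₀) : S.D0 φ i.succ = S.D φ (.inl i) := rfl

theorem D0_snd_inr (m : Fin (S.s₀ + 1)) (z : Σ j : Fin S.k, Fin (S.s j)) :
    (S.D0 φ m).2 (.inr z) = 0 := by
  cases m using Fin.cases with
  | zero => rfl
  | succ i => exact S.D_inl_snd_inr φ i z

theorem D0_last (hφ : ∀ q, IsCurvette (φ q) (S.pt q)) : S.D0 φ (Fin.last S.s₀) = S.V :=
  S.D_last (by have := hφ S.lastIdx; rwa [pt_lastIdx] at this)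

theorem a_eq (hφ : ∀ q, IsCurvette (φ q) (S.pt q))
    (m : Fin (S.s₀ + 1)) : S.a φ m = S.inter (S.D0 φ m) S.V := by
  rw [a, D0_last hφ]

theorem a_last (hφ : ∀ q, IsCurvette (φ q) (S.pt q)) : S.a φ (Fin.last S.s₀) = 0 := by
  rw [a_eq hφ, D0_last hφ, inter_V_V]

theorem a_nonneg (hφ : ∀ q, IsCurvette (φ q) (S.pt q))
    (m : Fin (S.s₀ + 1)) : 0 ≤ S.a φ m := by
  rw [a_eq hφ]
  cases m using Fin.cases with
  | zero =>
    rw [D0_zero, inter_apply, lineClass_fst, V_fst]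
    simp [lineClass_snd]
  | succ i => exact S.inter_D_V_nonneg i (hφ _)

theorem inter_D0_memberClass (hφ : ∀ q, IsCurvette (φ q) (S.pt q))
    (m : Fin (S.s₀ + 1)) (j : Fin S.k) :
    S.inter (S.D0 φ m) (S.memberClass j) = S.a φ m := by
  rw [S.inter_memberClass_eq (D0_snd_inr m), a_eq hφ]

theorem inter_D0_lineStrict_nonneg (hφ : ∀ q, IsCurvette (φ q) (S.pt q))
    (m : Fin (S.s₀ + 1)) :
    0 ≤ S.inter (S.D0 φ m) S.lineStrict := by
  cases m using Fin.cases with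
  | zero => rw [D0_zero, inter_lineClass_lineStrict]; exact zero_le_one
  | succ i => rw [D0_succ, S.inter_D_lineStrict (hφ _)]

theorem inter_D_excStrict_nonneg (hφ : ∀ q, IsCurvette (φ q) (S.pt q))
    (q r : S.Idx) : 0 ≤ S.inter (S.D φ q) (S.excStrict r) := by
  classical
  rw [S.inter_D_excStrict (hφ q)]
  split_ifs
  · exact zero_le_one
  · exact le_rfl

theorem inter_D0_excStrict_nonneg (hφ : ∀ q, IsCurvette (φ q) (S.pt q))
    (m : Fin (S.s₀ + 1)) (r : S.Idx) :
    0 ≤ S.inter (S.D0 φ m) (S.excStrict r) := by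
  cases m using Fin.cases with
  | zero => rw [D0_zero, inter_lineClass_excStrict]
  | succ i => exact inter_D_excStrict_nonneg hφ _ r

theorem D0_mem_dualP (hφ : ∀ q, IsCurvette (φ q) (S.pt q))
    (m : Fin (S.s₀ + 1)) : S.D0 φ m ∈ S.dualP := by
  rw [mem_dualP_iff]
  refine ⟨inter_D0_lineStrict_nonneg hφ m, fun j => ?_, inter_D0_excStrict_nonneg hφ m⟩
  rw [inter_D0_memberClass hφ]
  exact a_nonneg hφ m

theorem prodL_pos (J : Finset (Fin S.k)) (ℓ : (j : J) → Fin (S.s j)) : 0 < S.prodL J ℓ :=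
  Finset.prod_pos fun j _ => by positivity

theorem DJ_mem_dualP (hφ : ∀ q, IsCurvette (φ q) (S.pt q))
    (J : Finset (Fin S.k)) (ℓ : (j : J) → Fin (S.s j)) (m : Fin (S.s₀ + 1)) :
    S.DJ φ J ℓ m ∈ S.dualP := by
  classical
  have hP := prodL_pos J ℓ
  have ha := a_nonneg hφ m
  have hinter : ∀ y, S.inter (S.DJ φ J ℓ m) y =
      S.a φ m * ∑ j : J, S.prodL J ℓ / ((ℓ j : ℕ) + 1 : ℝ) * S.inter (S.D φ (.inr ⟨j, ℓ j⟩)) y +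
        S.prodL J ℓ * S.inter (S.D0 φ m) y := by
    intro y
    simp [DJ]
  rw [mem_dualP_iff]
  refine ⟨?_, fun j => ?_, fun q => ?_⟩
  · rw [hinter]
    simp only [S.inter_D_lineStrict (hφ _), mul_zero, Finset.sum_const_zero, zero_add]
    exact mul_nonneg hP.le (inter_D0_lineStrict_nonneg hφ m)
  · rw [hinter, inter_D0_memberClass hφ]
    have hterm : ∀ i : J, S.prodL J ℓ / ((ℓ i : ℕ) + 1 : ℝ) *
        S.inter (S.D φ (.inr ⟨i, ℓ i⟩)) (S.memberClass j) =
        if (i : Fin S.k) = j then -S.prodL J ℓ else 0 := by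
      intro i
      rw [S.inter_D_inr_memberClass hφ]
      split_ifs
      · have : ((ℓ i : ℕ) + 1 : ℝ) ≠ 0 := by positivity
        field_simp
      · rw [mul_zero]
    rw [Finset.sum_congr rfl fun i _ => hterm i]
    by_cases hj : j ∈ J
    · rw [Finset.sum_eq_single (⟨j, hj⟩ : J), if_pos rfl]
      · linarith [mul_comm (S.a φ m) (S.prodL J ℓ)]
      · intro i _ hi
        rw [if_neg fun h => hi (Subtype.ext h)]
      · intro h
        exact absurd (Finset.mem_univ _) h
    · rw [Finset.sum_eq_zero, mul_zero, zero_add]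
      · positivity
      · intro i _
        rw [if_neg]
        rintro rfl
        exact hj i.2
  · rw [hinter]
    refine add_nonneg (mul_nonneg ha (Finset.sum_nonneg fun i _ => ?_))
      (mul_nonneg hP.le (inter_D0_excStrict_nonneg hφ m q))
    exact mul_nonneg (by positivity) (inter_D_excStrict_nonneg hφ _ q)

/-- The generators of the dual cone. -/
def gens (S : Config) (φ : S.Idx → Germ) : Set S.NS :=
  {x : S.NS | ∃ m : Fin (S.s₀ + 1), x = S.D0 φ m} ∪
    {x : S.NS | ∃ (J : Finset (Fin S.k)) (ℓ : (j : J) → Fin (S.s j)) (m : Fin S.s₀),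
      J.Nonempty ∧ x = S.DJ φ J ℓ m.castSucc}

theorem smul_mem_hull {x : S.NS} {r : ℝ} (hr : 0 ≤ r)
    (hx : x ∈ PointedCone.hull ℝ (S.gens φ)) : r • x ∈ PointedCone.hull ℝ (S.gens φ) :=
  Submodule.smul_mem _ (⟨r, hr⟩ : NNReal) hx

theorem D0_mem_hull (m : Fin (S.s₀ + 1)) : S.D0 φ m ∈ PointedCone.hull ℝ (S.gens φ) :=
  PointedCone.subset_hull (Or.inl ⟨m, rfl⟩)

/-- The extremal choices, for each chain of additional points: no point at all, or one point, the
class `D` being normalized to have intersection `-1` with the curve of the chain. -/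
def choices (S : Config) (φ : S.Idx → Germ) (j : Fin S.k) : Set S.NS :=
  insert 0 (Set.range fun ℓ : Fin (S.s j) => ((ℓ : ℝ) + 1)⁻¹ • S.D φ (.inr ⟨j, ℓ⟩))

/-- A choice of points is a tuple indexed by the set `J` of the chains where a point is chosen, and
gives a positive multiple of a class `D_{0 m}^{J, ℓ}`. -/
theorem add_sum_choices_mem_hull (m : Fin S.s₀) {w : Fin S.k → S.NS}
    (hw : ∀ j, w j ∈ S.choices φ j) :
    S.D0 φ m.castSucc + S.a φ m.castSucc • ∑ j, w j ∈ PointedCone.hull ℝ (S.gens φ) := by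
  classical
  obtain ⟨J, hJ⟩ : ∃ J : Finset (Fin S.k), J = Finset.univ.filter fun j => w j ≠ 0 := ⟨_, rfl⟩
  have hex : ∀ j : J, ∃ ℓ : Fin (S.s j), ((ℓ : ℝ) + 1)⁻¹ • S.D φ (.inr ⟨j, ℓ⟩) = w j := by
    rintro ⟨j, hj⟩
    rw [hJ, Finset.mem_filter] at hj
    exact (hw j).resolve_left hj.2
  choose ℓ hℓ using hex
  have hsum : ∑ j, w j = ∑ j : J, ((ℓ j : ℝ) + 1)⁻¹ • S.D φ (.inr ⟨j, ℓ j⟩) := by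
    rw [Finset.sum_congr rfl fun j _ => hℓ j, Finset.sum_coe_sort J w]
    refine (Finset.sum_subset (Finset.subset_univ J) fun j _ hj => ?_).symm
    by_contra h
    exact hj (by rw [hJ, Finset.mem_filter]; exact ⟨Finset.mem_univ _, h⟩)
  rcases J.eq_empty_or_nonempty with h0 | h0
  · have : ∑ j, w j = 0 := by
      refine Finset.sum_eq_zero fun j _ => ?_
      by_contra h
      have hj : j ∈ J := by rw [hJ, Finset.mem_filter]; exact ⟨Finset.mem_univ _, h⟩
      rw [h0] at hj
      exact absurd hj (Finset.notMem_empty j)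
    rw [this, smul_zero, add_zero]
    exact D0_mem_hull _
  · have hP := prodL_pos J ℓ
    have hDJ : S.D0 φ m.castSucc + S.a φ m.castSucc • ∑ j, w j =
        (S.prodL J ℓ)⁻¹ • S.DJ φ J ℓ m.castSucc := by
      have hkey : (S.prodL J ℓ)⁻¹ • ∑ j : J,
          (S.prodL J ℓ / ((ℓ j : ℕ) + 1 : ℝ)) • S.D φ (.inr ⟨j, ℓ j⟩) = ∑ j, w j := by
        rw [hsum, Finset.smul_sum]
        refine Finset.sum_congr rfl fun j _ => ?_
        rw [smul_smul, div_eq_mul_inv, inv_mul_cancel_left₀ hP.ne']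
      rw [← hkey, DJ, smul_add, smul_smul (S.prodL J ℓ)⁻¹ (S.prodL J ℓ), inv_mul_cancel₀ hP.ne',
        one_smul, add_comm, smul_comm]
    rw [hDJ]
    exact smul_mem_hull (inv_nonneg.mpr hP.le) (PointedCone.subset_hull (Or.inr ⟨J, ℓ, m, h0, rfl⟩))

/-- The convex hull of a product of finite sets is the product of the convex hulls, so that one may
pass to convex combinations in each chain independently. -/
theorem add_sum_mem_hull (m : Fin S.s₀) {v : Fin S.k → S.NS}
    (hv : ∀ j, v j ∈ convexHull ℝ (S.choices φ j)) :
    S.D0 φ m.castSucc + S.a φ m.castSucc • ∑ j, v j ∈ PointedCone.hull ℝ (S.gens φ) := by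
  have h1 : v ∈ convexHull ℝ (Set.univ.pi (S.choices φ)) :=
    mem_convexHull_pi fun j _ => hv j
  have h2 : Convex ℝ {w : Fin S.k → S.NS |
      S.D0 φ m.castSucc + S.a φ m.castSucc • ∑ j, w j ∈ PointedCone.hull ℝ (S.gens φ)} := by
    intro w hw w' hw' α β hα hβ hαβ
    have h3 := Submodule.add_mem _ (smul_mem_hull hα hw) (smul_mem_hull hβ hw')
    have h4 : S.D0 φ m.castSucc + S.a φ m.castSucc • ∑ j, (α • w + β • w') j =
        α • (S.D0 φ m.castSucc + S.a φ m.castSucc • ∑ j, w j) +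
          β • (S.D0 φ m.castSucc + S.a φ m.castSucc • ∑ j, w' j) := by
      simp only [Pi.add_apply, Pi.smul_apply, Finset.sum_add_distrib, ← Finset.smul_sum]
      obtain rfl : β = 1 - α := by linarith
      module
    change S.D0 φ m.castSucc + S.a φ m.castSucc • ∑ j, (α • w + β • w') j ∈
      PointedCone.hull ℝ (S.gens φ)
    rw [h4]
    exact h3
  exact convexHull_min (fun w hw => add_sum_choices_mem_hull m fun j =>
    Set.mem_univ_pi.mp hw j) h2 h1

theorem mem_convexHull_choices (j : Fin S.k) {y : Fin (S.s j) → ℝ} {c : ℝ} (hc : 0 < c)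
    (hy : ∀ ℓ, 0 ≤ y ℓ) (hsum : ∑ ℓ : Fin (S.s j), ((ℓ : ℝ) + 1) * y ℓ ≤ c) :
    ∑ ℓ, (y ℓ / c) • S.D φ (.inr ⟨j, ℓ⟩) ∈ convexHull ℝ (S.choices φ j) := by
  have hconv := convex_convexHull ℝ (S.choices φ j)
  have h0 : (0 : S.NS) ∈ convexHull ℝ (S.choices φ j) := subset_convexHull _ _ (Or.inl rfl)
  have h1 := hconv.sum_mem (t := (Finset.univ : Finset (Option (Fin (S.s j)))))
    (w := fun o => o.elim (1 - ∑ ℓ : Fin (S.s j), ((ℓ : ℝ) + 1) * y ℓ / c) fun ℓ => ((ℓ : ℝ) + 1) * y ℓ / c)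
    (z := fun o => o.elim 0 fun ℓ => ((ℓ : ℝ) + 1)⁻¹ • S.D φ (.inr ⟨j, ℓ⟩)) ?_ ?_ ?_
  · rw [Fintype.sum_option] at h1
    simp only [Option.elim_none, Option.elim_some, smul_zero, zero_add, smul_smul] at h1
    convert h1 using 4 with ℓ
    have : ((ℓ : ℝ) + 1) ≠ 0 := by positivity
    field_simp
  · rintro (_ | ℓ) _
    · change 0 ≤ 1 - _
      rw [← Finset.sum_div, sub_nonneg, div_le_one hc]
      exact hsum
    · have := hy ℓ
      change 0 ≤ ((ℓ : ℝ) + 1) * y ℓ / c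
      positivity
  · rw [Fintype.sum_option]
    simp
  · rintro (_ | ℓ) _
    · exact h0
    · exact subset_convexHull _ _ (Or.inr ⟨ℓ, rfl⟩)

/-- Coordinates of a class with respect to the classes `D`. -/
theorem eq_sum_D0_add (hφ : ∀ q, IsCurvette (φ q) (S.pt q)) (x : S.NS) :
    ∃ y : Fin (S.s₀ + 1) → ℝ, y 0 = S.inter x S.lineStrict ∧
      (∀ i : Fin S.s₀, y i.succ = S.inter x (S.excStrict (.inl i))) ∧
      x = ∑ m, y m • S.D0 φ m +
        ∑ j, ∑ ℓ, S.inter x (S.excStrict (.inr ⟨j, ℓ⟩)) • S.D φ (.inr ⟨j, ℓ⟩) := by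
  refine ⟨Fin.cons (S.inter x S.lineStrict) fun i => S.inter x (S.excStrict (.inl i)), rfl,
    fun i => rfl, ?_⟩
  rw [Fin.sum_univ_succ]
  conv_lhs => rw [S.eq_sum_D hφ x, Fintype.sum_sum_type, Fintype.sum_sigma, ← add_assoc]
  rfl

/-- A class `x` of the dual cone is a combination of the classes `D` with nonnegative coefficients.
The condition `x · C_j ≥ 0` bounds by `c = ∑ y_m a_m` the weighted sum of the coefficients along the
`j`-th chain, which is therefore `c` times a convex combination of the extremal choices. -/
theorem mem_hull_of_mem_dualP (hφ : ∀ q, IsCurvette (φ q) (S.pt q)) {x : S.NS}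
    (hx : x ∈ S.dualP) : x ∈ PointedCone.hull ℝ (S.gens φ) := by
  classical
  obtain ⟨hL, hC, hE⟩ := S.mem_dualP_iff.mp hx
  obtain ⟨y, hy0, hys, hxy⟩ := eq_sum_D0_add hφ x
  have hy : ∀ m, 0 ≤ y m := by
    intro m
    cases m using Fin.cases with
    | zero => rw [hy0]; exact hL
    | succ i => rw [hys]; exact hE _
  obtain ⟨z, hz⟩ : ∃ z : (j : Fin S.k) → Fin (S.s j) → ℝ,
      ∀ j ℓ, z j ℓ = S.inter x (S.excStrict (.inr ⟨j, ℓ⟩)) := ⟨_, fun _ _ => rfl⟩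
  have hz0 : ∀ j ℓ, 0 ≤ z j ℓ := fun j ℓ => by rw [hz]; exact hE _
  simp only [← hz] at hxy
  obtain ⟨c, hc⟩ : ∃ c, c = ∑ m, y m * S.a φ m := ⟨_, rfl⟩
  have hCc : ∀ j, ∑ ℓ : Fin (S.s j), ((ℓ : ℝ) + 1) * z j ℓ ≤ c := by
    intro j
    have h1 := hC j
    rw [hxy, map_add, LinearMap.add_apply, map_sum, map_sum, LinearMap.sum_apply,
      LinearMap.sum_apply] at h1
    simp only [map_sum, map_smul, LinearMap.sum_apply, LinearMap.smul_apply, smul_eq_mul,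
      inter_D0_memberClass hφ, S.inter_D_inr_memberClass hφ] at h1
    rw [← hc, Finset.sum_eq_single j] at h1
    · simp only [if_true, mul_neg, Finset.sum_neg_distrib] at h1
      have h2 : ∑ ℓ : Fin (S.s j), ((ℓ : ℝ) + 1) * z j ℓ = ∑ ℓ : Fin (S.s j), z j ℓ * ((ℓ : ℝ) + 1) :=
        Finset.sum_congr rfl fun ℓ _ => mul_comm _ _
      rw [h2]
      linarith
    · intro i _ hi
      simp [hi]
    · intro h
      exact absurd (Finset.mem_univ j) h
  have hc0 : 0 ≤ c := hc ▸ Finset.sum_nonneg fun m _ => mul_nonneg (hy m) (a_nonneg hφ m)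
  -- if `c = 0`, the additional points do not contribute
  rcases hc0.eq_or_lt with hc0 | hc0
  · have hzz : ∀ j ℓ, z j ℓ = 0 := by
      intro j ℓ
      have h1 := hCc j
      rw [← hc0] at h1
      have h2 := Finset.single_le_sum (f := fun ℓ : Fin (S.s j) => ((ℓ : ℝ) + 1) * z j ℓ)
        (fun i _ => mul_nonneg (by positivity) (hz0 j i)) (Finset.mem_univ ℓ)
      have h3 : ((ℓ : ℝ) + 1) * z j ℓ ≤ 0 := h2.trans h1
      have h4 : (0 : ℝ) < (ℓ : ℝ) + 1 := by positivity
      exact le_antisymm (nonpos_of_mul_nonpos_right h3 h4) (hz0 j ℓ)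
    rw [hxy]
    simp only [hzz, zero_smul, Finset.sum_const_zero, add_zero]
    exact Submodule.sum_mem _ fun m _ => smul_mem_hull (hy m) (D0_mem_hull m)
  · have hv : ∀ j, ∑ ℓ, (z j ℓ / c) • S.D φ (.inr ⟨j, ℓ⟩) ∈ convexHull ℝ (S.choices φ j) :=
      fun j => mem_convexHull_choices j hc0 (hz0 j) (hCc j)
    have hxe : x = ∑ m, y m • (S.D0 φ m +
        S.a φ m • ∑ j, ∑ ℓ, (z j ℓ / c) • S.D φ (.inr ⟨j, ℓ⟩)) := by
      simp only [smul_add, Finset.sum_add_distrib, smul_smul]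
      rw [← Finset.sum_smul, ← hc, Finset.smul_sum]
      simp only [Finset.smul_sum, smul_smul, mul_div_cancel₀ _ hc0.ne']
      exact hxy
    rw [hxe]
    refine Submodule.sum_mem _ fun m _ => smul_mem_hull (hy m) ?_
    cases m using Fin.lastCases with
    | last =>
      rw [a_last hφ, zero_smul, add_zero]
      exact D0_mem_hull _
    | cast m => exact add_sum_mem_hull m hv

end Config

end

end PencilCone

theorem proposition3p2 (S : PencilCone.Config)
    (φ : S.Idx → PencilCone.Germ)
    (hφ : ∀ q : S.Idx, PencilCone.IsCurvette (φ q) (S.pt q)) :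
    S.dualP = PointedCone.hull ℝ
      ({x : S.NS | ∃ m : Fin (S.s₀ + 1), x = S.D0 φ m} ∪
       {x : S.NS | ∃ (J : Finset (Fin S.k)) (ℓ : (j : J) → Fin (S.s j)) (m : Fin S.s₀),
          J.Nonempty ∧ x = S.DJ φ J ℓ m.castSucc}) := by
  refine le_antisymm (fun x hx => PencilCone.Config.mem_hull_of_mem_dualP hφ hx) ?_
  refine Submodule.span_le.mpr ?_
  rintro x (⟨m, rfl⟩ | ⟨J, ℓ, m, -, rfl⟩)
  · exact PencilCone.Config.D0_mem_dualP hφ m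
  · exact PencilCone.Config.DJ_mem_dualP hφ J ℓ m.castSucc
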